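/- **Setting.** Let $\Phi$ be an irreducible (reduced, crystallographic) root system spanning the real vector space $V$, with positive roots $\Phi^+$, $N=|\Phi^+|$, simple roots $\alpha_1,\dots,\alpha_r$, Weyl group $W$ with length function $\ell$ (with respect to the simple reflections), and weight lattice $\Lambda=\{x\in V:(x,\alpha^\vee)\in\mathbb Z\ \forall\alpha\in\Phi\}$. For $u,w\in W$ write $u\gtrdot w$ if $w=us_\beta$ for some $\beta\in\Phi^+$ and $\ell(u)=\ell(w)+1$; a saturated chain in the Bruhat order is a chain for this covering relation. Let $H_{\alpha,k}=\{x:(x,\alpha^\vee)=k\}$ $(\alpha\in\Phi,k\in\mathbb Z)$, let $s_{\alpha,k}(x)=x-((x,\alpha^\vee)-k)\alpha$, and let $W_{\rm aff}$ be the group generated by all $s_{\alpha,k}$. For an affine reflection $r=s_{\alpha,k}$ put $\bar r=s_\alpha\in W$. Alcoves are the connected components of $V\setminus\bigcup H_{\alpha,k}$, and $A_\circ=\{x:0<(x,\alpha^\vee)<1\ \forall\alpha\in\Phi^+\}$. **Galleries.** A *gallery* of weight $\mu\in\Lambda$ and length $l$ is a sequence $\gamma=(F_0,A_0,F_1,A_1,\dots,F_l,A_l,F_{l+1})$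 where $A_0,\dots,A_l$ are alcoves, $F_j$ is a common codimension one face of $A_{j-1}$ and $A_j$ for $1\le j\le l$ (possibly $A_{j-1}=A_j$; $\gamma$ is unfolded if this never happens), $F_0=\{0\}$ is a vertex of $A_0$, and $F_{l+1}=\{\mu\}$ is a vertex of $A_l$. Let $r_j$ be the affine reflection in the hyperplane containing $F_j$, $1\le j\le l$. The gallery is *reduced* if $A_0=A_\circ$ and $l$ is minimal among all galleries of weight $\mu$ starting at $A_\circ$. It is *special* if $l\ge N$ and $0$ lies in the closure of each of $A_0,\dots,A_N$ and $F_1,\dots,F_N$. The tail-flip $f_j$ keeps $F_0,A_0,\dots,A_{j-1},F_j$ and applies $r_j$ to $A_j,F_{j+1},\dots,A_l,F_{l+1}$. An *admissible folding* of an unfolded gallery $\gamma$ is a gallery $f_{j_1}\cdots f_{j_s}(\gamma)$ with $s\ge0$, $1\le j_1<\dots<j_s\le l$, such that $1\lessdot\bar r_{j_1}\lessdot\bar r_{j_1}\bar r_{j_2}\lessdot\cdots\lessdot\bar r_{j_1}\cdots\bar r_{j_s}$. For a special gallery $\gamma$ of weight $-\mu$ let $$t(\gamma)=(F_{l+1}+\mu,\,A_l+\mu,\,F_l+\mu,\dots,F_{N+1}+\mu,\,A_N+\mu,\,F_0+\mu).$$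 **LS-galleries.** Let $H_i=H_{\alpha_i,0}$ for $1\le i\le r$ and $H_0=H_{\theta,1}$, where $\theta^\vee$ is the highest coroot. The type of a face $F$ is $\{i: F'\subset H_i\}$, where $F'$ is the unique face of $A_\circ$ in the $W_{\rm aff}$-orbit of $F$ (alcoves have type $\emptyset$), and the type of a gallery is the sequence of the types of its terms. If $\{j_1<\dots<j_s\}=\{j:A_{j-1}=A_j\}$, the *companion* of the gallery is the sequence $(u_0,\dots,u_s)$ in $W$ with $u_0(A_\circ)=A_0$ and $u_i=\bar r_{j_i}u_{i-1}$. A gallery of weight $\lambda$ is *minimal* if it is unfolded and crosses only hyperplanes $H_{\alpha,k}$ strictly separating $0$ and $\lambda$. For a minimal gallery $\gamma$ of dominant regular weight, $\Gamma_{LS}(\gamma)$ is the set of all galleries with the same type as $\gamma$ whose companion satisfies $u_0\gtrdot u_1\gtrdot\cdots\gtrdot u_s$. **Proposition.** Let $\lambda\in\Lambda$ be a dominant regular weight, i.e. $(\lambda,\alpha^\vee)>0$ for all $\alpha\in\Phi^+$, and let $\gamma$ be a special reduced gallery of weight $-\lambda$. Then every admissible folding of $\gamma$ is a special gallery, $t(\gamma)$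 is a minimal gallery of weight $\lambda$, and the map $\gamma'\mapsto t(\gamma')$ is a bijection from the set of admissible foldings of $\gamma$ onto $\Gamma_{LS}(t(\gamma))$. Moreover, $\mathrm{weight}(t(\gamma'))=-\mathrm{weight}(\gamma')$ for every admissible folding $\gamma'$ of $\gamma$. -/

import Mathlib

noncomputable section

namespace Alcoves

variable {ι V V' : Type*} [AddCommGroup V] [Module ℝ V] [AddCommGroup V'] [Module ℝ V']

/-! ### Weights, affine hyperplanes and affine reflections

`V` is the real span of the roots and `P.coroot' α x` is the pairing `(x, α^∨)`. -/

/-- The weight lattice. -/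
def IsWeight (P : RootPairing ι ℝ V V') (x : V) : Prop :=
  ∀ α : ι, ∃ k : ℤ, P.coroot' α x = k

def IsDominant {P : RootPairing ι ℝ V V'} (b : P.Base) (x : V) : Prop :=
  ∀ α : ι, b.IsPos α → 0 ≤ P.coroot' α x

/-- A vector is regular if its stabilizer is trivial, that is, it lies on no root hyperplane. -/
def IsRegular (P : RootPairing ι ℝ V V') (x : V) : Prop :=
  ∀ α : ι, P.coroot' α x ≠ 0

/-- The number `|Φ⁺|` of positive roots. -/
def numPos {P : RootPairing ι ℝ V V'} (b : P.Base) : ℕ :=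
  Nat.card {α : ι // b.IsPos α}

/-- The affine hyperplane `{x | (x, α^∨) = k}`. -/
def hyperplane (P : RootPairing ι ℝ V V') (α : ι) (k : ℤ) : Set V :=
  {x | P.coroot' α x = k}

/-- The affine reflection `x ↦ s_α(x) + k α` in the hyperplane `(x, α^∨) = k`. -/
def affineReflection (P : RootPairing ι ℝ V V') (α : ι) (k : ℤ) : V ≃ᵃ[ℝ] V :=
  (P.reflection α).toAffineEquiv.trans (AffineEquiv.constVAdd ℝ V ((k : ℝ) • P.root α))

theorem affineReflection_apply (P : RootPairing ι ℝ V V') (α : ι) (k : ℤ) (x : V) :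
    affineReflection P α k x = x - (P.coroot' α x - k) • P.root α := by
  simp only [affineReflection, AffineEquiv.trans_apply, LinearEquiv.coe_toAffineEquiv,
    AffineEquiv.constVAdd_apply, vadd_eq_add, RootPairing.reflection_apply]
  module

/-- The affine Weyl group. -/
def affineWeylGroup (P : RootPairing ι ℝ V V') : Subgroup (V ≃ᵃ[ℝ] V) :=
  Subgroup.closure {r | ∃ (α : ι) (k : ℤ), r = affineReflection P α k}

/-! ### The Weyl group, its length function and the covers of the Bruhat order -/

/-- The Weyl group, as a group of linear automorphisms of `V`. -/
def weylGroup (P : RootPairing ι ℝ V V') : Subgroup (V ≃ₗ[ℝ] V) :=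
  Subgroup.closure (Set.range P.reflection)

/-- The length of an element of the Weyl group: the smallest number of factors in an expression as
a product of simple reflections. -/
def weylLength {P : RootPairing ι ℝ V V'} (b : P.Base) (w : V ≃ₗ[ℝ] V) : ℕ :=
  sInf {n | ∃ L : List b.support, L.length = n ∧ (L.map fun i => P.reflection i).prod = w}

/-- `u ⋗ w` in the Weyl group: `w = u s_β` for a root `β`, and `ℓ(u) = ℓ(w) + 1`. -/
def BruhatCovers {P : RootPairing ι ℝ V V'} (b : P.Base) (u w : V ≃ₗ[ℝ] V) : Prop :=
  u ∈ weylGroup P ∧ w ∈ weylGroup P ∧ (∃ β : ι, b.IsPos β ∧ w = u * P.reflection β) ∧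
    weylLength b u = weylLength b w + 1

/-- `w₀ ⋖ w₁ ⋖ ⋯` is a saturated increasing chain in the Bruhat order. -/
def IsSaturatedIncreasing {P : RootPairing ι ℝ V V'} (b : P.Base) (L : List (V ≃ₗ[ℝ] V)) : Prop :=
  L.IsChain fun w u => BruhatCovers b u w

/-- `w₀ ⋗ w₁ ⋗ ⋯` is a saturated decreasing chain in the Bruhat order. -/
def IsSaturatedDecreasing {P : RootPairing ι ℝ V V'} (b : P.Base) (L : List (V ≃ₗ[ℝ] V)) : Prop :=
  L.IsChain fun u w => BruhatCovers b u w

/-! ### Alcoves and their faces -/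

/-- An alcove: a nonempty set given by inequalities `m_α < (x, α^∨) < m_α + 1`, for the positive
roots `α`. -/
def IsAlcove {P : RootPairing ι ℝ V V'} (b : P.Base) (A : Set V) : Prop :=
  A.Nonempty ∧ ∃ m : ι → ℤ,
    A = {x | ∀ α, b.IsPos α → (m α : ℝ) < P.coroot' α x ∧ P.coroot' α x < m α + 1}

def fundamentalAlcove {P : RootPairing ι ℝ V V'} (b : P.Base) : Set V :=
  {x | ∀ α, b.IsPos α → 0 < P.coroot' α x ∧ P.coroot' α x < 1}

/-- A (relatively open) face of the affine arrangement: the set of all points that have the same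
position as a given point `x` (on it, or strictly on one side of it) with respect to every
hyperplane. -/
def IsFace (P : RootPairing ι ℝ V V') (F : Set V) : Prop :=
  ∃ x : V, F = {y | ∀ (α : ι) (k : ℤ), (P.coroot' α y < k ↔ P.coroot' α x < k) ∧
    ((k : ℝ) < P.coroot' α y ↔ (k : ℝ) < P.coroot' α x)}

/-- The closure of a face: the intersection of the closed half-spaces, bounded by hyperplanes of
the arrangement, that contain it. As `α` runs over all roots, positive and negative, the sets
`{x | k ≤ (x, α^∨)}` are all these half-spaces. -/
def faceClosure (P : RootPairing ι ℝ V V') (F : Set V) : Set V :=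
  {x | ∀ (α : ι) (k : ℤ), (∀ y ∈ F, (k : ℝ) ≤ P.coroot' α y) → (k : ℝ) ≤ P.coroot' α x}

/-- `F` is a face of the alcove `A`. -/
def IsFaceOf (P : RootPairing ι ℝ V V') (F A : Set V) : Prop :=
  IsFace P F ∧ F ⊆ faceClosure P A

/-- A face has codimension one if it lies in exactly one hyperplane of the arrangement. -/
def IsCodimOne (P : RootPairing ι ℝ V V') (F : Set V) : Prop :=
  ∃! H : Set V, (∃ (α : ι) (k : ℤ), H = hyperplane P α k) ∧ F ⊆ H

open Classical in
/-- The affine reflection in the hyperplane that contains a given face of codimension one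
(the reflection depends only on the hyperplane; the value is `1` if there is no hyperplane). -/
def faceReflection (P : RootPairing ι ℝ V V') (F : Set V) : V ≃ᵃ[ℝ] V :=
  if h : ∃ p : ι × ℤ, F ⊆ hyperplane P p.1 p.2 then affineReflection P h.choose.1 h.choose.2
  else 1

/-- The image `r̄ ∈ W` of the affine reflection `r` in the hyperplane containing `F`. -/
def linearFaceReflection (P : RootPairing ι ℝ V V') (F : Set V) : V ≃ₗ[ℝ] V :=
  (faceReflection P F).linear

/-- `θ` indexes the root whose coroot is the highest coroot. -/
def IsHighestCoroot {P : RootPairing ι ℝ V V'} (b : P.Base) (θ : ι) : Prop :=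
  ∀ α : ι, b.flip.height α ≤ b.flip.height θ

/-- The hyperplanes that bound the fundamental alcove: `(x, α_i^∨) = 0` for the simple roots
`α_i`, with index `some i`, and `(x, θ^∨) = 1`, with index `none` (this is `H₀`). -/
def boundaryHyperplane {P : RootPairing ι ℝ V V'} (b : P.Base) : Option b.support → Set V
  | some i => hyperplane P i 0
  | none => {x | ∃ θ : ι, IsHighestCoroot b θ ∧ x ∈ hyperplane P θ 1}

/-- The type of a face `F`: the set of all `i` with `F' ⊆ H_i`, where `F'` is the face of the
fundamental alcove such that `F = w(F')` for some `w` in the affine Weyl group. -/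
def faceType {P : RootPairing ι ℝ V V'} (b : P.Base) (F : Set V) : Set (Option b.support) :=
  {i | ∃ F' : Set V, IsFaceOf P F' (fundamentalAlcove b) ∧
    (∃ w ∈ affineWeylGroup P, F = w '' F') ∧ F' ⊆ boundaryHyperplane b i}

/-! ### Galleries -/

/-- The underlying data `(F₀, A₀, F₁, A₁, …, F_l, A_l, F_{l+1})` of a gallery of length `l`. -/
@[ext]
structure GallerySeq (V : Type*) (l : ℕ) where
  face : Fin (l + 2) → Set V
  alcove : Fin (l + 1) → Set V

namespace GallerySeq

variable {l : ℕ}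

/-- For `j = 0, …, l - 1`, the face `F_{j+1}` between the alcoves `A_j` and `A_{j+1}`. -/
def wall (γ : GallerySeq V l) (j : Fin l) : Set V :=
  γ.face j.succ.castSucc

/-- The gallery stays in place at the face between its alcoves `A_j` and `A_{j+1}`. -/
def FoldedAt (γ : GallerySeq V l) (j : Fin l) : Prop :=
  γ.alcove j.castSucc = γ.alcove j.succ

/-- The weight of a gallery: the `μ` such that `F_{l+1} = {μ}`. -/
def weight (γ : GallerySeq V l) : V :=
  Classical.epsilon fun μ => γ.face (Fin.last (l + 1)) = {μ}

theorem weight_eq {V : Type*} [AddCommGroup V] {γ : GallerySeq V l} {μ : V} (h : γ.face (Fin.last (l + 1)) = {μ}) :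
    γ.weight = μ := by
  have hs : γ.face (Fin.last (l + 1)) = {γ.weight} :=
    Classical.epsilon_spec (p := fun ν => γ.face (Fin.last (l + 1)) = {ν}) ⟨μ, h⟩
  exact Set.singleton_injective (hs.symm.trans h)

/-- Galleries: the `A_j` are alcoves, `F_1, …, F_l` are common codimension one faces of consecutive
alcoves, `F₀ = {0}` is a vertex of `A₀`, and `F_{l+1} = {μ}` is a vertex of `A_l`, with `μ` in the
weight lattice. -/
structure IsGallery {P : RootPairing ι ℝ V V'} (b : P.Base) (γ : GallerySeq V l) : Prop where
  isAlcove : ∀ j, IsAlcove b (γ.alcove j)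
  codimOne : ∀ j, IsCodimOne P (γ.wall j)
  wall_left : ∀ j : Fin l, IsFaceOf P (γ.wall j) (γ.alcove j.castSucc)
  wall_right : ∀ j : Fin l, IsFaceOf P (γ.wall j) (γ.alcove j.succ)
  face_zero : γ.face 0 = {0}
  face_zero_of : IsFaceOf P (γ.face 0) (γ.alcove 0)
  face_last : ∃ μ, IsWeight P μ ∧ γ.face (Fin.last (l + 1)) = {μ}
  face_last_of : IsFaceOf P (γ.face (Fin.last (l + 1))) (γ.alcove (Fin.last l))

/-- A gallery is reduced if it starts at the fundamental alcove and has minimal length among all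
galleries of the same weight that start at the fundamental alcove. -/
def IsReduced {P : RootPairing ι ℝ V V'} (b : P.Base) (γ : GallerySeq V l) : Prop :=
  γ.IsGallery b ∧ γ.alcove 0 = fundamentalAlcove b ∧
    ∀ (l' : ℕ) (γ' : GallerySeq V l'), γ'.IsGallery b → γ'.alcove 0 = fundamentalAlcove b →
      γ'.weight = γ.weight → l ≤ l'

/-- A gallery is special if `l ≥ N = |Φ⁺|` and `A_0, …, A_N` and `F_1, …, F_N` are adjacent to the
origin. -/
def IsSpecial {P : RootPairing ι ℝ V V'} (b : P.Base) (γ : GallerySeq V l) : Prop :=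
  γ.IsGallery b ∧ numPos b ≤ l ∧
    (∀ j : Fin (l + 1), (j : ℕ) ≤ numPos b → 0 ∈ faceClosure P (γ.alcove j)) ∧
    (∀ j : Fin l, (j : ℕ) < numPos b → 0 ∈ faceClosure P (γ.wall j))

/-- The tail-flip operator for the face between `A_j` and `A_{j+1}`: it reflects everything that
follows that face in the hyperplane containing it. -/
def tailFlip (P : RootPairing ι ℝ V V') (j : Fin l) (γ : GallerySeq V l) : GallerySeq V l where
  face i := if (i : ℕ) ≤ j + 1 then γ.face i else faceReflection P (γ.wall j) '' γ.face i
  alcove i := if (i : ℕ) ≤ j then γ.alcove i else faceReflection P (γ.wall j) '' γ.alcove i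

/-- `γ'` is an admissible folding of `γ`: it is `f_{j_1} ⋯ f_{j_s}(γ)` with `j_1 < ⋯ < j_s`, and
`1 ⋖ r̄_{j_1} ⋖ r̄_{j_1} r̄_{j_2} ⋖ ⋯ ⋖ r̄_{j_1} ⋯ r̄_{j_s}` is a saturated increasing chain. -/
def IsAdmissibleFolding {P : RootPairing ι ℝ V V'} (b : P.Base) (γ γ' : GallerySeq V l) : Prop :=
  ∃ J : List (Fin l), J.Pairwise (· < ·) ∧ γ' = J.foldr (tailFlip P) γ ∧
    IsSaturatedIncreasing b (J.scanl (fun w j => w * linearFaceReflection P (γ.wall j)) 1)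

/-- The type of a gallery: the sequence of the types of its faces and alcoves. -/
def type {P : RootPairing ι ℝ V V'} (b : P.Base) (γ : GallerySeq V l) :
    (Fin (l + 2) → Set (Option b.support)) × (Fin (l + 1) → Set (Option b.support)) :=
  (fun j => faceType b (γ.face j), fun j => faceType b (γ.alcove j))

open Classical in
/-- The increasing list of the positions at which the gallery is folded. -/
def foldList (γ : GallerySeq V l) : List (Fin l) :=
  (List.finRange l).filter fun j => γ.FoldedAt j

/-- `L` is the companion `(u_0, …, u_s)` of `γ`: `u_0 ∈ W` is the element with
`u_0(A_∘) = A_0`, and `u_i = r̄_{j_i} u_{i-1}`, where `j_1 < ⋯ < j_s` are the positions at which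
`γ` is folded. -/
def IsCompanion {P : RootPairing ι ℝ V V'} (b : P.Base) (γ : GallerySeq V l)
    (L : List (V ≃ₗ[ℝ] V)) : Prop :=
  ∃ u₀ ∈ weylGroup P, u₀ '' fundamentalAlcove b = γ.alcove 0 ∧
    L = γ.foldList.scanl (fun u j => linearFaceReflection P (γ.wall j) * u) u₀

/-- A minimal gallery: it is unfolded and crosses only hyperplanes `(x, α^∨) = k` that strictly
separate `0` from the weight of the gallery. -/
def IsMinimal {P : RootPairing ι ℝ V V'} (b : P.Base) (γ : GallerySeq V l) : Prop :=
  γ.IsGallery b ∧ (∀ j, ¬ γ.FoldedAt j) ∧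
    ∀ (j : Fin l) (α : ι) (k : ℤ), γ.wall j ⊆ hyperplane P α k →
      (0 < (k : ℝ) ∧ (k : ℝ) < P.coroot' α γ.weight) ∨
        (P.coroot' α γ.weight < (k : ℝ) ∧ (k : ℝ) < 0)

/-- The set of LS-galleries associated with a minimal gallery `γ`: the galleries of the same type
(in particular, of the same length) whose companion is a saturated decreasing chain. -/
def lsGalleries {P : RootPairing ι ℝ V V'} (b : P.Base) (γ : GallerySeq V l) :
    Set (GallerySeq V l) :=
  {γ' | γ'.IsGallery b ∧ γ'.type b = γ.type b ∧
    ∃ L, γ'.IsCompanion b L ∧ IsSaturatedDecreasing b L}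

/-- The transformation `t` (meant for special galleries, of weight `-μ`, say):
`(F_0, A_0, …, A_l, F_{l+1}) ↦ (F_{l+1} + μ, A_l + μ, …, F_{N+1} + μ, A_N + μ, F_0 + μ)`. -/
def t {P : RootPairing ι ℝ V V'} (b : P.Base) (γ : GallerySeq V l) :
    GallerySeq V (l - numPos b) where
  face j := (fun x => x - γ.weight) ''
    (if (j : ℕ) ≤ l - numPos b then γ.face ⟨l + 1 - j, by omega⟩ else γ.face 0)
  alcove j := (fun x => x - γ.weight) '' γ.alcove ⟨l - j, by omega⟩

end GallerySeq

end Alcoves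

end

noncomputable section

set_option linter.unusedSectionVars false

namespace Alcoves

/-! ### The action of the Weyl group on the roots. -/

section RootSystems

variable {ι V V' : Type*} [AddCommGroup V] [Module ℝ V] [AddCommGroup V'] [Module ℝ V']

/-! Folding a gallery at a set `J` of positions moves its `i`-th alcove by the ordered product of
the wall reflections at the positions of `J` below `i` (`foldMap`, `foldr_tailFlip`). An admissible
folding is therefore a set `J` for which the linear parts of these partial products climb one Bruhat
cover at each position of `J` (`isAdmissibleFolding_iff`).

The transformation `t` reverses the gallery, moves its end to the origin and forgets the first `N`
steps. Since `u x - u μ` depends only on the linear part of `u`, the first alcove of the transform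
is the image of the fundamental alcove under the linear part of the full product. The reflection in
a folded wall is a conjugate of the original one, so each fold met in the reversed gallery strips
the last remaining factor. The companion is thus the admissible chain read backwards, down to the
product over the positions below `N`, and the LS condition is exactly the cover condition at the
positions `≥ N` (`companion_t_fold_iff`). Folding does not change the type of the transform
(`type_t_fold`), and a gallery is determined by its type, its first alcove and its fold positions
(`GallerySeq.IsGal.eq_of_type_eq`). An LS-gallery therefore amounts to an element `u` of the Weyl
group together with a set `K` of positions `≥ N` satisfying the cover conditions.

What is lost is a chain of covers from `1` to `v`, where `v` is `u` times the inverse of the product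
over `K`, with steps among the first `N` walls. A shortest gallery crosses each hyperplane at most
once. The first `N` walls lie in hyperplanes through the origin, of which there are `N`, so their
labels enumerate the positive roots, and every initial segment is the inversion set of a Weyl group
element (`exists_isReflectionOrder`). For such an enumeration every `v` is reached from `1` by
exactly one saturated chain with labels in the given order (`exists_isIncreasingChain`,
`IsIncreasingChain.eq_of_eq`). Both halves come from the formula `weylLength_mul` for the length of
a product. This gives surjectivity and injectivity of `t`.

Minimality of the transform has the same source: a shortest gallery crosses only hyperplanes that
separate its start from its end and none through its end, and those through the origin are used up
in the first `N` steps (`isMinimal_t`). -/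

/-- The index of the negative of a root. -/
abbrev negIdx (P : RootPairing ι ℝ V V') (α : ι) : ι := P.reflectionPerm α α

theorem perm_apply_inv {κ : Type*} (σ : Equiv.Perm κ) (a : κ) : σ (σ⁻¹ a) = a :=
  σ.apply_symm_apply a

theorem perm_inv_apply {κ : Type*} (σ : Equiv.Perm κ) (a : κ) : σ⁻¹ (σ a) = a :=
  σ.symm_apply_apply a

section General

variable (P : RootPairing ι ℝ V V')

theorem root_negIdx (α : ι) : P.root (negIdx P α) = -P.root α := by
  rw [RootPairing.root_reflectionPerm, RootPairing.reflection_apply_self]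

theorem coroot'_negIdx (α : ι) (x : V) : P.coroot' (negIdx P α) x = -P.coroot' α x := by
  rw [RootPairing.coroot'_reflectionPerm, LinearMap.comp_apply]
  change P.coroot' α (P.reflection α x) = _
  rw [RootPairing.reflection_apply, map_sub, map_smul, RootPairing.root_coroot'_eq_pairing,
    RootPairing.pairing_same, smul_eq_mul]
  ring

theorem negIdx_negIdx (α : ι) : negIdx P (negIdx P α) = α := by
  apply P.root.injective
  rw [root_negIdx, root_negIdx, neg_neg]

theorem coroot'_reflectionPerm_reflection (α β : ι) (x : V) :
    P.coroot' (P.reflectionPerm α β) (P.reflection α x) = P.coroot' β x := by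
  rw [RootPairing.coroot'_reflectionPerm, LinearMap.comp_apply]
  change P.coroot' β (P.reflection α (P.reflection α x)) = _
  rw [RootPairing.reflection_same]

theorem reflection_mul_self (α : ι) : P.reflection α * P.reflection α = 1 := by
  ext x
  simp [LinearEquiv.mul_apply]

theorem reflection_mem (α : ι) : P.reflection α ∈ weylGroup P :=
  Subgroup.subset_closure ⟨α, rfl⟩

/-- The permutation `σ` describes the action of `w` on the roots and coroots. -/
def Realizes (w : V ≃ₗ[ℝ] V) (σ : Equiv.Perm ι) : Prop :=
  (∀ α, w (P.root α) = P.root (σ α)) ∧ ∀ α x, P.coroot' (σ α) (w x) = P.coroot' α x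

variable {P}

theorem Realizes.mul {w v : V ≃ₗ[ℝ] V} {σ τ : Equiv.Perm ι} (h : Realizes P w σ)
    (h' : Realizes P v τ) : Realizes P (w * v) (σ * τ) :=
  ⟨fun α => by simp [LinearEquiv.mul_apply, h.1, h'.1],
    fun α x => by simp only [LinearEquiv.mul_apply, Equiv.Perm.mul_apply, h.2, h'.2]⟩

theorem Realizes.inv {w : V ≃ₗ[ℝ] V} {σ : Equiv.Perm ι} (h : Realizes P w σ) :
    Realizes P w⁻¹ σ⁻¹ := by
  have hw : ∀ x, w (w⁻¹ x) = x := fun x => w.apply_symm_apply x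
  refine ⟨fun α => w.injective ?_, fun α x => ?_⟩
  · rw [hw, h.1, perm_apply_inv]
  · rw [← h.2, hw, perm_apply_inv]

theorem Realizes.unique {w : V ≃ₗ[ℝ] V} {σ τ : Equiv.Perm ι} (h : Realizes P w σ)
    (h' : Realizes P w τ) : σ = τ :=
  Equiv.ext fun α => P.root.injective (by rw [← h.1, ← h'.1])

theorem realizes_one : Realizes P (1 : V ≃ₗ[ℝ] V) 1 :=
  ⟨fun _ => rfl, fun _ _ => rfl⟩

theorem realizes_reflection (α : ι) : Realizes P (P.reflection α) (P.reflectionPerm α) :=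
  ⟨fun β => (P.root_reflectionPerm α β).symm, fun β x => coroot'_reflectionPerm_reflection P α β x⟩

theorem exists_realizes {w : V ≃ₗ[ℝ] V} (hw : w ∈ weylGroup P) : ∃ σ, Realizes P w σ := by
  induction hw using Subgroup.closure_induction with
  | mem x hx =>
    obtain ⟨α, rfl⟩ := hx
    exact ⟨_, realizes_reflection α⟩
  | one => exact ⟨1, realizes_one⟩
  | mul x y _ _ hx hy =>
    obtain ⟨σ, hσ⟩ := hx
    obtain ⟨τ, hτ⟩ := hy
    exact ⟨_, hσ.mul hτ⟩
  | inv x _ hx =>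
    obtain ⟨σ, hσ⟩ := hx
    exact ⟨_, hσ.inv⟩

variable (P)

open Classical in
/-- The permutation of the roots induced by an element of the Weyl group. -/
def rootPerm (w : V ≃ₗ[ℝ] V) : Equiv.Perm ι :=
  if h : ∃ σ, Realizes P w σ then h.choose else 1

variable {P}

theorem realizes_rootPerm {w : V ≃ₗ[ℝ] V} (hw : w ∈ weylGroup P) :
    Realizes P w (rootPerm P w) := by
  have h := exists_realizes hw
  rw [rootPerm, dif_pos h]
  exact h.choose_spec

theorem rootPerm_mul {w v : V ≃ₗ[ℝ] V} (hw : w ∈ weylGroup P) (hv : v ∈ weylGroup P) :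
    rootPerm P (w * v) = rootPerm P w * rootPerm P v :=
  (realizes_rootPerm (mul_mem hw hv)).unique ((realizes_rootPerm hw).mul (realizes_rootPerm hv))

theorem rootPerm_inv {w : V ≃ₗ[ℝ] V} (hw : w ∈ weylGroup P) :
    rootPerm P w⁻¹ = (rootPerm P w)⁻¹ :=
  (realizes_rootPerm (inv_mem hw)).unique (realizes_rootPerm hw).inv

theorem rootPerm_one : rootPerm P (1 : V ≃ₗ[ℝ] V) = 1 :=
  (realizes_rootPerm (one_mem _)).unique realizes_one

theorem rootPerm_reflection (α : ι) : rootPerm P (P.reflection α) = P.reflectionPerm α :=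
  (realizes_rootPerm (reflection_mem P α)).unique (realizes_reflection α)

theorem rootPerm_negIdx {w : V ≃ₗ[ℝ] V} (hw : w ∈ weylGroup P) (α : ι) :
    rootPerm P w (negIdx P α) = negIdx P (rootPerm P w α) := by
  apply P.root.injective
  rw [← (realizes_rootPerm hw).1, root_negIdx, root_negIdx, map_neg, (realizes_rootPerm hw).1]

theorem conj_reflection {w : V ≃ₗ[ℝ] V} (hw : w ∈ weylGroup P) (α : ι) :
    P.reflection (rootPerm P w α) * w = w * P.reflection α := by
  ext x
  simp only [LinearEquiv.mul_apply, RootPairing.reflection_apply, map_sub, map_smul,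
    (realizes_rootPerm hw).1, (realizes_rootPerm hw).2]

theorem reflection_negIdx (α : ι) : P.reflection (negIdx P α) = P.reflection α := by
  ext x
  simp only [RootPairing.reflection_apply, coroot'_negIdx, root_negIdx]
  module

variable (b : P.Base)

theorem isPos_negIdx (α : ι) : b.IsPos (negIdx P α) ↔ ¬ b.IsPos α :=
  RootPairing.Base.IsPos.neg_iff_not b α

theorem height_negIdx (α : ι) : b.height (negIdx P α) = -b.height α :=
  b.height_reflectionPerm_self α

end General

/-! ### Length as the number of inversions. -/

section Length

variable [Finite ι] {P : RootPairing ι ℝ V V'} [P.IsRootSystem] [P.IsCrystallographic]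
  [P.IsReduced] (b : P.Base)

/-- The positive roots that `w` makes negative. -/
def inversions (w : V ≃ₗ[ℝ] V) : Set ι := {α | b.IsPos α ∧ ¬ b.IsPos (rootPerm P w α)}

theorem height_rootPerm_reflectionPerm {w : V ≃ₗ[ℝ] V} (hw : w ∈ weylGroup P) (β γ : ι) :
    b.height (rootPerm P w (P.reflectionPerm β γ)) =
      b.height (rootPerm P w γ) - P.pairingIn ℤ γ β * b.height (rootPerm P w β) := by
  have h : P.root (rootPerm P w (P.reflectionPerm β γ)) =
      P.root (rootPerm P w γ) + (-P.pairingIn ℤ γ β) • P.root (rootPerm P w β) := by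
    simp only [← (realizes_rootPerm hw).1]
    rw [RootPairing.root_reflectionPerm, RootPairing.reflection_apply_root' ℤ, map_sub, map_zsmul,
      neg_smul, sub_eq_add_neg]
  rw [b.height_add_zsmul h, smul_eq_mul]
  ring

/-- The inversions of `w` inject into those of `w s_β` other than `β`, and `β` is an additional
inversion of `w s_β`. -/
theorem ncard_inversions_lt {w : V ≃ₗ[ℝ] V} (hw : w ∈ weylGroup P) {β : ι} (hβ : b.IsPos β)
    (hwβ : b.IsPos (rootPerm P w β)) :
    (inversions b w).ncard < (inversions b (w * P.reflection β)).ncard := by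
  classical
  have hs := reflection_mem P β
  have hp : ∀ γ, rootPerm P (w * P.reflection β) γ = rootPerm P w (P.reflectionPerm β γ) := by
    intro γ
    rw [rootPerm_mul hw hs, rootPerm_reflection, Equiv.Perm.mul_apply]
  have hββ : β ∈ inversions b (w * P.reflection β) := by
    refine ⟨hβ, ?_⟩
    rw [hp, rootPerm_negIdx hw, isPos_negIdx, not_not]
    exact hwβ
  -- Move `γ` by `s_β` when the result is still positive; otherwise `γ` itself is an inversion of `w
  -- s_β`.
  let f : ι → ι := fun γ => if b.IsPos (P.reflectionPerm β γ) then P.reflectionPerm β γ else γ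
  have hmaps : ∀ γ ∈ inversions b w, f γ ∈ inversions b (w * P.reflection β) \ {β} := by
    rintro γ ⟨hγ, hwγ⟩
    by_cases h : b.IsPos (P.reflectionPerm β γ)
    · simp only [f, if_pos h]
      refine ⟨⟨h, ?_⟩, ?_⟩
      · rw [hp, RootPairing.reflectionPerm_self]
        exact hwγ
      · intro h'
        rw [Set.mem_singleton_iff] at h'
        have : γ = negIdx P β := by
          rw [← RootPairing.reflectionPerm_self P β γ, h']
        rw [this, isPos_negIdx] at hγ
        exact hγ hβ
    · simp only [f, if_neg h]
      refine ⟨⟨hγ, ?_⟩, ?_⟩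
      · rw [hp]
        have h1 := height_rootPerm_reflectionPerm b (one_mem (weylGroup P)) β γ
        simp only [rootPerm_one, Equiv.Perm.one_apply] at h1
        rw [RootPairing.Base.isPos_iff'] at h hwγ ⊢
        rw [RootPairing.Base.isPos_iff] at hγ hβ hwβ
        rw [height_rootPerm_reflectionPerm b hw]
        push Not at *
        -- `s_β γ = γ - c β` is negative with `γ` and `β` positive, so `c > 0`. Then the height of
        -- `w γ - c w β` is negative, since `w γ` is negative and `w β` is positive.
        have h3 : 0 < P.pairingIn ℤ γ β := by
          by_contra hc
          nlinarith
        nlinarith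
      · intro h'
        rw [Set.mem_singleton_iff] at h'
        exact hwγ (h' ▸ hwβ)
  have hinj : Set.InjOn f (inversions b w) := by
    rintro γ ⟨hγ, -⟩ δ ⟨hδ, -⟩ h
    simp only [f] at h
    split_ifs at h with h1 h2 h2
    · exact (P.reflectionPerm β).injective h
    · rw [← h, RootPairing.reflectionPerm_self] at h2
      exact absurd hγ h2
    · rw [h, RootPairing.reflectionPerm_self] at h1
      exact absurd hδ h1
    · exact h
  calc (inversions b w).ncard = (f '' inversions b w).ncard := hinj.ncard_image.symm
    _ ≤ (inversions b (w * P.reflection β) \ {β}).ncard :=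
      Set.ncard_le_ncard (Set.image_subset_iff.2 hmaps) (Set.toFinite _)
    _ < _ := Set.ncard_sdiff_singleton_lt_of_mem hββ (Set.toFinite _)

/-- The product of the simple reflections in a list. -/
def simpleProd (L : List b.support) : V ≃ₗ[ℝ] V :=
  (L.map fun i : b.support => P.reflection (i : ι)).prod

@[simp] theorem simpleProd_nil : simpleProd b [] = 1 := rfl

@[simp] theorem simpleProd_cons (i : b.support) (L : List b.support) :
    simpleProd b (i :: L) = P.reflection i * simpleProd b L := rfl

@[simp] theorem simpleProd_append (L M : List b.support) :
    simpleProd b (L ++ M) = simpleProd b L * simpleProd b M := by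
  simp [simpleProd]

theorem weylLength_eq_sInf (w : V ≃ₗ[ℝ] V) :
    weylLength b w = sInf {n | ∃ L : List b.support, L.length = n ∧ simpleProd b L = w} := by
  have h (L : List b.support) : (do let a ← L; pure (a : ι)) = L.map Subtype.val := by
    simp [← List.map_eq_flatMap]
  simp only [weylLength, simpleProd, h, List.map_map, Function.comp_def]

/-- Every root is reached from simple roots by negations and simple reflections, and conjugating a
reflection by `s_j` gives the reflection in the reflected root. Hence simple reflections generate.
-/
theorem exists_prod_of_mem_weylGroup {w : V ≃ₗ[ℝ] V} (hw : w ∈ weylGroup P) :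
    ∃ L : List b.support, simpleProd b L = w := by
  let S : Subgroup (V ≃ₗ[ℝ] V) := Subgroup.closure (Set.range fun i : b.support => P.reflection i)
  have hS : weylGroup P ≤ S := by
    refine (Subgroup.closure_le _).2 ?_
    rintro - ⟨α, rfl⟩
    refine b.induction_reflect α (p := fun α => P.reflection α ∈ S) ?_ ?_ ?_
    · intro i hi
      have := reflection_negIdx (P := P) i
      rw [negIdx] at this
      rwa [this]
    · exact fun i hi => Subgroup.subset_closure ⟨⟨i, hi⟩, rfl⟩
    · intro i j hi hj
      have h1 : P.reflection j ∈ S := Subgroup.subset_closure ⟨⟨j, hj⟩, rfl⟩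
      rw [RootPairing.reflection_reflectionPerm]
      exact mul_mem (mul_mem h1 hi) h1
  have hw' := hS hw
  clear hw
  induction hw' using Subgroup.closure_induction with
  | mem x hx =>
    obtain ⟨i, rfl⟩ := hx
    exact ⟨[i], by simp⟩
  | one => exact ⟨[], rfl⟩
  | mul x y _ _ hx hy =>
    obtain ⟨L, rfl⟩ := hx
    obtain ⟨M, rfl⟩ := hy
    exact ⟨L ++ M, by simp⟩
  | inv x _ hx =>
    obtain ⟨L, rfl⟩ := hx
    refine ⟨L.reverse, ?_⟩
    rw [simpleProd, simpleProd, List.prod_inv_reverse, List.map_map, List.map_reverse]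
    rfl

theorem prod_mem_weylGroup (L : List b.support) :
    simpleProd b L ∈ weylGroup P :=
  list_prod_mem (by
    intro x hx
    obtain ⟨i, -, rfl⟩ := List.mem_map.1 hx
    exact reflection_mem P _)

theorem isPos_reflectionPerm_iff {i α : ι} (hi : i ∈ b.support) (h1 : α ≠ i)
    (h2 : α ≠ negIdx P i) : b.IsPos (P.reflectionPerm i α) ↔ b.IsPos α := by
  have key : ∀ α, α ≠ i → b.IsPos α → b.IsPos (P.reflectionPerm i α) :=
    fun α h hα => hα.reflectionPerm hi h
  refine ⟨fun h => ?_, key α h1⟩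
  rw [← RootPairing.reflectionPerm_self P i α]
  refine key _ ?_ h
  intro h'
  apply h2
  rw [← RootPairing.reflectionPerm_self P i α, h']

theorem eq_of_isPos_of_not_isPos_reflectionPerm {i α : ι} (hi : i ∈ b.support) (h1 : b.IsPos α)
    (h2 : ¬ b.IsPos (P.reflectionPerm i α)) : α = i := by
  by_contra h
  exact h2 (h1.reflectionPerm hi h)

/-- The exchange condition. -/
theorem exists_prod_eq_mul_reflection (L : List b.support) (i : b.support)
    (h : ¬ b.IsPos (rootPerm P (simpleProd b L) i)) :
    ∃ M : List b.support, M.length + 1 = L.length ∧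
      simpleProd b M = simpleProd b L *
        P.reflection i := by
  induction L with
  | nil =>
    simp only [simpleProd_nil, rootPerm_one, Equiv.Perm.one_apply] at h
    exact absurd (RootPairing.Base.isPos_of_mem_support i.2) h
  | cons k L ih =>
    simp only [simpleProd_cons] at h ⊢
    have hm := prod_mem_weylGroup b L
    by_cases hL : b.IsPos (rootPerm P (simpleProd b L) i)
    · rw [rootPerm_mul (reflection_mem P _) hm, rootPerm_reflection, Equiv.Perm.mul_apply] at h
      -- The sign changes at the letter `k`, so the tail of the word sends the simple root `i` to
      -- the simple root `k`; this letter can be deleted.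
      have he := eq_of_isPos_of_not_isPos_reflectionPerm b k.2 hL h
      refine ⟨L, by simp, ?_⟩
      have hc := conj_reflection hm (i : ι)
      rw [he] at hc
      rw [mul_assoc, ← hc, ← mul_assoc, reflection_mul_self, one_mul]
    · obtain ⟨M, hM, hM'⟩ := ih hL
      exact ⟨k :: M, by simp [hM], by simp [hM', mul_assoc]⟩

theorem exists_prod_length_eq_weylLength {w : V ≃ₗ[ℝ] V} (hw : w ∈ weylGroup P) :
    ∃ L : List b.support, L.length = weylLength b w ∧
      simpleProd b L = w := by
  obtain ⟨L, hL⟩ := exists_prod_of_mem_weylGroup b hw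
  rw [weylLength_eq_sInf]
  exact Nat.sInf_mem (s := {n | ∃ L : List b.support, L.length = n ∧
    simpleProd b L = w}) ⟨L.length, L, rfl, hL⟩

theorem weylLength_le (L : List b.support) :
    weylLength b (simpleProd b L) ≤ L.length := by
  rw [weylLength_eq_sInf]
  exact Nat.sInf_le ⟨L, rfl, rfl⟩

/-- If a shortest word `M s_i` for `w` has a last letter, then `w α_i > 0` makes `M α_i` negative,
and the exchange condition yields a shorter word for `w`. -/
theorem eq_one_of_forall_isPos {w : V ≃ₗ[ℝ] V} (hw : w ∈ weylGroup P)
    (h : ∀ i ∈ b.support, b.IsPos (rootPerm P w i)) : w = 1 := by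
  obtain ⟨L, hL, hLw⟩ := exists_prod_length_eq_weylLength b hw
  rcases List.eq_nil_or_concat L with rfl | ⟨M, i, rfl⟩
  · simpa using hLw.symm
  · exfalso
    simp only [List.concat_eq_append, simpleProd_append, simpleProd_cons, simpleProd_nil, mul_one,
      List.length_append, List.length_cons, List.length_nil] at hL hLw
    have hM := prod_mem_weylGroup b M
    have h1 : ¬ b.IsPos (rootPerm P (simpleProd b M) i) := by
      have := h i i.2
      rw [← hLw, rootPerm_mul hM (reflection_mem P _), rootPerm_reflection,
        Equiv.Perm.mul_apply, rootPerm_negIdx hM, isPos_negIdx] at this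
      exact this
    obtain ⟨M', hM', hM''⟩ := exists_prod_eq_mul_reflection b M i h1
    have := weylLength_le b M'
    rw [hM'', hLw] at this
    omega

theorem exists_not_isPos_of_inversions_ne_empty {w : V ≃ₗ[ℝ] V} (hw : w ∈ weylGroup P)
    (h : inversions b w ≠ ∅) : ∃ i ∈ b.support, ¬ b.IsPos (rootPerm P w i) := by
  by_contra! hc
  apply h
  have := eq_one_of_forall_isPos b hw hc
  subst this
  ext α
  simp [inversions, rootPerm_one]

theorem eq_one_of_inversions_eq_empty {w : V ≃ₗ[ℝ] V} (hw : w ∈ weylGroup P)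
    (h : inversions b w = ∅) : w = 1 := by
  refine eq_one_of_forall_isPos b hw fun i hi => ?_
  by_contra hc
  have : i ∈ inversions b w := ⟨RootPairing.Base.isPos_of_mem_support hi, hc⟩
  rw [h] at this
  exact this

/-- A simple reflection makes only one positive root negative, so each letter added on the left
creates at most one inversion. -/
theorem ncard_inversions_prod_le (L : List b.support) :
    (inversions b (simpleProd b L)).ncard ≤ L.length := by
  induction L with
  | nil =>
    have : inversions b (1 : V ≃ₗ[ℝ] V) = ∅ := by
      ext α
      simp [inversions, rootPerm_one]
    simp [this]
  | cons k L ih =>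
    have hm := prod_mem_weylGroup b L
    simp only [simpleProd_cons, List.length_cons]
    set w := simpleProd b L
    have : inversions b (P.reflection k * w) ⊆ insert ((rootPerm P w)⁻¹ k) (inversions b w) := by
      rintro α ⟨h1, h2⟩
      rw [rootPerm_mul (reflection_mem P _) hm, rootPerm_reflection, Equiv.Perm.mul_apply] at h2
      by_cases hα : b.IsPos (rootPerm P w α)
      · left
        rw [← eq_of_isPos_of_not_isPos_reflectionPerm b k.2 hα h2, perm_inv_apply]
      · exact Or.inr ⟨h1, hα⟩
    exact (Set.ncard_le_ncard this (Set.toFinite _)).trans ((Set.ncard_insert_le _ _).trans (by omega))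

theorem weylLength_eq {w : V ≃ₗ[ℝ] V} (hw : w ∈ weylGroup P) :
    weylLength b w = (inversions b w).ncard := by
  apply le_antisymm
  -- Multiply on the right by simple reflections whose roots `w` makes negative; each one lowers the
  -- inversion count, and a word results that is no longer than that count.
  · suffices ∀ n, ∀ w ∈ weylGroup P, (inversions b w).ncard = n →
        ∃ L : List b.support, simpleProd b L = w ∧ L.length ≤ n by
      obtain ⟨L, rfl, hL⟩ := this _ w hw rfl
      exact (weylLength_le b L).trans hL
    intro n
    induction n using Nat.strong_induction_on with
    | _ n ih =>
      intro w hw hn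
      by_cases he : inversions b w = ∅
      · exact ⟨[], by simp [eq_one_of_inversions_eq_empty b hw he], by simp⟩
      · obtain ⟨i, hi, hwi⟩ := exists_not_isPos_of_inversions_ne_empty b hw he
        have hs := reflection_mem P i
        have hlt := ncard_inversions_lt b (mul_mem hw hs)
          (RootPairing.Base.isPos_of_mem_support hi) (by
            rw [rootPerm_mul hw hs, rootPerm_reflection, Equiv.Perm.mul_apply,
              rootPerm_negIdx hw, isPos_negIdx]
            exact hwi)
        rw [mul_assoc, reflection_mul_self, mul_one] at hlt
        obtain ⟨L, hL, hL'⟩ := ih _ (hn ▸ hlt) _ (mul_mem hw hs) rfl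
        refine ⟨L ++ [⟨i, hi⟩], ?_, ?_⟩
        · simp [hL, mul_assoc, reflection_mul_self]
        · simp only [List.length_append, List.length_cons, List.length_nil]
          omega
  · obtain ⟨L, hL, rfl⟩ := exists_prod_length_eq_weylLength b hw
    rw [← hL]
    exact ncard_inversions_prod_le b L

theorem weylLength_lt_mul_reflection {w : V ≃ₗ[ℝ] V} (hw : w ∈ weylGroup P) {β : ι}
    (hβ : b.IsPos β) (hwβ : b.IsPos (rootPerm P w β)) :
    weylLength b w < weylLength b (w * P.reflection β) := by
  rw [weylLength_eq b hw, weylLength_eq b (mul_mem hw (reflection_mem P _))]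
  exact ncard_inversions_lt b hw hβ hwβ

theorem weylLength_mul_reflection_lt {w : V ≃ₗ[ℝ] V} (hw : w ∈ weylGroup P) {β : ι}
    (hβ : b.IsPos β) (hwβ : ¬ b.IsPos (rootPerm P w β)) :
    weylLength b (w * P.reflection β) < weylLength b w := by
  have h := weylLength_lt_mul_reflection b (mul_mem hw (reflection_mem P β)) hβ (by
    rw [rootPerm_mul hw (reflection_mem P _), rootPerm_reflection, Equiv.Perm.mul_apply,
      rootPerm_negIdx hw, isPos_negIdx]
    exact hwβ)
  rwa [mul_assoc, reflection_mul_self, mul_one] at h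

theorem ncard_symmDiff_add {α : Type*} [Finite α] (A B : Set α) :
    (symmDiff A B).ncard + 2 * (A ∩ B).ncard = A.ncard + B.ncard := by
  have h1 := Set.ncard_inter_add_ncard_sdiff_eq_ncard A B (Set.toFinite _)
  have h2 := Set.ncard_inter_add_ncard_sdiff_eq_ncard B A (Set.toFinite _)
  have h3 : (symmDiff A B).ncard = (A \ B).ncard + (B \ A).ncard :=
    Set.ncard_union_eq (Set.disjoint_left.2 fun x hx hx' => hx.2 hx'.1) (Set.toFinite _)
      (Set.toFinite _)
  rw [Set.inter_comm B A] at h2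
  omega

/-- Sending `α` to the positive one among `x α` and `-x α` identifies the inversions of `w x` with
the symmetric difference of the inversions of `w` and of `x⁻¹`. -/
theorem weylLength_mul {w x : V ≃ₗ[ℝ] V} (hw : w ∈ weylGroup P) (hx : x ∈ weylGroup P) :
    weylLength b (w * x) + 2 * (inversions b w ∩ inversions b x⁻¹).ncard =
      weylLength b w + (inversions b x⁻¹).ncard := by
  classical
  rw [weylLength_eq b hw, weylLength_eq b (mul_mem hw hx), ← ncard_symmDiff_add]
  congr 1
  set σ := rootPerm P x
  have hneg : ∀ α, σ (negIdx P α) = negIdx P (σ α) := rootPerm_negIdx hx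
  have hneg' : ∀ α, rootPerm P w (negIdx P α) = negIdx P (rootPerm P w α) := rootPerm_negIdx hw
  have hinv : ∀ γ, γ ∈ inversions b x⁻¹ ↔ b.IsPos γ ∧ ¬ b.IsPos (σ⁻¹ γ) := by
    intro γ
    rw [inversions, Set.mem_ofPred_eq, rootPerm_inv hx]
  let f : ι → ι := fun α => if b.IsPos (σ α) then σ α else negIdx P (σ α)
  have hf : Set.InjOn f (inversions b (w * x)) := by
    rintro γ ⟨hγ, -⟩ δ ⟨hδ, -⟩ h
    simp only [f] at h
    split_ifs at h with h1 h2 h2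
    · exact σ.injective h
    · rw [← hneg] at h
      rw [σ.injective h, isPos_negIdx] at hγ
      exact absurd hδ hγ
    · rw [← hneg] at h
      rw [← σ.injective h, isPos_negIdx] at hδ
      exact absurd hγ hδ
    · rw [← hneg, ← hneg] at h
      have := congrArg (negIdx P) (σ.injective h)
      rwa [negIdx_negIdx, negIdx_negIdx] at this
  rw [← hf.ncard_image]
  congr 1
  have hwx : ∀ α, α ∈ inversions b (w * x) ↔ b.IsPos α ∧ ¬ b.IsPos (rootPerm P w (σ α)) := by
    intro α
    rw [inversions, Set.mem_ofPred_eq, rootPerm_mul hw hx]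
    rfl
  ext γ
  rw [Set.mem_symmDiff, hinv]
  constructor
  · rintro ⟨α, hα, rfl⟩
    rw [hwx] at hα
    simp only [f]
    split_ifs with h
    · left
      exact ⟨⟨h, hα.2⟩, fun h' => h'.2 (by rw [perm_inv_apply]; exact hα.1)⟩
    · right
      refine ⟨⟨(isPos_negIdx b _).2 h, ?_⟩, ?_⟩
      · rw [← hneg, perm_inv_apply, isPos_negIdx, not_not]
        exact hα.1
      · rintro ⟨-, h'⟩
        rw [hneg', isPos_negIdx, not_not] at h'
        exact hα.2 h'
  · rintro (⟨⟨h1, h2⟩, h3⟩ | ⟨⟨h1, h2⟩, h3⟩)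
    · have h4 : b.IsPos (σ⁻¹ γ) := by
        by_contra h
        exact h3 ⟨h1, h⟩
      refine ⟨σ⁻¹ γ, (hwx _).2 ⟨h4, ?_⟩, ?_⟩
      · rwa [perm_apply_inv]
      · simp only [f, perm_apply_inv, if_pos h1]
    · have h4 : b.IsPos (rootPerm P w γ) := by
        by_contra h
        exact h3 ⟨h1, h⟩
      have h5 : σ (negIdx P (σ⁻¹ γ)) = negIdx P γ := by
        rw [hneg, perm_apply_inv]
      refine ⟨negIdx P (σ⁻¹ γ), (hwx _).2 ⟨(isPos_negIdx b _).2 h2, ?_⟩, ?_⟩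
      · rw [h5, hneg', isPos_negIdx, not_not]
        exact h4
      · have : ¬ b.IsPos (negIdx P γ) := by rwa [isPos_negIdx, not_not]
        simp only [f, h5, if_neg this, negIdx_negIdx]

end Length

/-! ### Reflection orders and chains with increasing labels. -/

section ReflectionOrder

variable [Finite ι] {P : RootPairing ι ℝ V V'} [P.IsRootSystem] [P.IsCrystallographic]
  [P.IsReduced] (b : P.Base)

/-- `x₀ = 1, x₁, …, x_N` in the Weyl group, with `x_{i+1} = s_{β_i} x_i`, where `β_0, …, β_{N-1}` is
an enumeration of the positive roots such that `β_0, …, β_{i-1}` are the inversions of `x_i⁻¹`. -/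
structure IsReflectionOrder (N : ℕ) (β : ℕ → ι) (x : ℕ → V ≃ₗ[ℝ] V) : Prop where
  mem : ∀ i, i ≤ N → x i ∈ weylGroup P
  succ : ∀ i, i < N → x (i + 1) = P.reflection (β i) * x i
  isPos : ∀ i, i < N → b.IsPos (β i)
  inversions_inv : ∀ i, i ≤ N → inversions b (x i)⁻¹ = β '' Set.Iio i
  injOn : Set.InjOn β (Set.Iio N)
  covers : ∀ α, b.IsPos α → α ∈ β '' Set.Iio N

/-- `w₀ = 1, w₁, …, w_N`, where `w_{i+1}` is either `w_i` or `w_i s_{β_i}`, covering `w_i`. -/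
structure IsIncreasingChain (N : ℕ) (β : ℕ → ι) (w : ℕ → V ≃ₗ[ℝ] V) : Prop where
  zero : w 0 = 1
  step : ∀ i, i < N → w (i + 1) = w i ∨
    w (i + 1) = w i * P.reflection (β i) ∧ weylLength b (w (i + 1)) = weylLength b (w i) + 1

variable {b} {N : ℕ} {β : ℕ → ι} {x : ℕ → V ≃ₗ[ℝ] V}

theorem IsReflectionOrder.ncard (h : IsReflectionOrder b N β x) {i : ℕ} (hi : i ≤ N) :
    (inversions b (x i)⁻¹).ncard = i := by
  rw [h.inversions_inv i hi, (h.injOn.mono (Set.Iio_subset_Iio hi)).ncard_image]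
  simp [Set.ncard_eq_toFinset_card']

theorem IsReflectionOrder.notMem (h : IsReflectionOrder b N β x) {i : ℕ} (hi : i < N) :
    β i ∉ inversions b (x i)⁻¹ := by
  rw [h.inversions_inv i hi.le]
  rintro ⟨j, hj, hji⟩
  have := h.injOn (Set.mem_Iio.2 ((Set.mem_Iio.1 hj).trans hi)) (Set.mem_Iio.2 hi) hji
  simp [this] at hj

theorem IsReflectionOrder.succ_subset (h : IsReflectionOrder b N β x) {i : ℕ} (hi : i < N) :
    inversions b (x (i + 1))⁻¹ ⊆ insert (β i) (inversions b (x i)⁻¹) := by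
  rw [h.inversions_inv i hi.le, h.inversions_inv (i + 1) hi]
  rintro - ⟨j, hj, rfl⟩
  rcases Nat.lt_succ_iff_lt_or_eq.1 (Set.mem_Iio.1 hj) with h' | rfl
  · exact Or.inr ⟨j, h', rfl⟩
  · exact Or.inl rfl

theorem IsIncreasingChain.mem {w : ℕ → V ≃ₗ[ℝ] V} (hw : IsIncreasingChain b N β w) {i : ℕ}
    (hi : i ≤ N) : w i ∈ weylGroup P := by
  induction i with
  | zero =>
    rw [hw.zero]
    exact one_mem _
  | succ i ih =>
    rcases hw.step i hi with h | ⟨h, -⟩ <;> rw [h]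
    · exact ih (by omega)
    · exact mul_mem (ih (by omega)) (reflection_mem P _)

/-- In the formula for `ℓ(v y)`, equality holds exactly when the intersection of the two inversion
sets is all of `inversions b v`. This turns inclusions of inversion sets into arithmetic of lengths.
-/
theorem weylLength_add_eq {v y : V ≃ₗ[ℝ] V} (hv : v ∈ weylGroup P) (hy : y ∈ weylGroup P) :
    weylLength b (v * y) + weylLength b v = (inversions b y⁻¹).ncard ↔
      inversions b v ⊆ inversions b y⁻¹ := by
  have h := weylLength_mul b hv hy
  have h1 := weylLength_eq b hv
  have h2 : (inversions b v ∩ inversions b y⁻¹).ncard ≤ (inversions b v).ncard :=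
    Set.ncard_le_ncard Set.inter_subset_left (Set.toFinite _)
  constructor
  · intro h'
    rw [← Set.inter_eq_left]
    refine Set.eq_of_subset_of_ncard_le Set.inter_subset_left ?_ (Set.toFinite _)
    omega
  · intro h'
    rw [Set.inter_eq_left.2 h'] at h
    omega

/-- When a step is taken, `w_{i+1} x_{i+1} = w_i s_β s_β x_i = w_i x_i`, while `ℓ(w_i)` and the
number of available inversions both grow by one. The length equality equivalent to the inclusion
therefore persists. -/
theorem IsIncreasingChain.inversions_subset (h : IsReflectionOrder b N β x) {w : ℕ → V ≃ₗ[ℝ] V}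
    (hw : IsIncreasingChain b N β w) {i : ℕ} (hi : i ≤ N) :
    inversions b (w i) ⊆ inversions b (x i)⁻¹ := by
  induction i with
  | zero =>
    rw [hw.zero]
    rintro α ⟨h1, h2⟩
    rw [rootPerm_one] at h2
    exact absurd h1 h2
  | succ i ih =>
    have ih := ih (by omega)
    have hwi := hw.mem (show i ≤ N by omega)
    have hxi := h.mem i (by omega)
    have hxi' := h.mem (i + 1) hi
    rcases hw.step i hi with h' | ⟨h', hl⟩
    · rw [h']
      refine ih.trans ?_
      rw [h.inversions_inv i (by omega), h.inversions_inv (i + 1) hi]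
      exact Set.image_mono (Set.Iio_subset_Iio (by omega))
    · rw [← weylLength_add_eq hwi hxi, h.ncard (by omega)] at ih
      rw [← weylLength_add_eq (hw.mem hi) hxi', h.ncard hi, hl]
      rw [h', h.succ i hi, mul_assoc, ← mul_assoc (P.reflection _), reflection_mul_self, one_mul]
      omega

/-- The chain can be recovered from its end: step `i` was taken exactly when `w_{i+1}` makes `β_i`
negative. If it was skipped, `β_i` is not an inversion of `w_i`, because it is not one of `x_i⁻¹`;
if it was taken, the length went up. -/
theorem IsIncreasingChain.eq_of_eq (h : IsReflectionOrder b N β x) {w w' : ℕ → V ≃ₗ[ℝ] V}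
    (hw : IsIncreasingChain b N β w) (hw' : IsIncreasingChain b N β w') (hN : w N = w' N) {i : ℕ}
    (hi : i ≤ N) : w i = w' i := by
  have key : ∀ {w : ℕ → V ≃ₗ[ℝ] V}, IsIncreasingChain b N β w → ∀ i < N,
      (w (i + 1) = w i ∧ b.IsPos (rootPerm P (w (i + 1)) (β i))) ∨
      (w (i + 1) = w i * P.reflection (β i) ∧ ¬ b.IsPos (rootPerm P (w (i + 1)) (β i))) := by
    intro w hw i hi
    have hwi := hw.mem hi.le
    rcases hw.step i hi with h' | ⟨h', hl⟩
    · left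
      refine ⟨h', ?_⟩
      rw [h']
      by_contra hc
      exact h.notMem hi (hw.inversions_subset h hi.le ⟨h.isPos i hi, hc⟩)
    · right
      refine ⟨h', fun hc => ?_⟩
      have := weylLength_lt_mul_reflection b (hw.mem hi) (h.isPos i hi) hc
      rw [h', mul_assoc, reflection_mul_self, mul_one, ← h', hl] at this
      omega
  refine Nat.decreasingInduction' (P := fun i => w i = w' i) ?_ hi hN
  intro j hj _ hj'
  rcases key hw j hj with ⟨h1, h2⟩ | ⟨h1, h2⟩ <;> rcases key hw' j hj with ⟨h3, h4⟩ | ⟨h3, h4⟩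
  · rw [← h1, ← h3, hj']
  · exact absurd (hj' ▸ h2) h4
  · exact absurd h4 (hj' ▸ h2)
  · exact mul_right_cancel (h1.symm.trans (hj'.trans h3))

/-- Build the chain backwards, undoing `s_{β_i}` exactly when the current element makes `β_i`
negative. -/
theorem exists_isIncreasingChain_aux (h : IsReflectionOrder b N β x) {i : ℕ} (hi : i ≤ N)
    {v : V ≃ₗ[ℝ] V} (hv : v ∈ weylGroup P) (hvi : inversions b v ⊆ inversions b (x i)⁻¹) :
    ∃ w, IsIncreasingChain b i β w ∧ w i = v := by
  induction i generalizing v with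
  | zero =>
    rw [h.inversions_inv 0 (by omega)] at hvi
    have : v = 1 := eq_one_of_inversions_eq_empty b hv (by simpa using hvi)
    exact ⟨fun _ => 1, ⟨rfl, fun i hi => by omega⟩, this.symm⟩
  | succ i ih =>
    have hxi := h.mem i (by omega)
    have hxi' := h.mem (i + 1) hi
    suffices ∃ u ∈ weylGroup P, inversions b u ⊆ inversions b (x i)⁻¹ ∧
        (v = u ∨ v = u * P.reflection (β i) ∧ weylLength b v = weylLength b u + 1) by
      obtain ⟨u, hu, hui, huv⟩ := this
      obtain ⟨w, hw, rfl⟩ := ih (by omega) hu hui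
      refine ⟨fun j => if j ≤ i then w j else v, ⟨by simp [hw.zero], ?_⟩, by simp⟩
      intro j hj
      rcases Nat.lt_succ_iff_lt_or_eq.1 hj with hj' | rfl
      · simpa [hj', hj'.le, Nat.succ_le_iff] using hw.step j hj'
      · simpa using huv
    by_cases hc : b.IsPos (rootPerm P v (β i))
    · refine ⟨v, hv, fun α hα => ?_, Or.inl rfl⟩
      rcases h.succ_subset hi (hvi hα) with rfl | h'
      · exact absurd hc hα.2
      · exact h'
    · have hs := reflection_mem P (β i)
      have hlt := weylLength_mul_reflection_lt b hv (h.isPos i hi) hc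
      rw [← weylLength_add_eq hv hxi', h.ncard hi] at hvi
      -- Put `u = v s_{β_i}`. Then `ℓ(u x_i) = ℓ(v x_{i+1}) = i + 1 - ℓ(v)`, whereas the product
      -- formula gives `ℓ(u x_i) ≥ i - ℓ(u)`. Together with `ℓ(u) < ℓ(v)` this forces `ℓ(v) = ℓ(u) +
      -- 1`, and then equality holds in the bound.
      have heq : v * P.reflection (β i) * x i = v * x (i + 1) := by
        rw [h.succ i hi, mul_assoc]
      have hmul := weylLength_mul b (mul_mem hv hs) hxi
      have h2 : (inversions b (v * P.reflection (β i)) ∩ inversions b (x i)⁻¹).ncard ≤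
          (inversions b (v * P.reflection (β i))).ncard :=
        Set.ncard_le_ncard Set.inter_subset_left (Set.toFinite _)
      rw [← weylLength_eq b (mul_mem hv hs)] at h2
      rw [heq, h.ncard (by omega)] at hmul
      refine ⟨v * P.reflection (β i), mul_mem hv hs, ?_, Or.inr ⟨?_, by omega⟩⟩
      · rw [← weylLength_add_eq (mul_mem hv hs) hxi, heq, h.ncard (by omega)]
        omega
      · rw [mul_assoc, reflection_mul_self, mul_one]

/-- For a reflection order, every element of the Weyl group is the end of an increasing saturated
chain that starts at `1`. -/
theorem exists_isIncreasingChain (h : IsReflectionOrder b N β x) {v : V ≃ₗ[ℝ] V}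
    (hv : v ∈ weylGroup P) : ∃ w, IsIncreasingChain b N β w ∧ w N = v := by
  refine exists_isIncreasingChain_aux h le_rfl hv ?_
  rw [h.inversions_inv N le_rfl]
  exact fun α hα => h.covers α hα.1

end ReflectionOrder

end RootSystems

end Alcoves

namespace Alcoves

/-! ### The highest root dominates every root. -/

section HighestRoot

variable {ι V V' : Type*} [AddCommGroup V] [Module ℝ V] [AddCommGroup V'] [Module ℝ V']
  [Finite ι] {P : RootPairing ι ℝ V V'} [P.IsRootSystem] [P.IsCrystallographic]
  [P.IsReduced]

theorem root_mem_closure_of_isPos {b : P.Base} {α : ι} (h : b.IsPos α) :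
    P.root α ∈ AddSubmonoid.closure (P.root '' b.support) := by
  refine h.induction_on_add (p := fun α => P.root α ∈ AddSubmonoid.closure (P.root '' b.support))
    ?_ ?_
  · exact fun i hi => AddSubmonoid.subset_closure ⟨i, hi, rfl⟩
  · intro i j k hk hi hj
    rw [hk]
    exact add_mem hi (AddSubmonoid.subset_closure ⟨j, hj, rfl⟩)

theorem exists_sum_nat_of_mem_closure {b : P.Base} {x : V}
    (hx : x ∈ AddSubmonoid.closure (P.root '' b.support)) :
    ∃ n : ι → ℕ, x = ∑ j ∈ b.support, n j • P.root j := by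
  classical
  induction hx using AddSubmonoid.closure_induction with
  | mem x hx =>
    obtain ⟨i, hi, rfl⟩ := hx
    exact ⟨Pi.single i 1, by
      rw [Finset.sum_eq_single_of_mem i hi (fun j _ hj => by simp [hj])]
      simp⟩
  | zero => exact ⟨0, by simp⟩
  | add x y _ _ hx hy =>
    obtain ⟨m, rfl⟩ := hx
    obtain ⟨n, rfl⟩ := hy
    exact ⟨m + n, by simp [add_smul, Finset.sum_add_distrib]⟩

variable [P.IsIrreducible]

/-- A dominant positive root involves every simple root. -/
theorem pos_coeff_of_dominant {b : P.Base} {α : ι} (hdom : ∀ j ∈ b.support, 0 ≤ P.pairingIn ℤ α j)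
    {n : ι → ℕ} (hn : P.root α = ∑ j ∈ b.support, n j • P.root j) {i : ι} (hi : i ∈ b.support) :
    n i ≠ 0 := by
  classical
  intro hni
  set S : Set ι := {j | j ∈ b.support ∧ n j ≠ 0}
  -- The simple roots occurring in `α` span a subspace which turns out to be invariant under the
  -- Weyl group, hence everything by irreducibility; a missing simple root would contradict linear
  -- independence.
  set q : Submodule ℝ V := Submodule.span ℝ (P.root '' S)
  have hpair : ∀ j ∈ b.support, n j = 0 → ∀ k ∈ S, P.pairingIn ℤ k j = 0 := by
    intro j hj hnj
    have hsum : P.pairingIn ℤ α j = ∑ k ∈ b.support, (n k : ℤ) * P.pairingIn ℤ k j := by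
      apply FaithfulSMul.algebraMap_injective ℤ ℝ
      simp only [map_sum, map_mul, RootPairing.algebraMap_pairingIn]
      rw [← RootPairing.root_coroot'_eq_pairing, hn, map_sum]
      exact Finset.sum_congr rfl fun k _ => by
        rw [map_nsmul, RootPairing.root_coroot'_eq_pairing, nsmul_eq_mul]
        simp
    have hle : ∀ k ∈ b.support, (n k : ℤ) * P.pairingIn ℤ k j ≤ 0 := by
      intro k hk
      rcases eq_or_ne k j with rfl | hkj
      · simp [hnj]
      · exact mul_nonpos_of_nonneg_of_nonpos (by positivity)
          (b.pairingIn_le_zero_of_ne hkj hk hj)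
    -- For `j` not occurring in `α` all terms are nonpositive, while dominance makes the sum
    -- nonnegative; so every term vanishes.
    have h0 : ∑ k ∈ b.support, (n k : ℤ) * P.pairingIn ℤ k j = 0 :=
      le_antisymm (Finset.sum_nonpos hle) (hsum ▸ hdom j hj)
    rw [Finset.sum_eq_zero_iff_of_nonpos hle] at h0
    rintro k ⟨hk, hk'⟩
    exact (mul_eq_zero.1 (h0 k hk)).resolve_left (by exact_mod_cast hk')
  have hq : ∀ j, q ∈ Module.End.invtSubmodule (P.reflection j).toLinearMap := by
    rw [← b.forall_mem_support_invtSubmodule_iff]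
    intro j hj
    rw [Module.End.mem_invtSubmodule]
    refine Submodule.span_le.2 ?_
    rintro - ⟨k, hk, rfl⟩
    change P.reflection j (P.root k) ∈ q
    rw [RootPairing.reflection_apply, RootPairing.root_coroot'_eq_pairing]
    by_cases hnj : n j = 0
    · rw [← P.algebraMap_pairingIn ℤ, hpair j hj hnj k hk]
      simpa using! Submodule.subset_span (s := P.root '' S) ⟨k, hk, rfl⟩
    · exact q.sub_mem (Submodule.subset_span ⟨k, hk, rfl⟩)
        (q.smul_mem _ (Submodule.subset_span ⟨j, ⟨hj, hnj⟩, rfl⟩))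
  have hα : P.root α ∈ q := by
    rw [hn]
    refine q.sum_mem fun j hj => ?_
    by_cases hnj : n j = 0
    · simp [hnj]
    · rw [← Nat.cast_smul_eq_nsmul ℝ]
      exact q.smul_mem _ (Submodule.subset_span ⟨j, ⟨hj, hnj⟩, rfl⟩)
  have htop : q = ⊤ := RootPairing.IsIrreducible.eq_top_of_invtSubmodule_reflection q hq (by
    intro h
    rw [h, Submodule.mem_bot] at hα
    exact P.ne_zero α hα)
  have hli := b.linearIndepOn_root
  have : P.root i ∉ Submodule.span ℝ (P.root '' S) := by
    refine (hli.mono ?_).notMem_span_of_insert (fun h => h.2 hni)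
    exact Set.insert_subset hi fun j hj => hj.1
  apply this
  change P.root i ∈ q
  rw [htop]
  exact Submodule.mem_top

/-- From a positive `α`, add simple roots as long as the sum is a root. Where this stops, `α` is
dominant, hence involves every simple root and pairs positively with `θ`; so it equals `θ` or `θ -
α` is a root, positive because of its height. -/
theorem root_sub_root_mem_closure {b : P.Base} {θ : ι} (hθ : ∀ α, b.height α ≤ b.height θ)
    (α : ι) : P.root θ - P.root α ∈ AddSubmonoid.closure (P.root '' b.support) := by
  have hθpos : b.IsPos θ := by
    rw [RootPairing.Base.isPos_iff']
    have := hθ (negIdx P θ)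
    rw [height_negIdx] at this
    omega
  have hdom : ∀ β, b.IsPos β → (∀ j ∈ b.support, P.root β + P.root j ∉ Set.range P.root) →
      ∀ j ∈ b.support, 0 ≤ P.pairingIn ℤ β j := by
    intro β hβ h j hj
    by_contra! hc
    refine h j hj (P.root_add_root_mem_of_pairingIn_neg hc ?_)
    intro h'
    rw [← root_negIdx] at h'
    rw [P.root.injective h', isPos_negIdx] at hβ
    exact hβ (RootPairing.Base.isPos_of_mem_support hj)
  have hθdom := hdom θ hθpos (by
    rintro j hj ⟨k, hk⟩
    have h1 := hθ k
    rw [b.height_add hk, RootPairing.Base.height_one_of_mem_support hj] at h1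
    omega)
  induction hN : (b.height θ - b.height α).toNat using Nat.strong_induction_on generalizing α with
  | _ N ih =>
  by_cases hα : b.IsPos α
  · by_cases hmax : ∀ j ∈ b.support, P.root α + P.root j ∉ Set.range P.root
    · have hαdom := hdom α hα hmax
      obtain ⟨n, hn⟩ := exists_sum_nat_of_mem_closure (root_mem_closure_of_isPos hα)
      have hpos : 0 < P.pairingIn ℤ α θ := by
        have hsum : P.pairingIn ℤ α θ = ∑ k ∈ b.support, (n k : ℤ) * P.pairingIn ℤ k θ := by
          apply FaithfulSMul.algebraMap_injective ℤ ℝ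
          simp only [map_sum, map_mul, RootPairing.algebraMap_pairingIn]
          rw [← RootPairing.root_coroot'_eq_pairing, hn, map_sum]
          exact Finset.sum_congr rfl fun k _ => by
            rw [map_nsmul, RootPairing.root_coroot'_eq_pairing, nsmul_eq_mul]
            simp
        rw [hsum]
        obtain ⟨j, hj, hjθ⟩ := hθpos.exists_mem_support_pos_pairingIn
        refine Finset.sum_pos' (fun k hk => mul_nonneg (by positivity) ?_) ⟨j, hj, ?_⟩
        · have := hθdom k hk
          rcases this.lt_or_eq with h | h
          · exact ((P.zero_lt_pairingIn_iff' ℤ).1 h).le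
          · exact ((P.pairingIn_eq_zero_iff).1 h.symm).ge
        · have := pos_coeff_of_dominant hαdom hn hj
          positivity
      rcases eq_or_ne θ α with rfl | hne
      · simp
      · obtain ⟨γ, hγ⟩ := P.root_sub_root_mem_of_pairingIn_pos ((P.zero_lt_pairingIn_iff' ℤ).1 hpos) hne
        rw [← hγ]
        apply root_mem_closure_of_isPos
        rw [RootPairing.Base.isPos_iff', b.height_sub hγ]
        have := hθ α
        omega
    · push Not at hmax
      obtain ⟨j, hj, k, hk⟩ := hmax
      have hk' := b.height_add hk
      rw [RootPairing.Base.height_one_of_mem_support hj] at hk'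
      have := hθ k
      have h := ih _ (by omega) k rfl
      have he : P.root θ - P.root α = (P.root θ - P.root k) + P.root j := by
        rw [hk]
        abel
      rw [he]
      exact add_mem h (AddSubmonoid.subset_closure ⟨j, hj, rfl⟩)
  · rw [sub_eq_add_neg, ← root_negIdx]
    exact add_mem (root_mem_closure_of_isPos hθpos)
      (root_mem_closure_of_isPos ((isPos_negIdx b α).2 hα))

end HighestRoot

/-! ### Positive coroots and the highest coroot as functionals. -/

section Coroots

variable {ι V V' : Type*} [AddCommGroup V] [Module ℝ V] [AddCommGroup V'] [Module ℝ V']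
  [Finite ι] {P : RootPairing ι ℝ V V'} [P.IsRootSystem] [P.IsCrystallographic]
  [P.IsReduced]

/-- Both notions agree on simple roots, change under negation, and are kept by a simple reflection
`s_j` except at `±α_j`; these operations reach all roots. This allows the results on roots to be
applied to coroots. -/
theorem isPos_flip_iff (b : P.Base) (α : ι) : b.flip.IsPos α ↔ b.IsPos α := by
  have hneg : ∀ α, b.flip.IsPos (negIdx P α) ↔ ¬ b.flip.IsPos α := fun α => isPos_negIdx b.flip α
  refine b.induction_reflect α (p := fun α => b.flip.IsPos α ↔ b.IsPos α) ?_ ?_ ?_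
  · intro i hi
    change b.flip.IsPos (negIdx P i) ↔ b.IsPos (negIdx P i)
    rw [hneg, isPos_negIdx, hi]
  · intro i hi
    exact iff_of_true (RootPairing.Base.isPos_of_mem_support (b := b.flip) hi)
      (RootPairing.Base.isPos_of_mem_support hi)
  · intro i j hi hj
    have hj1 : b.IsPos j := RootPairing.Base.isPos_of_mem_support hj
    have hj2 : b.flip.IsPos j := RootPairing.Base.isPos_of_mem_support (b := b.flip) hj
    rcases eq_or_ne i j with rfl | h1
    · change b.flip.IsPos (negIdx P i) ↔ b.IsPos (negIdx P i)
      rw [hneg, isPos_negIdx, hi]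
    · rcases eq_or_ne i (negIdx P j) with rfl | h2
      · rw [RootPairing.reflectionPerm_self]
        exact iff_of_true hj2 hj1
      · rw [isPos_reflectionPerm_iff b hj h1 h2, ← hi]
        exact isPos_reflectionPerm_iff b.flip hj h1 h2

theorem exists_coroot'_eq_sum (b : P.Base) {α : ι} (h : b.IsPos α) :
    ∃ n : ι → ℕ, ∀ x, P.coroot' α x = ∑ j ∈ b.support, n j * P.coroot' j x := by
  obtain ⟨n, hn⟩ := exists_sum_nat_of_mem_closure
    (root_mem_closure_of_isPos ((isPos_flip_iff b α).2 h))
  refine ⟨n, fun x => ?_⟩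
  change P.toLinearMap x (P.coroot α) = _
  change P.coroot α = _ at hn
  rw [hn, map_sum]
  exact Finset.sum_congr rfl fun j _ => by
    rw [map_nsmul, nsmul_eq_mul]
    rfl

theorem exists_coroot'_sub_eq_sum [P.IsIrreducible] (b : P.Base) {θ : ι}
    (h : IsHighestCoroot b θ) (α : ι) :
    ∃ n : ι → ℕ, ∀ x, P.coroot' θ x - P.coroot' α x = ∑ j ∈ b.support, n j * P.coroot' j x := by
  obtain ⟨n, hn⟩ := exists_sum_nat_of_mem_closure (root_sub_root_mem_closure (b := b.flip) h α)
  refine ⟨n, fun x => ?_⟩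
  change P.toLinearMap x (P.coroot θ) - P.toLinearMap x (P.coroot α) = _
  change P.coroot θ - P.coroot α = _ at hn
  rw [← map_sub, hn, map_sum]
  exact Finset.sum_congr rfl fun j _ => by
    rw [map_nsmul, nsmul_eq_mul]
    rfl

variable (P) in
theorem nonempty_index [P.IsIrreducible] : Nonempty ι := by
  by_contra h
  rw [not_nonempty_iff] at h
  have := RootPairing.IsIrreducible.nontrivial P
  obtain ⟨x, hx⟩ := exists_ne (0 : V)
  exact hx ((P.eq_zero_iff_forall_coroot'_eq_zero).2 fun i => h.elim i)

theorem exists_isHighestCoroot [Nonempty ι] (b : P.Base) : ∃ θ, IsHighestCoroot b θ :=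
  Finite.exists_max b.flip.height

end Coroots

/-! ### Finiteness of the Weyl group and short vectors of the root lattice. -/

section RootLattice

variable {ι V V' : Type*} [AddCommGroup V] [Module ℝ V] [AddCommGroup V'] [Module ℝ V']
  {P : RootPairing ι ℝ V V'}

theorem finite_weylGroup [Finite ι] [P.IsRootSystem] : (weylGroup P : Set (V ≃ₗ[ℝ] V)).Finite := by
  refine Set.Finite.of_finite_image (f := rootPerm P) (Set.toFinite _) ?_
  intro w hw v hv h
  apply LinearEquiv.toLinearMap_injective
  refine LinearMap.ext_on (s := Set.range P.root) ?_ ?_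
  · exact RootPairing.IsRootSystem.span_root_eq_top
  · rintro - ⟨α, rfl⟩
    change w (P.root α) = v (P.root α)
    rw [(realizes_rootPerm hw).1, (realizes_rootPerm hv).1, h]

/-- This is invariance of the form under `s_β`, applied to the pair `x`, `β`. -/
theorem rootForm_root [Fintype ι] (x : V) (β : ι) :
    2 * P.RootForm x (P.root β) = P.RootForm (P.root β) (P.root β) * P.coroot' β x := by
  have h := P.rootForm_reflection_reflection_apply β x (P.root β)
  rw [RootPairing.reflection_apply_self, RootPairing.reflection_apply, map_neg, map_sub, map_smul,
    LinearMap.sub_apply, LinearMap.smul_apply, smul_eq_mul] at h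
  linarith

/-- An element of the root lattice whose pairings with all coroots are at most `1` in absolute value
is zero. -/
theorem eq_zero_of_forall_coroot'_le_one [Finite ι] [P.IsRootSystem] [P.IsCrystallographic]
    (n : ℕ) : ∀ (L : List ι), L.length = n → (∀ α, P.coroot' α (L.map P.root).sum ≤ 1) →
      (L.map P.root).sum = 0 := by
  classical
  have : Fintype ι := Fintype.ofFinite ι
  induction n with
  | zero =>
    intro L hL _
    simp [List.length_eq_zero_iff.1 hL]
  | succ n ih =>
    intro L hL h
    set q := (L.map P.root).sum
    by_contra hq
    have hpos : 0 < P.RootForm q q := P.rootForm_pos_of_ne_zero (by simp) hq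
    -- A nonzero `q` has `(q, q) > 0`, so some summand `β` pairs positively with it. By integrality
    -- and the bound, `(q, β^∨) = 1`, so `s_β q = q - β` is a shorter sum satisfying the same
    -- bounds.
    obtain ⟨β, hβL, hβ⟩ : ∃ β ∈ L, 0 < P.RootForm q (P.root β) := by
      by_contra! hc
      have : P.RootForm q q ≤ 0 := by
        have h1 : P.RootForm q q = (L.map fun β => P.RootForm q (P.root β)).sum := by
          conv_lhs => rw [show P.RootForm q q = P.RootForm q (L.map P.root).sum from rfl]
          rw [map_list_sum, List.map_map]
          rfl
        rw [h1]
        clear_value q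
        clear hq hpos h hL h1
        induction L with
        | nil => simp
        | cons γ L ih =>
          rw [List.map_cons, List.sum_cons]
          exact add_nonpos (hc γ (by simp)) (ih fun β hβ => hc β (by simp [hβ]))
      linarith
    have h2 := rootForm_root (P := P) q β
    have h3 : 0 < P.RootForm (P.root β) (P.root β) :=
      P.rootForm_pos_of_ne_zero (by simp) (P.ne_zero β)
    have h4 : 0 < P.coroot' β q := by
      by_contra! hc
      nlinarith
    have hint : ∃ k : ℤ, P.coroot' β q = k := by
      have : ∀ M : List ι, ∃ k : ℤ, P.coroot' β (M.map P.root).sum = k := by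
        intro M
        induction M with
        | nil => exact ⟨0, by simp⟩
        | cons γ M ih =>
          obtain ⟨k, hk⟩ := ih
          refine ⟨P.pairingIn ℤ γ β + k, ?_⟩
          rw [List.map_cons, List.sum_cons, map_add, hk, RootPairing.root_coroot'_eq_pairing,
            ← P.algebraMap_pairingIn ℤ]
          simp
      exact this L
    obtain ⟨k, hk⟩ := hint
    have h5 := h β
    rw [hk] at h4 h5
    have hk1 : k = 1 := by
      have h6 : 0 < k := by exact_mod_cast h4
      have h7 : k ≤ 1 := by exact_mod_cast h5
      omega
    have hrefl : P.reflection β q = ((L.erase β).map P.root).sum := by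
      rw [RootPairing.reflection_apply, hk, hk1, Int.cast_one, one_smul, sub_eq_iff_eq_add',
        ← List.sum_cons, ← List.map_cons]
      exact ((List.perm_cons_erase hβL).map P.root).sum_eq
    have := ih (L.erase β) (by rw [List.length_erase_of_mem hβL, hL]; rfl) (by
      intro α
      rw [← hrefl, ← coroot'_reflectionPerm_reflection P β, RootPairing.reflection_same]
      exact h _)
    rw [← hrefl] at this
    exact hq ((P.reflection β).map_eq_zero_iff.1 this)

theorem eq_zero_of_mem_closure_root [Finite ι] [P.IsRootSystem] [P.IsCrystallographic] {q : V}
    (hq : q ∈ AddSubgroup.closure (Set.range P.root)) (h : ∀ α, P.coroot' α q ≤ 1) : q = 0 := by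
  have : ∃ L : List ι, (L.map P.root).sum = q := by
    clear h
    induction hq using AddSubgroup.closure_induction with
    | mem x hx =>
      obtain ⟨α, rfl⟩ := hx
      exact ⟨[α], by simp⟩
    | zero => exact ⟨[], rfl⟩
    | add x y _ _ hx hy =>
      obtain ⟨L, rfl⟩ := hx
      obtain ⟨M, rfl⟩ := hy
      exact ⟨L ++ M, by simp⟩
    | neg x _ hx =>
      obtain ⟨L, rfl⟩ := hx
      refine ⟨L.map (negIdx P), ?_⟩
      clear * -
      induction L with
      | nil => simp
      | cons α L ih =>
        simp only [List.map_cons, List.sum_cons, root_negIdx, neg_add, ih]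
  obtain ⟨L, rfl⟩ := this
  exact eq_zero_of_forall_coroot'_le_one _ L rfl h

end RootLattice

end Alcoves

namespace Alcoves

/-! ### Faces and alcoves described by representative points. -/

section Cells

variable {ι V V' : Type*} [AddCommGroup V] [Module ℝ V] [AddCommGroup V'] [Module ℝ V']
  {P : RootPairing ι ℝ V V'}

variable (P) in
/-- The face of the affine arrangement through a point. -/
def cell (x : V) : Set V :=
  {y | ∀ (α : ι) (k : ℤ), (P.coroot' α y < k ↔ P.coroot' α x < k) ∧
    ((k : ℝ) < P.coroot' α y ↔ (k : ℝ) < P.coroot' α x)}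

variable (P) in
/-- The point `x` lies in the closure of the face through `a`. -/
def Adheres (x a : V) : Prop := ∀ (α : ι) (k : ℤ), (k : ℝ) ≤ P.coroot' α a → (k : ℝ) ≤ P.coroot' α x

variable (P) in
/-- The point lies in no hyperplane of the affine arrangement. -/
def Generic (a : V) : Prop := ∀ (α : ι) (k : ℤ), P.coroot' α a ≠ k

theorem mem_cell_self (x : V) : x ∈ cell P x := fun _ _ => ⟨Iff.rfl, Iff.rfl⟩

/-- Opposite inequalities are the same inequalities for the negative roots. -/
theorem mem_cell_of_lt_iff {x y : V}
    (h : ∀ (α : ι) (k : ℤ), P.coroot' α y < k ↔ P.coroot' α x < k) : y ∈ cell P x := by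
  intro α k
  refine ⟨h α k, ?_⟩
  have := h (negIdx P α) (-k)
  rw [coroot'_negIdx, coroot'_negIdx] at this
  push_cast at this
  rwa [neg_lt_neg_iff, neg_lt_neg_iff] at this

theorem cell_eq {x y : V} (h : y ∈ cell P x) : cell P y = cell P x := by
  ext z
  exact forall_congr' fun α => forall_congr' fun k => by rw [(h α k).1, (h α k).2]

theorem mem_cell_of_eq {x y : V} (h : cell P y = cell P x) : y ∈ cell P x :=
  h ▸ mem_cell_self y

theorem isFace_iff {F : Set V} : IsFace P F ↔ ∃ x, F = cell P x := Iff.rfl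

theorem isFace_cell (x : V) : IsFace P (cell P x) := ⟨x, rfl⟩

theorem coroot'_eq_of_mem_cell {x y : V} (h : y ∈ cell P x) {α : ι} {k : ℤ}
    (hx : P.coroot' α x = k) : P.coroot' α y = k := by
  have h1 := h α k
  rw [hx] at h1
  simp only [lt_irrefl, iff_false, not_lt] at h1
  exact le_antisymm h1.2 h1.1

theorem cell_subset_hyperplane {x : V} {α : ι} {k : ℤ} :
    cell P x ⊆ hyperplane P α k ↔ P.coroot' α x = k :=
  ⟨fun h => h (mem_cell_self x), fun h _ hy => coroot'_eq_of_mem_cell hy h⟩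

theorem mem_faceClosure_cell {a z : V} : z ∈ faceClosure P (cell P a) ↔ Adheres P z a := by
  refine forall_congr' fun α => forall_congr' fun k => ?_
  refine imp_congr_left ⟨fun h => h a (mem_cell_self a), fun h y hy => ?_⟩
  have := (hy α k).1
  rw [← not_lt] at h ⊢
  rwa [this]

theorem Adheres.of_mem_cell {x y a : V} (h : Adheres P x a) (hy : y ∈ cell P x) :
    Adheres P y a := by
  intro α k hk
  rw [← not_lt, (hy α k).1, not_lt]
  exact h α k hk

theorem isFaceOf_cell {x a : V} : IsFaceOf P (cell P x) (cell P a) ↔ Adheres P x a :=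
  ⟨fun h => mem_faceClosure_cell.1 (h.2 (mem_cell_self x)),
    fun h => ⟨isFace_cell x, fun _ hy => mem_faceClosure_cell.2 (h.of_mem_cell hy)⟩⟩

theorem Adheres.le {x a : V} (h : Adheres P x a) {α : ι} {k : ℤ} (hk : P.coroot' α a ≤ k) :
    P.coroot' α x ≤ k := by
  have := h (negIdx P α) (-k)
  rw [coroot'_negIdx, coroot'_negIdx] at this
  push_cast at this
  rw [neg_le_neg_iff, neg_le_neg_iff] at this
  exact this hk

theorem Adheres.lt_iff {x a : V} (h : Adheres P x a) {α : ι} {k : ℤ} (hx : P.coroot' α x ≠ k) :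
    P.coroot' α a < k ↔ P.coroot' α x < k := by
  constructor
  · intro h'
    exact lt_of_le_of_ne (h.le h'.le) hx
  · intro h'
    by_contra! hc
    exact absurd (h α k hc) (not_le.2 h')

theorem singleton_zero_eq_cell [P.IsRootSystem] : ({0} : Set V) = cell P 0 := by
  ext y
  rw [Set.mem_singleton_iff]
  constructor
  · rintro rfl
    exact mem_cell_self 0
  · intro h
    refine (P.eq_zero_iff_forall_coroot'_eq_zero).2 fun α => ?_
    have := coroot'_eq_of_mem_cell h (α := α) (k := 0) (by simp)
    simpa using this

section Base

variable (b : P.Base)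

theorem isPos_or_isPos_negIdx (α : ι) : b.IsPos α ∨ b.IsPos (negIdx P α) := by
  rw [isPos_negIdx]
  exact em _

theorem generic_of_isPos {a : V} (h : ∀ α, b.IsPos α → ∀ k : ℤ, P.coroot' α a ≠ k) :
    Generic P a := by
  intro α k hk
  rcases isPos_or_isPos_negIdx b α with hα | hα
  · exact h α hα k hk
  · refine h _ hα (-k) ?_
    rw [coroot'_negIdx, hk]
    push_cast
    rfl

theorem mem_cell_of_isPos {x y : V}
    (h : ∀ α, b.IsPos α → ∀ k : ℤ, (P.coroot' α y < k ↔ P.coroot' α x < k) ∧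
      ((k : ℝ) < P.coroot' α y ↔ (k : ℝ) < P.coroot' α x)) : y ∈ cell P x := by
  intro α k
  rcases isPos_or_isPos_negIdx b α with hα | hα
  · exact h α hα k
  · have := h _ hα (-k)
    rw [coroot'_negIdx, coroot'_negIdx] at this
    push_cast at this
    rw [neg_lt_neg_iff, neg_lt_neg_iff, neg_lt_neg_iff, neg_lt_neg_iff] at this
    exact this.symm

theorem between_cell {m : ι → ℤ} {a : V}
    (ha : ∀ α, b.IsPos α → (m α : ℝ) < P.coroot' α a ∧ P.coroot' α a < m α + 1) :
    Generic P a ∧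
      {x | ∀ α, b.IsPos α → (m α : ℝ) < P.coroot' α x ∧ P.coroot' α x < m α + 1} = cell P a := by
  have key : ∀ (x : ℝ) (m k : ℤ), (m : ℝ) < x → x < m + 1 → (x < k ↔ m + 1 ≤ k) ∧
      ((k : ℝ) < x ↔ k ≤ m) := by
    intro x m k h1 h2
    refine ⟨⟨fun h => ?_, fun h => ?_⟩, ⟨fun h => ?_, fun h => ?_⟩⟩
    · have : (m : ℝ) < k := h1.trans h
      exact_mod_cast this
    · have : ((m + 1 : ℤ) : ℝ) ≤ k := by exact_mod_cast h
      push_cast at this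
      linarith
    · have : (k : ℝ) < ((m + 1 : ℤ) : ℝ) := by push_cast; linarith
      have : k < m + 1 := by exact_mod_cast this
      omega
    · have : (k : ℝ) ≤ m := by exact_mod_cast h
      linarith
  refine ⟨generic_of_isPos b fun α hα k hk => ?_, ?_⟩
  · obtain ⟨h1, h2⟩ := ha α hα
    have := key _ _ k h1 h2
    rw [hk] at this
    simp only [lt_irrefl, false_iff] at this
    omega
  · ext x
    constructor
    · intro hx
      refine mem_cell_of_isPos b fun α hα k => ?_
      rw [(key _ _ k (hx α hα).1 (hx α hα).2).1, (key _ _ k (hx α hα).1 (hx α hα).2).2,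
        (key _ _ k (ha α hα).1 (ha α hα).2).1, (key _ _ k (ha α hα).1 (ha α hα).2).2]
      exact ⟨Iff.rfl, Iff.rfl⟩
    · intro hx α hα
      have h1 := (hx α (m α)).2
      have h2 := (hx α (m α + 1)).1
      push_cast at h2
      exact ⟨h1.2 (ha α hα).1, h2.2 (ha α hα).2⟩

/-- The integers `m_α` of an alcove are the floors of the pairings at any of its points; genericity
makes the inequalities strict. Working with points `a` replaces set-theoretic conditions by
inequalities. -/
theorem isAlcove_iff {A : Set V} : IsAlcove b A ↔ ∃ a, Generic P a ∧ A = cell P a := by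
  constructor
  · rintro ⟨⟨a, ha⟩, m, rfl⟩
    obtain ⟨h1, h2⟩ := between_cell b ha
    exact ⟨a, h1, h2⟩
  · rintro ⟨a, ha, rfl⟩
    refine ⟨⟨a, mem_cell_self a⟩, fun α => ⌊P.coroot' α a⌋, ?_⟩
    refine (between_cell b fun α hα => ⟨?_, Int.lt_floor_add_one _⟩).2.symm
    exact lt_of_le_of_ne (Int.floor_le _) fun h => ha α _ h.symm

theorem fundamentalAlcove_eq_cell {a : V} (ha : a ∈ fundamentalAlcove b) :
    fundamentalAlcove b = cell P a ∧ Generic P a := by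
  have := between_cell b (m := fun _ => 0) (a := a) (by simpa [fundamentalAlcove] using ha)
  refine ⟨?_, this.1⟩
  rw [← this.2]
  simp [fundamentalAlcove]

theorem mem_fundamentalAlcove_of_generic {a : V} (ha : Generic P a)
    (h : ∀ α, b.IsPos α → 0 ≤ P.coroot' α a ∧ P.coroot' α a ≤ 1) : a ∈ fundamentalAlcove b := by
  intro α hα
  refine ⟨lt_of_le_of_ne (h α hα).1 ?_, lt_of_le_of_ne (h α hα).2 ?_⟩
  · simpa using (ha α 0).symm
  · simpa using ha α 1

end Base

/-! ### Affine automorphisms that preserve the arrangement. -/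

section Reflections

theorem affineReflection_negIdx (α : ι) (k : ℤ) :
    affineReflection P (negIdx P α) (-k) = affineReflection P α k := by
  ext x
  simp only [affineReflection_apply, coroot'_negIdx, root_negIdx]
  push_cast
  module

theorem affineReflection_linear (α : ι) (k : ℤ) :
    (affineReflection P α k).linear = P.reflection α := rfl

theorem affineReflection_mul_self (α : ι) (k : ℤ) :
    affineReflection P α k * affineReflection P α k = 1 := by
  ext x
  change affineReflection P α k (affineReflection P α k x) = x
  simp only [affineReflection_apply, map_sub, map_smul, RootPairing.root_coroot'_eq_pairing,
    RootPairing.pairing_same, smul_eq_mul]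
  module

theorem affineReflection_apply_apply (α : ι) (k : ℤ) (x : V) :
    affineReflection P α k (affineReflection P α k x) = x :=
  congrArg (fun g : V ≃ᵃ[ℝ] V => g x) (affineReflection_mul_self α k)

theorem affineReflection_image_image (α : ι) (k : ℤ) (A : Set V) :
    affineReflection P α k '' (affineReflection P α k '' A) = A := by
  rw [Set.image_image]
  simp only [affineReflection_apply_apply, Set.image_id']

theorem coroot'_affineReflection_self (α : ι) (k : ℤ) (x : V) :
    P.coroot' α (affineReflection P α k x) = 2 * k - P.coroot' α x := by
  rw [affineReflection_apply, map_sub, map_smul, RootPairing.root_coroot'_eq_pairing,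
    RootPairing.pairing_same, smul_eq_mul]
  ring

theorem affineReflection_eq_self {α : ι} {k : ℤ} {x : V} (h : P.coroot' α x = k) :
    affineReflection P α k x = x := by
  rw [affineReflection_apply, h, sub_self, zero_smul, sub_zero]

theorem affineReflection_mem (α : ι) (k : ℤ) : affineReflection P α k ∈ affineWeylGroup P :=
  Subgroup.subset_closure ⟨α, k, rfl⟩

variable (P) in
/-- The affine automorphism `g` permutes the hyperplanes of the arrangement and is compatible with
the action of `σ` on the roots. -/
def Permutes (g : V ≃ᵃ[ℝ] V) (σ : Equiv.Perm ι) (c : ι → ℤ) : Prop :=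
  (∀ α x, P.coroot' (σ α) (g x) = P.coroot' α x + c α) ∧
    ∀ α, g.linear (P.root α) = P.root (σ α)

variable (P) in
/-- The group of affine automorphisms that permute the hyperplanes of the arrangement and the
roots. -/
def arrangementGroup : Subgroup (V ≃ᵃ[ℝ] V) where
  carrier := {g | ∃ σ c, Permutes P g σ c}
  one_mem' := ⟨1, 0, fun α x => by simp, fun α => rfl⟩
  mul_mem' := by
    rintro g h ⟨σ, c, hg⟩ ⟨τ, d, hh⟩
    refine ⟨σ * τ, fun α => d α + c (τ α), fun α x => ?_, fun α => ?_⟩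
    · rw [Equiv.Perm.mul_apply, AffineEquiv.coe_mul, Function.comp_apply, hg.1, hh.1]
      push_cast
      ring
    · change g.linear (h.linear _) = _
      rw [hh.2, hg.2]
      rfl
  inv_mem' := by
    rintro g ⟨σ, c, hg⟩
    have hgg : ∀ x, g (g⁻¹ x) = x := fun x => g.apply_symm_apply x
    refine ⟨σ⁻¹, fun α => -c (σ⁻¹ α), fun α x => ?_, fun α => ?_⟩
    · have := hg.1 (σ⁻¹ α) (g⁻¹ x)
      rw [hgg, perm_apply_inv] at this
      rw [this]
      push_cast
      ring
    · apply g.linear.injective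
      rw [hg.2, perm_apply_inv]
      exact g.linear.apply_symm_apply _

theorem affineReflection_permutes (α : ι) (k : ℤ) [P.IsCrystallographic] :
    Permutes P (affineReflection P α k) (P.reflectionPerm α)
      fun β => k * P.pairingIn ℤ α (P.reflectionPerm α β) := by
  refine ⟨fun β x => ?_, fun β => (P.root_reflectionPerm α β).symm⟩
  have h : affineReflection P α k x = P.reflection α x + (k : ℝ) • P.root α := by
    rw [affineReflection_apply, RootPairing.reflection_apply]
    module
  rw [h, map_add, map_smul, coroot'_reflectionPerm_reflection, RootPairing.root_coroot'_eq_pairing,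
    ← P.algebraMap_pairingIn ℤ]
  push_cast
  rfl

theorem affineWeylGroup_le [P.IsCrystallographic] : affineWeylGroup P ≤ arrangementGroup P := by
  refine (Subgroup.closure_le _).2 ?_
  rintro - ⟨α, k, rfl⟩
  exact ⟨_, _, affineReflection_permutes α k⟩

variable (P) in
/-- Translations, as elements of the group of affine automorphisms. -/
abbrev translation (v : V) : V ≃ᵃ[ℝ] V := AffineEquiv.constVAdd ℝ V v

theorem translation_mem {v : V} (hv : IsWeight P v) : translation v ∈ arrangementGroup P := by
  choose c hc using hv
  refine ⟨1, c, fun α x => ?_, fun α => rfl⟩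
  rw [Equiv.Perm.one_apply, AffineEquiv.constVAdd_apply, vadd_eq_add, map_add, hc]
  ring

theorem image_cell {g : V ≃ᵃ[ℝ] V} (hg : g ∈ arrangementGroup P) (x : V) :
    g '' cell P x = cell P (g x) := by
  have key : ∀ g ∈ arrangementGroup P, ∀ x, ∀ y ∈ cell P x, g y ∈ cell P (g x) := by
    rintro g ⟨σ, c, hg⟩ x y hy
    refine mem_cell_of_lt_iff fun α k => ?_
    have h1 := hg.1 (σ⁻¹ α) x
    have h2 := hg.1 (σ⁻¹ α) y
    have h3 := (hy (σ⁻¹ α) (k - c (σ⁻¹ α))).1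
    rw [perm_apply_inv] at h1 h2
    push_cast at h3
    rw [h1, h2, ← lt_sub_iff_add_lt, ← lt_sub_iff_add_lt, h3]
  apply Set.Subset.antisymm
  · rintro - ⟨y, hy, rfl⟩
    exact key g hg x y hy
  · intro y hy
    refine ⟨g⁻¹ y, ?_, g.apply_symm_apply y⟩
    have := key g⁻¹ (inv_mem hg) _ y hy
    rwa [show g⁻¹ (g x) = x from g.symm_apply_apply x] at this

theorem adheres_image {g : V ≃ᵃ[ℝ] V} (hg : g ∈ arrangementGroup P) {x a : V} :
    Adheres P (g x) (g a) ↔ Adheres P x a := by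
  have key : ∀ g ∈ arrangementGroup P, ∀ x a, Adheres P x a → Adheres P (g x) (g a) := by
    rintro g ⟨σ, c, hg⟩ x a h α k hk
    have h1 := hg.1 (σ⁻¹ α) x
    have h2 := hg.1 (σ⁻¹ α) a
    rw [perm_apply_inv] at h1 h2
    have := h (σ⁻¹ α) (k - c (σ⁻¹ α))
    push_cast at this
    rw [h2] at hk
    rw [h1]
    linarith [this (by linarith)]
  refine ⟨fun h => ?_, key g hg x a⟩
  have := key g⁻¹ (inv_mem hg) _ _ h
  rwa [show g⁻¹ (g x) = x from g.symm_apply_apply x,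
    show g⁻¹ (g a) = a from g.symm_apply_apply a] at this

theorem generic_image {g : V ≃ᵃ[ℝ] V} (hg : g ∈ arrangementGroup P) {a : V} (ha : Generic P a) :
    Generic P (g a) := by
  obtain ⟨σ, c, hg⟩ := hg
  intro α k h
  have h2 := hg.1 (σ⁻¹ α) a
  rw [perm_apply_inv, h] at h2
  refine ha (σ⁻¹ α) (k - c (σ⁻¹ α)) ?_
  push_cast
  linarith

theorem isAlcove_image {b : P.Base} {g : V ≃ᵃ[ℝ] V} (hg : g ∈ arrangementGroup P) {A : Set V}
    (h : IsAlcove b A) : IsAlcove b (g '' A) := by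
  obtain ⟨a, ha, rfl⟩ := (isAlcove_iff b).1 h
  exact (isAlcove_iff b).2 ⟨g a, generic_image hg ha, image_cell hg a⟩

theorem isFaceOf_image {b : P.Base} {g : V ≃ᵃ[ℝ] V} (hg : g ∈ arrangementGroup P) {F A : Set V}
    (hA : IsAlcove b A) (h : IsFaceOf P F A) : IsFaceOf P (g '' F) (g '' A) := by
  obtain ⟨a, ha, rfl⟩ := (isAlcove_iff b).1 hA
  obtain ⟨x, rfl⟩ := isFace_iff.1 h.1
  rw [image_cell hg, image_cell hg, isFaceOf_cell, adheres_image hg]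
  exact isFaceOf_cell.1 h

theorem image_hyperplane {g : V ≃ᵃ[ℝ] V} {σ : Equiv.Perm ι} {c : ι → ℤ} (hg : Permutes P g σ c)
    (α : ι) (k : ℤ) : g '' hyperplane P α k = hyperplane P (σ α) (k + c α) := by
  ext x
  constructor
  · rintro ⟨y, hy, rfl⟩
    have : P.coroot' α y = k := hy
    change P.coroot' (σ α) (g y) = _
    rw [hg.1, this]
    push_cast
    rfl
  · intro hx
    have hx' : P.coroot' (σ α) x = ((k + c α : ℤ) : ℝ) := hx
    refine ⟨g⁻¹ x, ?_, g.apply_symm_apply x⟩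
    have := hg.1 α (g⁻¹ x)
    rw [show g (g⁻¹ x) = x from g.apply_symm_apply x, hx'] at this
    push_cast at this
    change P.coroot' α (g⁻¹ x) = k
    linarith

theorem isCodimOne_image {g : V ≃ᵃ[ℝ] V} (hg : g ∈ arrangementGroup P) {F : Set V}
    (h : IsCodimOne P F) : IsCodimOne P (g '' F) := by
  have himg : ∀ g ∈ arrangementGroup P, ∀ H : Set V, (∃ (α : ι) (k : ℤ), H = hyperplane P α k) →
      ∃ (α : ι) (k : ℤ), g '' H = hyperplane P α k := by
    rintro g ⟨σ, c, hg⟩ - ⟨α, k, rfl⟩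
    exact ⟨_, _, image_hyperplane hg α k⟩
  have hinv : ∀ H : Set V, g '' ((g⁻¹ : V ≃ᵃ[ℝ] V) '' H) = H := by
    intro H
    rw [Set.image_image]
    simp only [show ∀ x, g (g⁻¹ x) = x from fun x => g.apply_symm_apply x, Set.image_id']
  obtain ⟨H, ⟨hH, hFH⟩, huniq⟩ := h
  refine ⟨g '' H, ⟨himg g hg H hH, Set.image_mono hFH⟩, ?_⟩
  rintro H' ⟨hH', hF'⟩
  rw [← hinv H']
  congr 1
  refine huniq _ ⟨himg _ (inv_mem hg) _ hH', ?_⟩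
  rw [← hinv H'] at hF'
  exact (Set.image_subset_image_iff g.injective).1 hF'

theorem conj_affineReflection {g : V ≃ᵃ[ℝ] V} {σ : Equiv.Perm ι} {c : ι → ℤ}
    (hg : Permutes P g σ c) (α : ι) (k : ℤ) :
    affineReflection P (σ α) (k + c α) * g = g * affineReflection P α k := by
  ext x
  change affineReflection P (σ α) (k + c α) (g x) = g (affineReflection P α k x)
  have h : g (affineReflection P α k x) = -(P.coroot' α x - k) • P.root (σ α) + g x := by
    rw [← hg.2, ← map_smul]
    refine Eq.trans (congrArg g ?_) (g.map_vadd x _)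
    rw [affineReflection_apply, vadd_eq_add]
    module
  rw [h, affineReflection_apply, hg.1]
  push_cast
  module

end Reflections

/-! ### Walls, their unique hyperplanes and the reflections in them. -/

section CodimOne

variable [Finite ι] [P.IsRootSystem] [P.IsCrystallographic] [P.IsReduced]

/-- Equal hyperplanes have equal directions, so the two coroots are proportional, and reducedness
leaves only the signs `±1`. -/
theorem hyperplane_eq_iff {α β : ι} {k m : ℤ} (h : hyperplane P α k = hyperplane P β m) :
    (β = α ∧ m = k) ∨ (β = negIdx P α ∧ m = -k) := by
  have hmem : ∀ x, P.coroot' α x = k ↔ P.coroot' β x = m := fun x => Set.ext_iff.1 h x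
  have h2 : P.coroot' α (P.root α) = 2 := by
    rw [RootPairing.root_coroot'_eq_pairing, RootPairing.pairing_same]
  set x₀ : V := ((k : ℝ) / 2) • P.root α
  have hx₀ : P.coroot' α x₀ = k := by
    rw [map_smul, h2, smul_eq_mul]
    ring
  have hx₀' := (hmem x₀).1 hx₀
  have hker : ∀ y, P.coroot' α y = 0 → P.coroot' β y = 0 := by
    intro y hy
    have := (hmem (x₀ + y)).1 (by rw [map_add, hx₀, hy, add_zero])
    rw [map_add, hx₀'] at this
    linarith
  set t : ℝ := P.coroot' β (P.root α) / 2
  have hprop : ∀ y, P.coroot' β y = t * P.coroot' α y := by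
    intro y
    have := hker (y - (P.coroot' α y / 2) • P.root α) (by
      rw [map_sub, map_smul, h2, smul_eq_mul]
      ring)
    rw [map_sub, map_smul, smul_eq_mul] at this
    simp only [t]
    linarith
  have hco : P.coroot β = t • P.coroot α := by
    apply P.flip.toPerfPair.injective
    ext y
    change P.coroot' β y = P.toLinearMap.flip (t • P.coroot α) y
    rw [map_smul, hprop]
    rfl
  have hβα : β = α ∨ β = negIdx P α := by
    by_contra! hc
    have hli := RootPairing.IsReduced.linearIndependent P.flip hc.1 (by
      intro h'
      apply hc.2
      apply P.root.injective
      rw [root_negIdx]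
      exact RootPairing.root_eq_neg_iff P |>.2 (RootPairing.coroot_eq_neg_iff P |>.1 h'))
    rw [LinearIndependent.pair_iff] at hli
    have := hli 1 (-t) (by
      change (1 : ℝ) • P.coroot β + -t • P.coroot α = 0
      rw [hco]
      module)
    exact one_ne_zero this.1
  rcases hβα with rfl | rfl
  · left
    refine ⟨rfl, ?_⟩
    rw [hx₀] at hx₀'
    exact_mod_cast hx₀'.symm
  · right
    refine ⟨rfl, ?_⟩
    rw [coroot'_negIdx, hx₀] at hx₀'
    exact_mod_cast hx₀'.symm

variable (P) in
/-- The hyperplane `(x, α^∨) = k` is the only one that contains the face `F`. -/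
def OnlyHyperplane (F : Set V) (α : ι) (k : ℤ) : Prop :=
  F ⊆ hyperplane P α k ∧ ∀ β m, F ⊆ hyperplane P β m →
    (β = α ∧ m = k) ∨ (β = negIdx P α ∧ m = -k)

theorem OnlyHyperplane.neg {F : Set V} {α : ι} {k : ℤ} (h : OnlyHyperplane P F α k) :
    OnlyHyperplane P F (negIdx P α) (-k) := by
  refine ⟨fun x hx => ?_, fun β m hβ => ?_⟩
  · have : P.coroot' α x = k := h.1 hx
    change P.coroot' _ x = _
    rw [coroot'_negIdx, this]
    push_cast
    rfl
  · rcases h.2 β m hβ with ⟨rfl, rfl⟩ | ⟨rfl, rfl⟩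
    · exact Or.inr ⟨(negIdx_negIdx P _).symm, (neg_neg _).symm⟩
    · exact Or.inl ⟨rfl, rfl⟩

theorem IsCodimOne.onlyHyperplane {F : Set V} (h : IsCodimOne P F) {α : ι} {k : ℤ}
    (hF : F ⊆ hyperplane P α k) : OnlyHyperplane P F α k := by
  refine ⟨hF, fun β m hβ => hyperplane_eq_iff ?_⟩
  exact h.unique ⟨⟨α, k, rfl⟩, hF⟩ ⟨⟨β, m, rfl⟩, hβ⟩

theorem IsCodimOne.exists_isPos (b : P.Base) {F : Set V} (h : IsCodimOne P F) :
    ∃ α k, b.IsPos α ∧ OnlyHyperplane P F α k := by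
  obtain ⟨H, ⟨α, k, rfl⟩, hF⟩ := h.exists
  have := h.onlyHyperplane hF
  rcases isPos_or_isPos_negIdx b α with hα | hα
  · exact ⟨α, k, hα, this⟩
  · exact ⟨_, _, hα, this.neg⟩

theorem OnlyHyperplane.faceReflection_eq {F : Set V} {α : ι} {k : ℤ} (h : OnlyHyperplane P F α k) :
    faceReflection P F = affineReflection P α k := by
  have hex : ∃ p : ι × ℤ, F ⊆ hyperplane P p.1 p.2 := ⟨(α, k), h.1⟩
  rw [faceReflection, dif_pos hex]
  rcases h.2 _ _ hex.choose_spec with ⟨h1, h2⟩ | ⟨h1, h2⟩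
  · rw [h1, h2]
  · rw [h1, h2, affineReflection_negIdx]

theorem OnlyHyperplane.image {g : V ≃ᵃ[ℝ] V} {σ : Equiv.Perm ι} {c : ι → ℤ}
    (hg : Permutes P g σ c) {F : Set V} {α : ι} {k : ℤ} (hF : IsCodimOne P F)
    (h : OnlyHyperplane P F α k) : OnlyHyperplane P (g '' F) (σ α) (k + c α) := by
  refine (isCodimOne_image ⟨σ, c, hg⟩ hF).onlyHyperplane ?_
  rw [← image_hyperplane hg]
  exact Set.image_mono h.1

theorem faceReflection_image {g : V ≃ᵃ[ℝ] V} (hg : g ∈ arrangementGroup P) {F : Set V}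
    (hF : IsCodimOne P F) : faceReflection P (g '' F) * g = g * faceReflection P F := by
  obtain ⟨σ, c, hg⟩ := hg
  obtain ⟨H, ⟨α, k, rfl⟩, h⟩ := hF.exists
  have h := hF.onlyHyperplane h
  rw [(h.image hg hF).faceReflection_eq, h.faceReflection_eq, conj_affineReflection hg]

/-- Two alcoves that have a common face of codimension one, and are on the same side of the
hyperplane containing it, are equal. -/
theorem cell_eq_of_same_side {x a c : V} {α : ι} {k : ℤ} (h : OnlyHyperplane P (cell P x) α k)
    (ha : Generic P a) (hc : Generic P c) (hxa : Adheres P x a) (hxc : Adheres P x c)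
    (hside : P.coroot' α a < k ↔ P.coroot' α c < k) : cell P a = cell P c := by
  apply cell_eq
  refine mem_cell_of_lt_iff fun β m => ?_
  by_cases hx : P.coroot' β x = m
  · rcases h.2 β m (cell_subset_hyperplane.2 hx) with ⟨rfl, rfl⟩ | ⟨rfl, rfl⟩
    · exact hside
    · have hflip : ∀ a, Generic P a → (P.coroot' (negIdx P α) a < ((-k : ℤ) : ℝ) ↔
          ¬ P.coroot' α a < k) := by
        intro a ha
        rw [coroot'_negIdx]
        push_cast
        rw [neg_lt_neg_iff, not_lt]
        exact ⟨le_of_lt, fun h => lt_of_le_of_ne h (ha α k).symm⟩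
      rw [hflip a ha, hflip c hc, hside]
  · rw [hxa.lt_iff hx, hxc.lt_iff hx]

theorem image_faceReflection_mem {F : Set V} (hF : IsCodimOne P F) :
    faceReflection P F ∈ affineWeylGroup P := by
  obtain ⟨H, ⟨α, k, rfl⟩, h⟩ := hF.exists
  rw [(hF.onlyHyperplane h).faceReflection_eq]
  exact affineReflection_mem α k

/-- Only the wall's own hyperplane can separate `A` from `B`. If it does, reflecting `A` in it
brings it to the side of `B`. -/
theorem eq_or_eq_faceReflection_image {b : P.Base} {F A B : Set V} (hF : IsCodimOne P F)
    (hA : IsAlcove b A) (hB : IsAlcove b B) (hFA : IsFaceOf P F A) (hFB : IsFaceOf P F B) :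
    B = A ∨ B = faceReflection P F '' A := by
  obtain ⟨H, ⟨α, k, rfl⟩, h⟩ := hF.exists
  have h := hF.onlyHyperplane h
  obtain ⟨x, rfl⟩ := isFace_iff.1 hFA.1
  obtain ⟨a, ha, rfl⟩ := (isAlcove_iff b).1 hA
  obtain ⟨c, hc, rfl⟩ := (isAlcove_iff b).1 hB
  rw [isFaceOf_cell] at hFA hFB
  have hr := affineWeylGroup_le (affineReflection_mem (P := P) α k)
  by_cases hside : P.coroot' α a < k ↔ P.coroot' α c < k
  · exact Or.inl (cell_eq_of_same_side h ha hc hFA hFB hside).symm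
  · right
    rw [h.faceReflection_eq, image_cell hr]
    have hx := affineReflection_eq_self (cell_subset_hyperplane.1 h.1)
    refine (cell_eq_of_same_side h (generic_image hr ha) hc ?_ hFB ?_).symm
    · rw [← adheres_image hr, hx] at hFA
      exact hFA
    · rw [coroot'_affineReflection_self]
      have h1 := ha α k
      constructor
      · intro h'
        by_contra h''
        exact hside (iff_of_false (by linarith) h'')
      · intro h'
        by_contra h''
        have : P.coroot' α a < k := lt_of_le_of_ne (by linarith) h1
        exact hside (iff_of_true this h')

theorem faceReflection_image_ne {b : P.Base} {F A : Set V} (hF : IsCodimOne P F)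
    (hA : IsAlcove b A) : faceReflection P F '' A ≠ A := by
  obtain ⟨H, ⟨α, k, rfl⟩, h⟩ := hF.exists
  have h := hF.onlyHyperplane h
  obtain ⟨a, ha, rfl⟩ := (isAlcove_iff b).1 hA
  have hr := affineWeylGroup_le (affineReflection_mem (P := P) α k)
  rw [h.faceReflection_eq, image_cell hr]
  intro h'
  have h1 := mem_cell_of_eq h' α k
  rw [coroot'_affineReflection_self] at h1
  rcases lt_or_gt_of_ne (ha α k) with h2 | h2
  · linarith [h1.1.2 h2]
  · linarith [h1.2.2 h2]

theorem faceReflection_image_face {F : Set V} (hF : IsCodimOne P F) :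
    faceReflection P F '' F = F := by
  obtain ⟨H, ⟨α, k, rfl⟩, h⟩ := hF.exists
  rw [(hF.onlyHyperplane h).faceReflection_eq]
  have : ∀ x ∈ F, affineReflection P α k x = x := fun x hx => affineReflection_eq_self (h hx)
  rw [Set.image_congr this, Set.image_id']

end CodimOne

end Cells

end Alcoves

namespace Alcoves

/-! ### The closed fundamental alcove as a strict fundamental domain. -/

section FundamentalDomain

variable {ι V V' : Type*} [AddCommGroup V] [Module ℝ V] [AddCommGroup V'] [Module ℝ V']
  [Finite ι] {P : RootPairing ι ℝ V V'} [P.IsRootSystem] [P.IsCrystallographic] [P.IsReduced]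

theorem linear_mem_weylGroup {w : V ≃ᵃ[ℝ] V} (hw : w ∈ affineWeylGroup P) :
    w.linear ∈ weylGroup P := by
  induction hw using Subgroup.closure_induction with
  | mem x hx =>
    obtain ⟨α, k, rfl⟩ := hx
    exact reflection_mem P α
  | one => exact one_mem (weylGroup P)
  | mul x y _ _ hx hy => exact mul_mem hx hy
  | inv x _ hx => exact inv_mem hx

theorem affine_apply (w : V ≃ᵃ[ℝ] V) (x : V) : w x = w.linear x + w 0 := by
  have := w.map_vadd 0 x
  rwa [vadd_eq_add, vadd_eq_add, add_zero] at this

theorem apply_closure_root {w : V ≃ₗ[ℝ] V} (hw : w ∈ weylGroup P) {q : V}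
    (hq : q ∈ AddSubgroup.closure (Set.range P.root)) :
    w q ∈ AddSubgroup.closure (Set.range P.root) := by
  induction hq using AddSubgroup.closure_induction with
  | mem x hx =>
    obtain ⟨α, rfl⟩ := hx
    rw [(realizes_rootPerm hw).1]
    exact AddSubgroup.subset_closure ⟨_, rfl⟩
  | zero =>
    rw [map_zero]
    exact zero_mem _
  | add x y _ _ hx hy =>
    rw [map_add]
    exact add_mem hx hy
  | neg x _ hx =>
    rw [map_neg]
    exact neg_mem hx

theorem apply_zero_mem_closure_root {w : V ≃ᵃ[ℝ] V} (hw : w ∈ affineWeylGroup P) :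
    w 0 ∈ AddSubgroup.closure (Set.range P.root) := by
  induction hw using Subgroup.closure_induction with
  | mem x hx =>
    obtain ⟨α, k, rfl⟩ := hx
    rw [affineReflection_apply, map_zero, zero_sub, zero_sub, neg_smul, neg_neg,
      Int.cast_smul_eq_zsmul]
    exact zsmul_mem (AddSubgroup.subset_closure (Set.mem_range_self α)) k
  | one => exact zero_mem _
  | mul x y hx' _ hx hy =>
    change x (y 0) ∈ _
    rw [affine_apply x]
    exact add_mem (apply_closure_root (linear_mem_weylGroup hx') hy) hx
  | inv x hx' hx =>
    have h : (x⁻¹ : V ≃ᵃ[ℝ] V) 0 = -(x⁻¹ : V ≃ᵃ[ℝ] V).linear (x 0) := by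
      have := affine_apply x⁻¹ (x 0)
      rw [show (x⁻¹ : V ≃ᵃ[ℝ] V) (x 0) = 0 from x.symm_apply_apply 0] at this
      exact (neg_eq_of_add_eq_zero_right this.symm).symm
    rw [h]
    exact neg_mem (apply_closure_root (linear_mem_weylGroup (inv_mem hx')) hx)

variable {b : P.Base}

theorem coroot'_pos_iff_isPos {a : V} (ha : a ∈ fundamentalAlcove b) (α : ι) :
    0 < P.coroot' α a ↔ b.IsPos α := by
  refine ⟨fun h => ?_, fun h => (ha α h).1⟩
  by_contra hα
  have := (ha _ ((isPos_negIdx b α).2 hα)).1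
  rw [coroot'_negIdx] at this
  linarith

theorem coroot'_apply_pos_iff {a : V} (ha : a ∈ fundamentalAlcove b) {w : V ≃ₗ[ℝ] V}
    (hw : w ∈ weylGroup P) (α : ι) :
    0 < P.coroot' α (w a) ↔ b.IsPos ((rootPerm P w)⁻¹ α) := by
  have := (realizes_rootPerm hw).2 ((rootPerm P w)⁻¹ α) a
  rw [perm_apply_inv] at this
  rw [this, coroot'_pos_iff_isPos ha]

theorem eq_one_of_apply_mem_of_linear {a : V} (ha : a ∈ fundamentalAlcove b) {w : V ≃ₗ[ℝ] V}
    (hw : w ∈ weylGroup P) (h : w a ∈ fundamentalAlcove b) : w = 1 := by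
  refine eq_one_of_forall_isPos b hw fun i hi => ?_
  have h1 := coroot'_apply_pos_iff ha hw (rootPerm P w i)
  rw [perm_inv_apply, coroot'_pos_iff_isPos h] at h1
  exact h1.2 (RootPairing.Base.isPos_of_mem_support hi)

theorem eq_of_image_fundamentalAlcove_eq {w v : V ≃ₗ[ℝ] V} (hne : (fundamentalAlcove b).Nonempty)
    (hw : w ∈ weylGroup P) (hv : v ∈ weylGroup P)
    (h : w '' fundamentalAlcove b = v '' fundamentalAlcove b) : w = v := by
  obtain ⟨a, ha⟩ := hne
  obtain ⟨a', ha', haa'⟩ : w a ∈ v '' fundamentalAlcove b := h ▸ ⟨a, ha, rfl⟩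
  have h1 : v⁻¹ * w = 1 := by
    refine eq_one_of_apply_mem_of_linear ha (mul_mem (inv_mem hv) hw) ?_
    rw [LinearEquiv.mul_apply, ← haa', show v⁻¹ (v a') = a' from v.symm_apply_apply a']
    exact ha'
  exact (inv_mul_eq_one.1 h1).symm

/-- The affine Weyl group acts simply transitively on alcoves. -/
theorem eq_one_of_apply_mem {a : V} (ha : a ∈ fundamentalAlcove b) {w : V ≃ᵃ[ℝ] V}
    (hw : w ∈ affineWeylGroup P) (h : w a ∈ fundamentalAlcove b) : w = 1 := by
  have h0 : Adheres P 0 a := by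
    intro α k hk
    rw [map_zero]
    rcases isPos_or_isPos_negIdx b α with hα | hα
    · have h1 := hk.trans_lt (ha α hα).2
      have : k < 1 := by exact_mod_cast h1
      exact_mod_cast (by omega : k ≤ 0)
    · have h1 := (ha _ hα).1
      rw [coroot'_negIdx] at h1
      have : (k : ℝ) < 0 := by linarith
      exact this.le
  have hw0 := (adheres_image (affineWeylGroup_le hw)).2 h0
  have hz : w 0 = 0 := by
    refine eq_zero_of_mem_closure_root (apply_zero_mem_closure_root hw) fun α => ?_
    -- The point `w 0` adheres to `w a`, which lies in the fundamental alcove; being a root lattice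
    -- vector with all pairings at most `1`, it vanishes, and `w` is linear.
    have : P.coroot' α (w 0) ≤ ((1 : ℤ) : ℝ) := by
      refine hw0.le ?_
      rcases isPos_or_isPos_negIdx b α with hα | hα
      · have := (h α hα).2
        push_cast
        linarith
      · have := (h _ hα).1
        rw [coroot'_negIdx] at this
        push_cast
        linarith
    simpa using this
  have hlin : ∀ x, w x = w.linear x := fun x => by rw [affine_apply, hz, add_zero]
  have h1 : w.linear = 1 := eq_one_of_apply_mem_of_linear ha (linear_mem_weylGroup hw)
    (by rwa [← hlin])
  ext x
  rw [hlin, h1]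
  rfl

/-- The sign of the last term shows that reflecting `z` in a hyperplane strictly separating it from
`a` brings it closer to `a`. -/
theorem rootForm_affineReflection_sub [Fintype ι] (α : ι) (k : ℤ) (z a : V) :
    P.RootForm (affineReflection P α k z - a) (affineReflection P α k z - a) =
      P.RootForm (z - a) (z - a) +
        P.RootForm (P.root α) (P.root α) * ((P.coroot' α z - k) * (P.coroot' α a - k)) := by
  set c := P.coroot' α z - k with hc
  have h1 : affineReflection P α k z - a = (z - a) - c • P.root α := by
    rw [affineReflection_apply]
    abel
  have h2 := rootForm_root (P := P) (z - a) α
  have h3 : P.RootForm (P.root α) (z - a) = P.RootForm (z - a) (P.root α) :=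
    P.rootForm_symmetric.eq _ _
  rw [map_sub (P.coroot' α)] at h2
  rw [h1]
  have e1 : P.RootForm ((z - a) - c • P.root α) ((z - a) - c • P.root α) =
      P.RootForm (z - a) (z - a) - 2 * c * P.RootForm (z - a) (P.root α) +
        c * c * P.RootForm (P.root α) (P.root α) := by
    rw [map_sub P.RootForm (z - a) (c • P.root α), LinearMap.sub_apply,
      map_sub (P.RootForm (z - a)) (z - a), map_sub (P.RootForm (c • P.root α)) (z - a),
      map_smul, map_smul, LinearMap.smul_apply, LinearMap.smul_apply, map_smul, h3]
    simp only [smul_eq_mul]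
    ring
  rw [e1]
  linear_combination (-c) * h2 + c * P.RootForm (P.root α) (P.root α) * hc

/-- The closure of the fundamental alcove is a strict fundamental domain for the affine Weyl
group. -/
theorem eq_of_adheres {a x y : V} (ha : a ∈ fundamentalAlcove b) (hx : Adheres P x a)
    (hy : Adheres P y a) {w : V ≃ᵃ[ℝ] V} (hw : w ∈ affineWeylGroup P) (h : w x = y) : x = y := by
  have : Fintype ι := Fintype.ofFinite ι
  set S : Set (V ≃ᵃ[ℝ] V) := {v | v ∈ affineWeylGroup P ∧ v x = y}
  -- An affine map sending `x` to `y` is determined by its linear part, which lies in the finite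
  -- Weyl group.
  have hS : S.Finite := by
    refine Set.Finite.of_finite_image (f := AffineEquiv.linear)
      (finite_weylGroup.subset (Set.image_subset_iff.2 fun v hv => linear_mem_weylGroup hv.1)) ?_
    intro u hu v hv huv
    ext z
    have h1 := u.map_vadd x (z - x)
    have h2 := v.map_vadd x (z - x)
    rw [vadd_eq_add, sub_add_cancel] at h1 h2
    rw [h1, h2, huv, hu.2, hv.2]
  obtain ⟨v, hv, hmin⟩ := Set.exists_min_image S (fun v => P.RootForm (v a - a) (v a - a)) hS
    ⟨w, hw, h⟩
  have hva := (adheres_image (affineWeylGroup_le hv.1)).2 hx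
  rw [hv.2] at hva
  have hgen := generic_image (affineWeylGroup_le hv.1) (fundamentalAlcove_eq_cell b ha).2
  -- A hyperplane separating `a` from `v a` contains `y`, which adheres to both. Reflecting in it
  -- would give another element taking `x` to `y` and moving `a` less, against the choice of `v`.
  have hnosep : ∀ (α : ι) (k : ℤ), k < P.coroot' α a → k ≤ P.coroot' α (v a) := by
    intro α k hk
    by_contra! hc
    have hyk : P.coroot' α y = k := le_antisymm (hva.le hc.le) (hy α k hk.le)
    have h1 := hmin (affineReflection P α k * v) ⟨mul_mem (affineReflection_mem α k) hv.1, by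
      change affineReflection P α k (v x) = y
      rw [hv.2, affineReflection_eq_self hyk]⟩
    simp only [AffineEquiv.coe_mul, Function.comp_apply] at h1
    rw [rootForm_affineReflection_sub] at h1
    have h2 : 0 < P.RootForm (P.root α) (P.root α) :=
      P.rootForm_pos_of_ne_zero (by simp) (P.ne_zero α)
    have h3 : (P.coroot' α (v a) - k) * (P.coroot' α a - k) < 0 :=
      mul_neg_of_neg_of_pos (by linarith) (by linarith)
    have h4 := mul_neg_of_pos_of_neg h2 h3
    linarith
  have hmem : v a ∈ fundamentalAlcove b := by
    refine mem_fundamentalAlcove_of_generic b hgen fun α hα => ⟨?_, ?_⟩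
    · have := hnosep α 0 (by simpa using (ha α hα).1)
      simpa using this
    · have := hnosep (negIdx P α) (-1) (by
        rw [coroot'_negIdx]
        have := (ha α hα).2
        push_cast
        linarith)
      rw [coroot'_negIdx] at this
      push_cast at this
      linarith
  have := eq_one_of_apply_mem ha hv.1 hmem
  rw [← hv.2, this]
  rfl

end FundamentalDomain

/-! ### Types determine the faces of an alcove. -/

section Types

variable {ι V V' : Type*} [AddCommGroup V] [Module ℝ V] [AddCommGroup V'] [Module ℝ V']
  [Finite ι] {P : RootPairing ι ℝ V V'} [P.IsRootSystem] [P.IsCrystallographic] [P.IsReduced]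
  [P.IsIrreducible] {b : P.Base}

theorem adheres_fundamental {a x : V} (ha : a ∈ fundamentalAlcove b) (hx : Adheres P x a) {α : ι}
    (hα : b.IsPos α) : 0 ≤ P.coroot' α x ∧ P.coroot' α x ≤ 1 := by
  have h1 := hx α 0 (by simpa using (ha α hα).1.le)
  have h2 := hx.le (α := α) (k := 1) (by simpa using (ha α hα).2.le)
  simpa using And.intro h1 h2

/-- A face of the fundamental alcove is determined by the bounding hyperplanes that contain it. -/
theorem cell_eq_of_boundaryHyperplane {a x y : V} (ha : a ∈ fundamentalAlcove b)
    (hx : Adheres P x a) (hy : Adheres P y a)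
    (h : ∀ i, x ∈ boundaryHyperplane b i ↔ y ∈ boundaryHyperplane b i) : cell P x = cell P y := by
  have hx' := fun {α} => adheres_fundamental ha hx (α := α)
  have hy' := fun {α} => adheres_fundamental ha hy (α := α)
  have hsimple : ∀ i ∈ b.support, P.coroot' i x = 0 ↔ P.coroot' i y = 0 := by
    intro i hi
    have := h (some ⟨i, hi⟩)
    simpa [boundaryHyperplane, hyperplane] using this
  have hsum : ∀ n : ι → ℕ, ∑ j ∈ b.support, n j * P.coroot' j x = 0 ↔
      ∑ j ∈ b.support, n j * P.coroot' j y = 0 := by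
    intro n
    rw [Finset.sum_eq_zero_iff_of_nonneg, Finset.sum_eq_zero_iff_of_nonneg]
    · refine forall_congr' fun j => forall_congr' fun hj => ?_
      rw [mul_eq_zero, mul_eq_zero, hsimple j hj]
    · exact fun j hj => mul_nonneg (Nat.cast_nonneg _)
        (hy' (RootPairing.Base.isPos_of_mem_support hj)).1
    · exact fun j hj => mul_nonneg (Nat.cast_nonneg _)
        (hx' (RootPairing.Base.isPos_of_mem_support hj)).1
  have := nonempty_index P
  have hle : ∀ θ, IsHighestCoroot b θ → ∀ z, Adheres P z a → ∀ α,
      P.coroot' α z ≤ P.coroot' θ z := by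
    intro θ hθ z hz α
    obtain ⟨n, hn⟩ := exists_coroot'_sub_eq_sum b hθ α
    have := hn z
    have h0 : 0 ≤ ∑ j ∈ b.support, n j * P.coroot' j z :=
      Finset.sum_nonneg fun j hj => mul_nonneg (Nat.cast_nonneg _)
        (adheres_fundamental ha hz (RootPairing.Base.isPos_of_mem_support hj)).1
    linarith
  obtain ⟨θ, hθ⟩ := exists_isHighestCoroot b
  have hθpos : b.IsPos θ := by
    rw [← coroot'_pos_iff_isPos ha]
    obtain ⟨α, hα⟩ : ∃ α, b.IsPos α := by
      rcases isPos_or_isPos_negIdx b θ with h | h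
      exacts [⟨_, h⟩, ⟨_, h⟩]
    exact (ha α hα).1.trans_le (hle θ hθ a (fun _ _ h => h) α)
  have hnone : ∀ z, Adheres P z a → (z ∈ boundaryHyperplane b none ↔ P.coroot' θ z = 1) := by
    intro z hz
    constructor
    · rintro ⟨θ', hθ', hz'⟩
      have hz' : P.coroot' θ' z = ((1 : ℤ) : ℝ) := hz'
      push_cast at hz'
      exact le_antisymm (adheres_fundamental ha hz hθpos).2 (hz' ▸ hle θ hθ z hz θ')
    · intro hz'
      refine ⟨θ, hθ, ?_⟩
      change P.coroot' θ z = ((1 : ℤ) : ℝ)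
      rw [hz']
      norm_cast
  have htop : P.coroot' θ x = 1 ↔ P.coroot' θ y = 1 := by
    rw [← hnone x hx, ← hnone y hy, h]
  -- On the closed alcove a positive coroot is a sum of nonnegative simple terms, and it vanishes
  -- exactly when each term does. The value `1` is treated in the same way through the difference
  -- from the highest coroot.
  have hzero : ∀ α, b.IsPos α → (P.coroot' α x = 0 ↔ P.coroot' α y = 0) := by
    intro α hα
    obtain ⟨n, hn⟩ := exists_coroot'_eq_sum b hα
    rw [hn, hn, hsum]
  have hone : ∀ α, b.IsPos α → (P.coroot' α x = 1 ↔ P.coroot' α y = 1) := by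
    intro α hα
    obtain ⟨n, hn⟩ := exists_coroot'_sub_eq_sum b hθ α
    have key : ∀ z, Adheres P z a → (P.coroot' α z = 1 ↔
        P.coroot' θ z = 1 ∧ ∑ j ∈ b.support, n j * P.coroot' j z = 0) := by
      intro z hz
      rw [← hn z]
      have h1 := hle θ hθ z hz α
      have h2 := (adheres_fundamental ha hz hθpos).2
      constructor
      · intro h3
        constructor <;> linarith
      · rintro ⟨h3, h4⟩
        linarith
    rw [key x hx, key y hy, htop, hsum]
  apply cell_eq
  refine mem_cell_of_isPos b fun α hα k => ?_
  have h0 := hzero α hα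
  have h1 := hone α hα
  obtain ⟨hx0, hx1⟩ := hx' hα
  obtain ⟨hy0, hy1⟩ := hy' hα
  -- For `z` in `[0, 1]`, the position relative to all integers depends only on whether `z = 0` and
  -- whether `z = 1`.
  have key : ∀ z : ℝ, 0 ≤ z → z ≤ 1 → ((z < k ↔ 2 ≤ k ∨ (k = 1 ∧ z ≠ 1)) ∧
      (k < z ↔ k ≤ -1 ∨ (k = 0 ∧ z ≠ 0))) := by
    intro z hz0 hz1
    constructor
    · constructor
      · intro h
        have h2 : (0 : ℝ) < k := hz0.trans_lt h
        have h3 : 0 < k := by exact_mod_cast h2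
        rcases (show 2 ≤ k ∨ k = 1 by omega) with h4 | rfl
        · exact Or.inl h4
        · exact Or.inr ⟨rfl, fun h5 => by simp [h5] at h⟩
      · rintro (h | ⟨rfl, h⟩)
        · have : (2 : ℝ) ≤ k := by exact_mod_cast h
          linarith
        · simpa using lt_of_le_of_ne hz1 h
    · constructor
      · intro h
        have h2 : (k : ℝ) < 1 := h.trans_le hz1
        have h3 : k < 1 := by exact_mod_cast h2
        rcases (show k ≤ -1 ∨ k = 0 by omega) with h4 | rfl
        · exact Or.inl h4
        · exact Or.inr ⟨rfl, fun h5 => by simp [h5] at h⟩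
      · rintro (h | ⟨rfl, h⟩)
        · have : (k : ℝ) ≤ -1 := by exact_mod_cast h
          linarith
        · simpa using lt_of_le_of_ne hz0 h.symm
  rw [(key _ hx0 hx1).1, (key _ hx0 hx1).2, (key _ hy0 hy1).1, (key _ hy0 hy1).2, ne_eq, ne_eq,
    ne_eq, ne_eq, h0, h1]
  exact ⟨Iff.rfl, Iff.rfl⟩

theorem cell_subset_boundaryHyperplane {x : V} {i : Option b.support} :
    cell P x ⊆ boundaryHyperplane b i ↔ x ∈ boundaryHyperplane b i := by
  refine ⟨fun h => h (mem_cell_self x), fun h => ?_⟩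
  cases i with
  | some i => exact cell_subset_hyperplane.2 h
  | none =>
    obtain ⟨θ, hθ, h⟩ := h
    exact fun y hy => ⟨θ, hθ, cell_subset_hyperplane.2 h hy⟩

/-- The choices of face and group element in the definition of the type do not matter, because two
points of the closed fundamental alcove in one orbit coincide. -/
theorem mem_faceType_iff {a x : V} (ha : a ∈ fundamentalAlcove b) {g : V ≃ᵃ[ℝ] V}
    (hg : g ∈ affineWeylGroup P) (hx : Adheres P x a) {i : Option b.support} :
    i ∈ faceType b (g '' cell P x) ↔ x ∈ boundaryHyperplane b i := by
  constructor
  · rintro ⟨F', hF', ⟨w, hw, hwF⟩, hi⟩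
    obtain ⟨x', hx', hgx⟩ : g x ∈ w '' F' := hwF ▸ ⟨x, mem_cell_self x, rfl⟩
    rw [(fundamentalAlcove_eq_cell b ha).1] at hF'
    have hx'a : Adheres P x' a := mem_faceClosure_cell.1 (hF'.2 hx')
    have : x = x' := by
      refine eq_of_adheres ha hx hx'a (mul_mem (inv_mem hw) hg) ?_
      change w⁻¹ (g x) = x'
      rw [← hgx]
      exact w.symm_apply_apply x'
    rw [this]
    exact hi hx'
  · intro hi
    refine ⟨cell P x, ?_, ⟨g, hg, rfl⟩, cell_subset_boundaryHyperplane.2 hi⟩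
    rw [(fundamentalAlcove_eq_cell b ha).1]
    exact isFaceOf_cell.2 hx

theorem eq_of_faceType_eq {F F' : Set V} (hne : (fundamentalAlcove b).Nonempty) {g : V ≃ᵃ[ℝ] V}
    (hg : g ∈ affineWeylGroup P) (hF : IsFaceOf P F (g '' fundamentalAlcove b))
    (hF' : IsFaceOf P F' (g '' fundamentalAlcove b)) (h : faceType b F = faceType b F') :
    F = F' := by
  obtain ⟨a, ha⟩ := hne
  have hga := affineWeylGroup_le hg
  have key : ∀ F, IsFaceOf P F (g '' fundamentalAlcove b) →
      ∃ x, Adheres P x a ∧ F = g '' cell P x := by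
    intro F hF
    obtain ⟨x, rfl⟩ := isFace_iff.1 hF.1
    rw [(fundamentalAlcove_eq_cell b ha).1, image_cell hga, isFaceOf_cell] at hF
    have hx : g (g⁻¹ x) = x := g.apply_symm_apply x
    refine ⟨g⁻¹ x, ?_, ?_⟩
    · rwa [← adheres_image hga, hx]
    · rw [image_cell hga, hx]
  obtain ⟨x, hx, rfl⟩ := key F hF
  obtain ⟨y, hy, rfl⟩ := key F' hF'
  rw [cell_eq_of_boundaryHyperplane ha hx hy fun i => ?_]
  rw [← mem_faceType_iff ha hg hx, ← mem_faceType_iff ha hg hy, h]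

theorem faceType_image {F : Set V} {g : V ≃ᵃ[ℝ] V} (hg : g ∈ affineWeylGroup P) :
    faceType b (g '' F) = faceType b F := by
  have key : ∀ g ∈ affineWeylGroup P, ∀ F : Set V, faceType b F ⊆ faceType b (g '' F) := by
    rintro g hg F i ⟨F', h1, ⟨w, hw, rfl⟩, h3⟩
    exact ⟨F', h1, ⟨g * w, mul_mem hg hw, by rw [Set.image_image]; rfl⟩, h3⟩
  apply Set.Subset.antisymm _ (key g hg F)
  have := key g⁻¹ (inv_mem hg) (g '' F)
  rw [Set.image_image] at this
  simpa only [show ∀ x, (g⁻¹ : V ≃ᵃ[ℝ] V) (g x) = x from fun x => g.symm_apply_apply x,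
    Set.image_id'] using this

/-- Translations by weights shift the arrangement's hyperplanes to one another, hence normalise the
affine Weyl group, although they need not belong to it. -/
theorem translation_conj_mem {v : V} (hv : IsWeight P v) {g : V ≃ᵃ[ℝ] V}
    (hg : g ∈ affineWeylGroup P) : translation v * g * (translation v)⁻¹ ∈ affineWeylGroup P := by
  induction hg using Subgroup.closure_induction with
  | mem x hx =>
    obtain ⟨α, k, rfl⟩ := hx
    obtain ⟨m, hm⟩ := hv α
    have : translation v * affineReflection P α k * (translation v)⁻¹ =
        affineReflection P α (k + m) := by
      ext x
      change v + affineReflection P α k (-v + x) = _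
      rw [affineReflection_apply, affineReflection_apply, map_add, map_neg, hm]
      push_cast
      module
    rw [this]
    exact affineReflection_mem _ _
  | one => simp [one_mem]
  | mul x y _ _ hx hy =>
    have : translation v * (x * y) * (translation v)⁻¹ =
        (translation v * x * (translation v)⁻¹) * (translation v * y * (translation v)⁻¹) := by
      group
    rw [this]
    exact mul_mem hx hy
  | inv x _ hx =>
    have : translation v * x⁻¹ * (translation v)⁻¹ = (translation v * x * (translation v)⁻¹)⁻¹ := by
      group
    rw [this]
    exact inv_mem hx

theorem toAffineEquiv_mem {w : V ≃ₗ[ℝ] V} (hw : w ∈ weylGroup P) :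
    w.toAffineEquiv ∈ affineWeylGroup P := by
  induction hw using Subgroup.closure_induction with
  | mem x hx =>
    obtain ⟨α, rfl⟩ := hx
    have : (P.reflection α).toAffineEquiv = affineReflection P α 0 := by
      ext x
      simp [affineReflection]
    rw [this]
    exact affineReflection_mem _ _
  | one => exact one_mem (affineWeylGroup P)
  | mul x y _ _ hx hy => exact mul_mem hx hy
  | inv x _ hx => exact inv_mem hx

end Types

end Alcoves

namespace Alcoves

/-! ### Galleries indexed by natural numbers, and paths of alcoves. -/

section Paths

variable {ι V V' : Type*} [AddCommGroup V] [Module ℝ V] [AddCommGroup V'] [Module ℝ V']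
  [Finite ι] {P : RootPairing ι ℝ V V'} [P.IsRootSystem] [P.IsCrystallographic] [P.IsReduced]

namespace GallerySeq

variable {l : ℕ}

/-- The alcoves of a gallery, indexed by the natural numbers. -/
def alc (γ : GallerySeq V l) (i : ℕ) : Set V := γ.alcove ⟨min i l, by omega⟩

/-- The faces of a gallery, indexed by the natural numbers. -/
def fc (γ : GallerySeq V l) (i : ℕ) : Set V := γ.face ⟨min i (l + 1), by omega⟩

/-- The gallery data given by sequences of faces and alcoves. -/
def ofFun (F A : ℕ → Set V) : GallerySeq V l := ⟨fun j => F j, fun j => A j⟩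

theorem alcove_eq (γ : GallerySeq V l) (j : Fin (l + 1)) : γ.alcove j = γ.alc j := by
  rw [alc]
  congr 1
  ext
  simp
  omega

theorem face_eq (γ : GallerySeq V l) (j : Fin (l + 2)) : γ.face j = γ.fc j := by
  rw [fc]
  congr 1
  ext
  simp
  omega

theorem wall_eq (γ : GallerySeq V l) (j : Fin l) : γ.wall j = γ.fc (j + 1) := by
  rw [wall, face_eq]
  rfl

theorem ofFun_alc (F A : ℕ → Set V) {i : ℕ} (hi : i ≤ l) :
    (ofFun F A : GallerySeq V l).alc i = A i := by
  simp [alc, ofFun, hi]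

theorem ofFun_fc (F A : ℕ → Set V) {i : ℕ} (hi : i ≤ l + 1) :
    (ofFun F A : GallerySeq V l).fc i = F i := by
  simp [fc, ofFun, hi]

theorem eq_of_fc_alc {γ γ' : GallerySeq V l} (h1 : ∀ i ≤ l + 1, γ.fc i = γ'.fc i)
    (h2 : ∀ i ≤ l, γ.alc i = γ'.alc i) : γ = γ' := by
  ext1
  · funext j
    rw [face_eq, face_eq, h1 _ (by omega)]
  · funext j
    rw [alcove_eq, alcove_eq, h2 _ (by omega)]

/-- The conditions for a gallery, with indices in the natural numbers. -/
structure IsGal (b : P.Base) (γ : GallerySeq V l) (μ : V) : Prop where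
  isAlcove : ∀ i ≤ l, IsAlcove b (γ.alc i)
  codimOne : ∀ i < l, IsCodimOne P (γ.fc (i + 1))
  left : ∀ i < l, IsFaceOf P (γ.fc (i + 1)) (γ.alc i)
  right : ∀ i < l, IsFaceOf P (γ.fc (i + 1)) (γ.alc (i + 1))
  zero : γ.fc 0 = {0}
  zero_of : IsFaceOf P {0} (γ.alc 0)
  isWeight : IsWeight P μ
  last : γ.fc (l + 1) = {μ}
  last_of : IsFaceOf P {μ} (γ.alc l)

theorem IsGallery.isGal {b : P.Base} {γ : GallerySeq V l} (h : γ.IsGallery b) :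
    γ.IsGal b γ.weight := by
  obtain ⟨μ, hμ, hlast⟩ := h.face_last
  rw [weight_eq hlast]
  have h1 := h.face_zero
  have h2 := h.face_zero_of
  have h3 := h.face_last_of
  rw [h1, alcove_eq] at h2
  rw [hlast, alcove_eq] at h3
  rw [face_eq] at h1 hlast
  refine ⟨fun i hi => ?_, fun i hi => ?_, fun i hi => ?_, fun i hi => ?_, h1, h2, hμ, hlast, h3⟩
  · simpa only [alcove_eq] using h.isAlcove ⟨i, by omega⟩
  · simpa only [wall_eq] using h.codimOne ⟨i, hi⟩
  · have := h.wall_left ⟨i, hi⟩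
    rwa [wall_eq, alcove_eq] at this
  · have := h.wall_right ⟨i, hi⟩
    rwa [wall_eq, alcove_eq] at this

theorem IsGal.weight_eq {b : P.Base} {γ : GallerySeq V l} {μ : V} (h : γ.IsGal b μ) :
    γ.weight = μ := by
  apply GallerySeq.weight_eq
  rw [face_eq]
  exact h.last

theorem IsGal.isGallery {b : P.Base} {γ : GallerySeq V l} {μ : V} (h : γ.IsGal b μ) :
    γ.IsGallery b where
  isAlcove j := by
    rw [alcove_eq]
    exact h.isAlcove _ (by omega)
  codimOne j := by
    rw [wall_eq]
    exact h.codimOne _ j.2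
  wall_left j := by
    rw [wall_eq, alcove_eq]
    exact h.left _ j.2
  wall_right j := by
    rw [wall_eq, alcove_eq]
    exact h.right _ j.2
  face_zero := by
    rw [face_eq]
    exact h.zero
  face_zero_of := by
    have := h.zero
    rw [face_eq, alcove_eq, show ((0 : Fin (l + 2)) : ℕ) = 0 from rfl, h.zero]
    exact h.zero_of
  face_last := ⟨μ, h.isWeight, by
    rw [face_eq]
    exact h.last⟩
  face_last_of := by
    rw [face_eq, alcove_eq, Fin.val_last, Fin.val_last, h.last]
    exact h.last_of

end GallerySeq

open GallerySeq

/-- The alcoves `A` and `B` have a common face of codimension one. -/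
def Adjacent (b : P.Base) (A B : Set V) : Prop :=
  IsAlcove b A ∧ IsAlcove b B ∧ ∃ F, IsCodimOne P F ∧ IsFaceOf P F A ∧ IsFaceOf P F B

/-- There is a path of length `n` from the alcove `A` to the alcove `B`. -/
def Reach (b : P.Base) : ℕ → Set V → Set V → Prop
  | 0, A, B => A = B
  | n + 1, A, B => ∃ C, Reach b n A C ∧ Adjacent b C B

variable {b : P.Base}

theorem Reach.trans {m n : ℕ} {A B C : Set V} (h : Reach b m A B) (h' : Reach b n B C) :
    Reach b (m + n) A C := by
  induction n generalizing C with
  | zero =>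
    have h' : B = C := h'
    rwa [← h']
  | succ n ih =>
    obtain ⟨D, hD, hDC⟩ := h'
    exact ⟨D, ih hD, hDC⟩

theorem Reach.image {g : V ≃ᵃ[ℝ] V} (hg : g ∈ arrangementGroup P) {n : ℕ} {A B : Set V}
    (h : Reach b n A B) : Reach b n (g '' A) (g '' B) := by
  induction n generalizing B with
  | zero =>
    have h : A = B := h
    rw [h]
    rfl
  | succ n ih =>
    obtain ⟨D, hD, h1, h2, F, h3, h4, h5⟩ := h
    exact ⟨g '' D, ih hD, isAlcove_image hg h1, isAlcove_image hg h2, g '' F,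
      isCodimOne_image hg h3, isFaceOf_image hg h1 h4, isFaceOf_image hg h2 h5⟩

theorem Reach.exists_fun {n : ℕ} {A B : Set V} (h : Reach b n A B) (hA : IsAlcove b A) :
    ∃ F C : ℕ → Set V, C 0 = A ∧ C n = B ∧ (∀ i ≤ n, IsAlcove b (C i)) ∧ ∀ i < n,
      IsCodimOne P (F i) ∧ IsFaceOf P (F i) (C i) ∧ IsFaceOf P (F i) (C (i + 1)) := by
  induction n generalizing B with
  | zero => exact ⟨fun _ => ∅, fun _ => A, rfl, h, fun _ _ => hA, fun i hi => by omega⟩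
  | succ n ih =>
    obtain ⟨D, hD, h1, h2, F', h3, h4, h5⟩ := h
    obtain ⟨F, C, hC0, hCn, hC, hFC⟩ := ih hD
    refine ⟨fun i => if i < n then F i else F', fun i => if i ≤ n then C i else B, by simp [hC0],
      by simp, fun i hi => ?_, fun i hi => ?_⟩
    · by_cases h : i ≤ n
      · simpa [h] using hC i h
      · simpa [h] using h2
    · rcases Nat.lt_succ_iff_lt_or_eq.1 hi with h | rfl
      · simpa [h, h.le, Nat.succ_le_iff.2 h] using hFC i h
      · subst hCn
        simpa using ⟨h3, h4, h5⟩

theorem Reach.exists_gallery {n : ℕ} {A B : Set V} (h : Reach b n A B) (hA : IsAlcove b A)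
    (h0 : IsFaceOf P {0} A) {μ : V} (hμ : IsWeight P μ) (hμB : IsFaceOf P {μ} B) :
    ∃ γ : GallerySeq V n, γ.IsGallery b ∧ γ.alcove 0 = A ∧ γ.weight = μ := by
  obtain ⟨F, C, hC0, hCn, hC, hFC⟩ := h.exists_fun hA
  let γ : GallerySeq V n := ofFun (fun i => if i = 0 then {0} else if i = n + 1 then {μ} else
    F (i - 1)) C
  have halc : ∀ i ≤ n, γ.alc i = C i := fun i hi => ofFun_alc _ _ hi
  have hfc : ∀ i < n, γ.fc (i + 1) = F i := fun i hi => by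
    rw [ofFun_fc _ _ (by omega)]
    simp [hi.ne]
  have hγ : γ.IsGal b μ := by
    refine ⟨fun i hi => ?_, fun i hi => ?_, fun i hi => ?_, fun i hi => ?_, ?_, ?_, hμ, ?_, ?_⟩
    · rw [halc i hi]
      exact hC i hi
    · rw [hfc i hi]
      exact (hFC i hi).1
    · rw [hfc i hi, halc i hi.le]
      exact (hFC i hi).2.1
    · rw [hfc i hi, halc (i + 1) hi]
      exact (hFC i hi).2.2
    · rw [ofFun_fc _ _ (by omega)]
      simp
    · rwa [halc 0 (by omega), hC0]
    · rw [ofFun_fc _ _ le_rfl]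
      simp
    · rwa [halc n le_rfl, hCn]
  refine ⟨γ, hγ.isGallery, ?_, hγ.weight_eq⟩
  rw [alcove_eq, ← hC0]
  exact halc 0 (by omega)

variable {l : ℕ} {γ : GallerySeq V l} {μ : V}

theorem GallerySeq.IsGal.reach (h : γ.IsGal b μ) {i j : ℕ} (hij : i ≤ j) (hj : j ≤ l) :
    Reach b (j - i) (γ.alc i) (γ.alc j) := by
  induction j, hij using Nat.le_induction with
  | base =>
    rw [Nat.sub_self]
    rfl
  | succ j hij ih =>
    rw [Nat.succ_sub hij]
    exact ⟨γ.alc j, ih (by omega), h.isAlcove j (by omega), h.isAlcove _ hj, _,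
      h.codimOne j hj, h.left j hj, h.right j hj⟩

/-- `A` lies in the open half-space `(x, α^∨) < k`. -/
def Below (P : RootPairing ι ℝ V V') (A : Set V) (α : ι) (k : ℤ) : Prop :=
  ∀ x ∈ A, P.coroot' α x < k

theorem below_cell {a : V} {α : ι} {k : ℤ} : Below P (cell P a) α k ↔ P.coroot' α a < k :=
  ⟨fun h => h a (mem_cell_self a), fun h _ hx => (hx α k).1.2 h⟩

theorem below_iff_of_not_subset {F A B : Set V} (hA : IsAlcove b A) (hB : IsAlcove b B)
    (hFA : IsFaceOf P F A) (hFB : IsFaceOf P F B) {α : ι} {k : ℤ} (h : ¬ F ⊆ hyperplane P α k) :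
    Below P A α k ↔ Below P B α k := by
  obtain ⟨x, rfl⟩ := isFace_iff.1 hFA.1
  obtain ⟨a, ha, rfl⟩ := (isAlcove_iff b).1 hA
  obtain ⟨c, hc, rfl⟩ := (isAlcove_iff b).1 hB
  rw [isFaceOf_cell] at hFA hFB
  rw [cell_subset_hyperplane] at h
  rw [below_cell, below_cell, hFA.lt_iff h, hFB.lt_iff h]

theorem below_image_iff {A : Set V} (hA : IsAlcove b A) (α : ι) (k : ℤ) :
    Below P (affineReflection P α k '' A) α k ↔ ¬ Below P A α k := by
  obtain ⟨a, ha, rfl⟩ := (isAlcove_iff b).1 hA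
  rw [image_cell (affineWeylGroup_le (affineReflection_mem α k)), below_cell, below_cell,
    coroot'_affineReflection_self, not_lt]
  constructor
  · intro h
    linarith
  · intro h
    have := lt_of_le_of_ne h (ha α k).symm
    linarith

end Paths

/-! ### Shortest galleries and the hyperplanes they cross. -/

section Reduced

open GallerySeq

variable {ι V V' : Type*} [AddCommGroup V] [Module ℝ V] [AddCommGroup V'] [Module ℝ V']
  [Finite ι] {P : RootPairing ι ℝ V V'} [P.IsRootSystem] [P.IsCrystallographic] [P.IsReduced]
  {b : P.Base} {l : ℕ} {γ : GallerySeq V l} {μ : V}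

/-- `l` is minimal among the lengths of galleries of the same weight that start at the fundamental
alcove. -/
structure IsShortest (b : P.Base) (γ : GallerySeq V l) (μ : V) : Prop extends γ.IsGal b μ where
  start : γ.alc 0 = fundamentalAlcove b
  minimal : ∀ n B, Reach b n (γ.alc 0) B → IsFaceOf P {μ} B → l ≤ n

theorem GallerySeq.IsReduced.isShortest (h : γ.IsReduced b) : IsShortest b γ γ.weight := by
  have h1 := h.1.isGal
  have h2 : γ.alc 0 = fundamentalAlcove b := by
    rw [← h.2.1, alcove_eq]
    rfl
  refine ⟨h1, h2, fun n B hB hμ => ?_⟩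
  obtain ⟨γ', h3, h4, h5⟩ := hB.exists_gallery (h1.isAlcove 0 (by omega)) h1.zero_of h1.isWeight hμ
  exact h.2.2 n γ' h3 (h4.trans h2) h5

namespace IsShortest

variable (h : IsShortest b γ μ)
include h

theorem alc_ne {i : ℕ} (hi : i < l) : γ.alc (i + 1) ≠ γ.alc i := by
  intro he
  have h1 := h.reach (i := 0) (j := i) (by omega) (by omega)
  have h2 := h.reach (i := i + 1) (j := l) (by omega) le_rfl
  rw [he] at h2
  have := h.minimal _ _ (h1.trans h2) h.last_of
  omega

theorem alc_succ {i : ℕ} (hi : i < l) :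
    γ.alc (i + 1) = faceReflection P (γ.fc (i + 1)) '' γ.alc i :=
  (eq_or_eq_faceReflection_image (h.codimOne i hi) (h.isAlcove i hi.le) (h.isAlcove _ hi)
    (h.left i hi) (h.right i hi)).resolve_left (h.alc_ne hi)

theorem alc_succ' {i : ℕ} (hi : i < l) {α : ι} {k : ℤ} (hw : γ.fc (i + 1) ⊆ hyperplane P α k) :
    γ.alc (i + 1) = affineReflection P α k '' γ.alc i := by
  rw [h.alc_succ hi, ((h.codimOne i hi).onlyHyperplane hw).faceReflection_eq]

theorem alc_eq' {i : ℕ} (hi : i < l) {α : ι} {k : ℤ} (hw : γ.fc (i + 1) ⊆ hyperplane P α k) :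
    affineReflection P α k '' γ.alc (i + 1) = γ.alc i := by
  rw [h.alc_succ' hi hw, affineReflection_image_image]

/-- A shortest gallery crosses each hyperplane at most once. -/
theorem not_subset_of_lt {i j : ℕ} (hij : i < j) (hj : j < l) {α : ι} {k : ℤ}
    (hi' : γ.fc (i + 1) ⊆ hyperplane P α k) (hj' : γ.fc (j + 1) ⊆ hyperplane P α k) : False := by
  have h1 := h.reach (i := 0) (j := i) (by omega) (by omega)
  -- Reflecting the piece between the two crossings joins it to both remaining pieces and saves two
  -- steps.
  have h2 := (h.reach (i := i + 1) (j := j) (by omega) (by omega)).image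
    (affineWeylGroup_le (affineReflection_mem α k))
  have h3 := h.reach (i := j + 1) (j := l) (by omega) le_rfl
  rw [h.alc_eq' (hij.trans hj) hi', ← h.alc_succ' hj hj'] at h2
  have := h.minimal _ _ ((h1.trans h2).trans h3) h.last_of
  omega

theorem eq_of_subset {i j : ℕ} (hi : i < l) (hj : j < l) {α : ι} {k : ℤ}
    (hi' : γ.fc (i + 1) ⊆ hyperplane P α k) (hj' : γ.fc (j + 1) ⊆ hyperplane P α k) : i = j := by
  rcases lt_trichotomy i j with hij | hij | hij
  · exact (h.not_subset_of_lt hij hj hi' hj').elim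
  · exact hij
  · exact (h.not_subset_of_lt hij hi hj' hi').elim

/-- A shortest gallery crosses no hyperplane through its end. -/
theorem coroot'_ne {i : ℕ} (hi : i < l) {α : ι} {k : ℤ} (hw : γ.fc (i + 1) ⊆ hyperplane P α k) :
    P.coroot' α μ ≠ k := by
  intro hμ
  have hr := affineWeylGroup_le (affineReflection_mem (P := P) α k)
  have h1 := h.reach (i := 0) (j := i) (by omega) (by omega)
  -- Reflecting everything after the crossing keeps the end `μ` and saves one step.
  have h2 := (h.reach (i := i + 1) (j := l) (by omega) le_rfl).image hr
  rw [h.alc_eq' hi hw] at h2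
  have h3 := isFaceOf_image hr (h.isAlcove l le_rfl) h.last_of
  rw [Set.image_singleton, affineReflection_eq_self hμ] at h3
  have := h.minimal _ _ (h1.trans h2) h3
  omega

theorem below_iff_of_forall {i j : ℕ} (hij : i ≤ j) (hj : j ≤ l) {α : ι} {k : ℤ}
    (hn : ∀ n, i ≤ n → n < j → ¬ γ.fc (n + 1) ⊆ hyperplane P α k) :
    Below P (γ.alc i) α k ↔ Below P (γ.alc j) α k := by
  induction j, hij using Nat.le_induction with
  | base => rfl
  | succ j hij ih =>
    rw [ih (by omega) fun n h1 h2 => hn n h1 (by omega)]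
    exact below_iff_of_not_subset (h.isAlcove j (by omega)) (h.isAlcove _ hj) (h.left j hj)
      (h.right j hj) (hn j hij (by omega))

theorem below_before {i j : ℕ} (hij : i ≤ j) (hj : j < l) {α : ι} {k : ℤ}
    (hw : γ.fc (j + 1) ⊆ hyperplane P α k) :
    Below P (γ.alc i) α k ↔ Below P (γ.alc 0) α k := by
  refine (h.below_iff_of_forall (by omega) (by omega) fun n h1 h2 hn => ?_).symm
  have := h.eq_of_subset (by omega) hj hn hw
  omega

theorem below_after {i j : ℕ} (hij : j < i) (hi : i ≤ l) {α : ι} {k : ℤ}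
    (hw : γ.fc (j + 1) ⊆ hyperplane P α k) :
    Below P (γ.alc i) α k ↔ ¬ Below P (γ.alc 0) α k := by
  have hj : j < l := by omega
  rw [← h.below_before le_rfl hj hw, ← below_image_iff (h.isAlcove j hj.le), ← h.alc_succ' hj hw]
  refine (h.below_iff_of_forall (by omega) (by omega) fun n h1 h2 hn => ?_).symm
  have := h.eq_of_subset (by omega) hj hn hw
  omega

theorem nonempty : (fundamentalAlcove b).Nonempty := by
  rw [← h.start]
  exact (h.isAlcove 0 (by omega)).1

theorem below_start_iff {α : ι} (hα : b.IsPos α) (k : ℤ) : Below P (γ.alc 0) α k ↔ 1 ≤ k := by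
  obtain ⟨a, ha⟩ := h.nonempty
  rw [h.start, (fundamentalAlcove_eq_cell b ha).1, below_cell]
  obtain ⟨h1, h2⟩ := ha α hα
  constructor
  · intro h3
    have h4 : (0 : ℝ) < k := h1.trans h3
    have : 0 < k := by exact_mod_cast h4
    omega
  · intro h3
    have : (1 : ℝ) ≤ k := by exact_mod_cast h3
    linarith

theorem below_end_iff {α : ι} {k : ℤ} (hk : P.coroot' α μ ≠ k) :
    Below P (γ.alc l) α k ↔ P.coroot' α μ < k := by
  obtain ⟨a, ha, hal⟩ := (isAlcove_iff b).1 (h.isAlcove l le_rfl)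
  have h1 := h.last_of
  rw [hal] at h1
  rw [hal, below_cell]
  exact Adheres.lt_iff (mem_faceClosure_cell.1 (h1.2 rfl)) hk

/-- A crossed hyperplane is crossed once and avoids the end, so it has the first alcove and `μ` on
opposite sides. -/
theorem wall_range {i : ℕ} (hi : i < l) {α : ι} (hα : b.IsPos α) {k : ℤ}
    (hw : γ.fc (i + 1) ⊆ hyperplane P α k) (hμ : P.coroot' α μ < 0) :
    P.coroot' α μ < k ∧ k ≤ 0 := by
  have h1 := h.coroot'_ne hi hw
  have h2 := h.below_after hi le_rfl hw
  rw [h.below_end_iff h1, h.below_start_iff hα, not_le] at h2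
  by_cases hk : k < 1
  · exact ⟨h2.2 hk, by omega⟩
  · exfalso
    apply hk
    apply h2.1
    have : (1 : ℝ) ≤ k := by exact_mod_cast (not_lt.1 hk)
    linarith

end IsShortest

end Reduced

end Alcoves

namespace Alcoves

/-! ### Chains along lists of positions. -/

section Lists

variable {G : Type*} {m : ℕ}

theorem scanl_eq_cons {β : Type*} (f : G → β → G) (x : G) (L : List β) :
    ∃ M, L.scanl f x = x :: M := by
  cases L with
  | nil => exact ⟨[], rfl⟩
  | cons a L => exact ⟨_, List.scanl_cons⟩

/-- Let `w` be a sequence that changes only at the positions listed in `L`, where it changes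
by `f`. The list of partial results of `f` along `L` is a chain if and only if all changes of `w`
satisfy the relation. -/
theorem isChain_scanl_iff {R : G → G → Prop} {f : G → Fin m → G} {w : ℕ → G} {L : List (Fin m)}
    (hL : L.Pairwise (· < ·)) {n : ℕ} (hn : ∀ j ∈ L, n ≤ (j : ℕ))
    (h1 : ∀ j : Fin m, n ≤ (j : ℕ) → j ∉ L → w (j + 1) = w j)
    (h2 : ∀ j ∈ L, w (j + 1) = f (w j) j) :
    (L.scanl f (w n)).IsChain R ↔ ∀ j ∈ L, R (w j) (w (j + 1)) := by
  induction L generalizing n with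
  | nil => simp
  | cons a L ih =>
    rw [List.pairwise_cons] at hL
    have hconst : ∀ i, n ≤ i → i ≤ (a : ℕ) → w i = w n := by
      intro i hi hia
      induction i, hi using Nat.le_induction with
      | base => rfl
      | succ i hi ih =>
        rw [← ih (by omega), ← h1 ⟨i, by omega⟩ hi]
        intro hmem
        rcases List.mem_cons.1 hmem with h | h
        · rw [← h] at hia
          simp at hia
        · have : (a : ℕ) < i := hL.1 _ h
          omega
    have hwa : w a = w n := hconst a (hn a (by simp)) le_rfl
    have ih' := ih hL.2 (n := a + 1) (fun j hj => hL.1 j hj)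
      (fun j hj hjL => h1 j ((hn a (by simp)).trans (by omega)) (by
        rw [List.mem_cons, not_or]
        refine ⟨?_, hjL⟩
        rintro rfl
        omega)) (fun j hj => h2 j (List.mem_cons_of_mem _ hj))
    have ha := h2 a (by simp)
    rw [List.scanl_cons, ← hwa, ← ha]
    obtain ⟨M, hM⟩ := scanl_eq_cons f (w (a + 1)) L
    rw [hM] at ih' ⊢
    rw [List.isChain_cons_cons, ih', List.forall_mem_cons]

end Lists

variable {ι V V' : Type*} [AddCommGroup V] [Module ℝ V] [AddCommGroup V'] [Module ℝ V']
  [Finite ι] {P : RootPairing ι ℝ V V'} [P.IsRootSystem] [P.IsCrystallographic] [P.IsReduced]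
  {b : P.Base} {l : ℕ} {γ : GallerySeq V l} {μ : V}

/-! ### The first `N` steps of a special shortest gallery. -/

section Special

open GallerySeq

theorem IsAlcove.isFace {A : Set V} (hA : IsAlcove b A) : IsFace P A := by
  obtain ⟨a, -, rfl⟩ := (isAlcove_iff b).1 hA
  exact isFace_cell a

theorem zero_mem_faceClosure_image {F : Set V} (hF : IsFace P F) {g : V ≃ᵃ[ℝ] V}
    (hg : g ∈ arrangementGroup P) (h0 : g 0 = 0) (h : 0 ∈ faceClosure P F) :
    0 ∈ faceClosure P (g '' F) := by
  obtain ⟨x, rfl⟩ := isFace_iff.1 hF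
  rw [mem_faceClosure_cell] at h
  rw [image_cell hg, mem_faceClosure_cell]
  nth_rw 1 [← h0]
  exact (adheres_image hg).2 h

theorem isFaceOf_zero {A : Set V} (hA : IsAlcove b A) (h : 0 ∈ faceClosure P A) :
    IsFaceOf P {0} A := by
  obtain ⟨a, -, rfl⟩ := (isAlcove_iff b).1 hA
  rw [singleton_zero_eq_cell (P := P), isFaceOf_cell]
  exact mem_faceClosure_cell.1 h

theorem eq_zero_of_zero_mem_faceClosure {F : Set V} (hF : IsFace P F)
    (h : 0 ∈ faceClosure P F) {α : ι} {k : ℤ} (hα : F ⊆ hyperplane P α k) : k = 0 := by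
  obtain ⟨x, rfl⟩ := isFace_iff.1 hF
  rw [mem_faceClosure_cell] at h
  rw [cell_subset_hyperplane] at hα
  have h1 := h α k hα.ge
  have h2 := h.le hα.le
  rw [map_zero] at h1 h2
  exact_mod_cast le_antisymm h1 h2

theorem faceReflection_mul_self {F : Set V} (hF : IsCodimOne P F) :
    faceReflection P F * faceReflection P F = 1 := by
  obtain ⟨H, ⟨α, k, rfl⟩, h⟩ := hF.exists
  rw [(hF.onlyHyperplane h).faceReflection_eq, affineReflection_mul_self]

/-- The first part of a special gallery, in terms of natural numbers. -/
structure IsNearZero (b : P.Base) (γ : GallerySeq V l) : Prop where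
  le : numPos b ≤ l
  alc : ∀ i ≤ numPos b, 0 ∈ faceClosure P (γ.alc i)
  wall : ∀ i < numPos b, 0 ∈ faceClosure P (γ.fc (i + 1))

theorem isSpecial_iff : γ.IsSpecial b ↔ γ.IsGallery b ∧ IsNearZero b γ := by
  constructor
  · rintro ⟨h1, h2, h3, h4⟩
    refine ⟨h1, h2, fun i hi => ?_, fun i hi => ?_⟩
    · have := h3 ⟨i, by omega⟩ hi
      rwa [alcove_eq] at this
    · have := h4 ⟨i, by omega⟩ hi
      rwa [wall_eq] at this
  · rintro ⟨h1, h2, h3, h4⟩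
    refine ⟨h1, h2, fun i hi => ?_, fun i hi => ?_⟩
    · rw [alcove_eq]
      exact h3 i hi
    · rw [wall_eq]
      exact h4 i hi

/-- The hyperplanes containing the walls of a gallery. -/
structure IsLabelling (b : P.Base) (γ : GallerySeq V l) (α : ℕ → ι) (k : ℕ → ℤ) : Prop where
  isPos : ∀ i < l, b.IsPos (α i)
  only : ∀ i < l, OnlyHyperplane P (γ.fc (i + 1)) (α i) (k i)

theorem GallerySeq.IsGal.exists_isLabelling [Nonempty ι] (h : γ.IsGal b μ) :
    ∃ α k, IsLabelling b γ α k := by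
  have : ∀ i, ∃ (α : ι) (k : ℤ), i < l → b.IsPos α ∧ OnlyHyperplane P (γ.fc (i + 1)) α k := by
    intro i
    by_cases hi : i < l
    · obtain ⟨α, k, h1⟩ := (h.codimOne i hi).exists_isPos b
      exact ⟨α, k, fun _ => h1⟩
    · exact ⟨Classical.arbitrary ι, 0, fun h => absurd h hi⟩
  choose α k h1 using this
  exact ⟨α, k, fun i hi => (h1 i hi).1, fun i hi => (h1 i hi).2⟩

section Labelled

variable {α : ℕ → ι} {k : ℕ → ℤ} (h : IsShortest b γ μ) (h0 : IsNearZero b γ)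
  (hα : IsLabelling b γ α k)
include h h0 hα

theorem label_eq_zero {i : ℕ} (hi : i < numPos b) : k i = 0 :=
  have hl := h0.le
  eq_zero_of_zero_mem_faceClosure (h.left i (by omega)).1 (h0.wall i hi) (hα.only i (by omega)).1

theorem subset_hyperplane_zero {i : ℕ} (hi : i < numPos b) :
    γ.fc (i + 1) ⊆ hyperplane P (α i) 0 := by
  have hl := h0.le
  rw [← label_eq_zero h h0 hα hi]
  exact (hα.only i (by omega)).1

theorem injOn_label : Set.InjOn α (Set.Iio (numPos b)) := by
  intro i hi j hj hij
  have hl := h0.le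
  rw [Set.mem_Iio] at hi hj
  have h1 := subset_hyperplane_zero h h0 hα hi
  rw [hij] at h1
  exact h.eq_of_subset (by omega) (by omega) h1 (subset_hyperplane_zero h h0 hα hj)

/-- The first `N` labels are positive roots, distinct because no hyperplane is crossed twice, and
there are only `N` positive roots. -/
theorem image_label : α '' Set.Iio (numPos b) = {β | b.IsPos β} := by
  have hl := h0.le
  refine Set.eq_of_subset_of_ncard_le ?_ ?_ (Set.toFinite _)
  · rintro - ⟨i, hi, rfl⟩
    rw [Set.mem_Iio] at hi
    exact hα.isPos i (by omega)
  · rw [(injOn_label h h0 hα).ncard_image]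
    rw [← Nat.card_coe_set_eq, Set.ncard_eq_toFinset_card', Set.toFinset_Iio, Nat.card_Iio]
    exact le_rfl

theorem ne_zero_of_subset {i : ℕ} (hN : numPos b ≤ i) (hi : i < l) {β : ι} {n : ℤ}
    (hβ : b.IsPos β) (hw : γ.fc (i + 1) ⊆ hyperplane P β n) : n ≠ 0 := by
  rintro rfl
  have hmem : β ∈ α '' Set.Iio (numPos b) := by
    rw [image_label h h0 hα]
    exact hβ
  obtain ⟨j, hj, rfl⟩ := hmem
  rw [Set.mem_Iio] at hj
  have := h.eq_of_subset (by omega) hi (subset_hyperplane_zero h h0 hα hj) hw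
  omega

/-- The elements of the Weyl group that map the fundamental alcove to the first alcoves of a
special gallery. -/
theorem exists_isReflectionOrder [P.IsIrreducible] : ∃ x, IsReflectionOrder b (numPos b) α x := by
  have hl := h0.le
  let x : ℕ → V ≃ₗ[ℝ] V := fun i => Nat.rec 1 (fun i y => P.reflection (α i) * y) i
  have hsucc : ∀ i, x (i + 1) = P.reflection (α i) * x i := fun _ => rfl
  have hx : ∀ i, x i ∈ weylGroup P := by
    intro i
    induction i with
    | zero => exact one_mem _
    | succ i ih =>
      rw [hsucc]
      exact mul_mem (reflection_mem P _) ih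
  have halc : ∀ i ≤ numPos b, γ.alc i = x i '' fundamentalAlcove b := by
    intro i hi
    induction i with
    | zero =>
      rw [h.start]
      exact (Set.image_id _).symm
    | succ i ih =>
      rw [h.alc_succ' (by omega) (subset_hyperplane_zero h h0 hα (by omega)), ih (by omega),
        hsucc, Set.image_image]
      refine Set.image_congr fun y _ => ?_
      rw [affineReflection_apply, LinearEquiv.mul_apply, RootPairing.reflection_apply,
        Int.cast_zero, sub_zero]
  obtain ⟨a, ha⟩ := h.nonempty
  refine ⟨x, fun i _ => hx i, fun i _ => hsucc i, fun i hi => hα.isPos i (by omega),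
    fun i hi => ?_, injOn_label h h0 hα, fun β hβ => ?_⟩
  · ext β
    by_cases hβ : b.IsPos β
    swap
    · refine iff_of_false (fun h' => hβ h'.1) ?_
      rintro ⟨j, hj, rfl⟩
      rw [Set.mem_Iio] at hj
      exact hβ (hα.isPos j (by omega))
    -- The inversions of `x_i⁻¹` are the positive roots whose hyperplanes through the origin have
    -- been crossed before the alcove `x_i(A_∘)`, that is, the first `i` labels.
    have h1 : β ∈ inversions b (x i)⁻¹ ↔ Below P (γ.alc i) β 0 := by
      have h2 := coroot'_apply_pos_iff ha (hx i) β
      obtain ⟨h3, h4⟩ := fundamentalAlcove_eq_cell b ha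
      have hg := affineWeylGroup_le (toAffineEquiv_mem (hx i))
      have h5 : γ.alc i = cell P (x i a) := by
        rw [halc i hi, h3]
        exact image_cell hg a
      have h6 : P.coroot' β (x i a) ≠ (0 : ℤ) := generic_image hg h4 β 0
      rw [h5, below_cell]
      rw [Int.cast_zero] at h6 ⊢
      rw [inversions, Set.mem_ofPred_eq, rootPerm_inv (hx i), ← h2, not_lt]
      exact ⟨fun h' => lt_of_le_of_ne h'.2 h6, fun h' => ⟨hβ, h'.le⟩⟩
    have hmem : β ∈ α '' Set.Iio (numPos b) := by
      rw [image_label h h0 hα]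
      exact hβ
    obtain ⟨j, hj, rfl⟩ := hmem
    rw [Set.mem_Iio] at hj
    have hw := subset_hyperplane_zero h h0 hα hj
    rw [h1]
    rcases lt_or_ge j i with hij | hij
    · rw [h.below_after hij (by omega) hw, h.below_start_iff hβ]
      exact iff_of_true (by omega) ⟨j, hij, rfl⟩
    · rw [h.below_before hij (by omega) hw, h.below_start_iff hβ]
      refine iff_of_false (by omega) ?_
      rintro ⟨n, hn, hnj⟩
      rw [Set.mem_Iio] at hn
      have := injOn_label h h0 hα (Set.mem_Iio.2 (by omega)) (Set.mem_Iio.2 hj) hnj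
      omega
  · rw [image_label h h0 hα]
    exact hβ

end Labelled

/-- A shortest gallery to an antidominant weight ends at the translate of the fundamental
alcove. -/
theorem IsShortest.image_alc_last (h : IsShortest b γ μ) (hμ : ∀ α, b.IsPos α → P.coroot' α μ < 0) :
    (fun x => x - μ) '' γ.alc l = fundamentalAlcove b := by
  obtain ⟨c, hc, hcl⟩ := (isAlcove_iff b).1 (h.isAlcove l le_rfl)
  have had := h.last_of
  rw [hcl] at had
  have had : Adheres P μ c := mem_faceClosure_cell.1 (had.2 rfl)
  have hw : IsWeight P (-μ) := by
    intro α
    obtain ⟨n, hn⟩ := h.isWeight α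
    exact ⟨-n, by rw [map_neg, hn]; simp⟩
  have ht := translation_mem hw
  have himg : (fun x => x - μ) '' γ.alc l = cell P (c - μ) := by
    have := image_cell ht c
    rw [AffineEquiv.constVAdd_apply, vadd_eq_add, neg_add_eq_sub] at this
    rw [← this, hcl]
    refine Set.image_congr fun y _ => ?_
    rw [AffineEquiv.constVAdd_apply, vadd_eq_add, neg_add_eq_sub]
  have hgen : Generic P (c - μ) := by
    have := generic_image ht hc
    rwa [AffineEquiv.constVAdd_apply, vadd_eq_add, neg_add_eq_sub] at this
  rw [himg, (fundamentalAlcove_eq_cell b (mem_fundamentalAlcove_of_generic b hgen fun α hα => ?_)).1]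
  obtain ⟨n, hn⟩ := h.isWeight α
  have hneg := hμ α hα
  rw [map_sub]
  constructor
  -- No hyperplane through `μ` is crossed, so the last alcove lies on the same side of it as the
  -- first, which is the upper side since `n < 0`.
  · have h1 := h.below_iff_of_forall (i := 0) (j := l) (by omega) le_rfl (α := α) (k := n)
      fun i _ hi hw => h.coroot'_ne hi hw hn
    rw [h.below_start_iff hα, hcl, below_cell] at h1
    by_contra h2
    have h3 := h1.2 (by linarith)
    rw [hn] at hneg
    have : n < 0 := by exact_mod_cast hneg
    omega
  · by_contra h1
    have h2 := had α (n + 1) (by push_cast; linarith)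
    push_cast at h2
    linarith

end Special

end Alcoves

namespace Alcoves

open GallerySeq

variable {ι V V' : Type*} [AddCommGroup V] [Module ℝ V] [AddCommGroup V'] [Module ℝ V']
  [Finite ι] {P : RootPairing ι ℝ V V'} [P.IsRootSystem] [P.IsCrystallographic] [P.IsReduced]
  {b : P.Base} {l : ℕ} {γ : GallerySeq V l} {μ : V}

/-! ### Folding a gallery at a set of positions. -/

section Fold

open Classical in
variable (P) in
/-- The product of the affine reflections in the walls of `γ` with positions in `J` that are less
than a given position. -/
def foldMap (γ : GallerySeq V l) (J : Set ℕ) : ℕ → V ≃ᵃ[ℝ] V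
  | 0 => 1
  | i + 1 => if i ∈ J then foldMap γ J i * faceReflection P (γ.fc (i + 1)) else foldMap γ J i

variable (P) in
/-- The gallery obtained from `γ` by folding at the positions in `J`. -/
def fold (γ : GallerySeq V l) (J : Set ℕ) : GallerySeq V l :=
  -- Position `i` of `J` refers to the wall with index `i + 1`, which its own fold does not move;
  -- hence the shift. Truncated subtraction leaves the initial face fixed.
  ofFun (fun i => foldMap P γ J (i - 1) '' γ.fc i) fun i => foldMap P γ J i '' γ.alc i

variable {J : Set ℕ}

theorem foldMap_succ_of_mem {i : ℕ} (hi : i ∈ J) :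
    foldMap P γ J (i + 1) = foldMap P γ J i * faceReflection P (γ.fc (i + 1)) := if_pos hi

theorem foldMap_succ_of_notMem {i : ℕ} (hi : i ∉ J) :
    foldMap P γ J (i + 1) = foldMap P γ J i := if_neg hi

theorem fold_alc {i : ℕ} (hi : i ≤ l) : (fold P γ J).alc i = foldMap P γ J i '' γ.alc i :=
  ofFun_alc _ _ hi

theorem fold_fc {i : ℕ} (hi : i ≤ l + 1) :
    (fold P γ J).fc i = foldMap P γ J (i - 1) '' γ.fc i :=
  ofFun_fc _ _ hi

theorem fold_fc_succ {i : ℕ} (hi : i ≤ l) :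
    (fold P γ J).fc (i + 1) = foldMap P γ J i '' γ.fc (i + 1) :=
  fold_fc (by omega)

theorem foldMap_eq_one {i : ℕ} (h : ∀ j ∈ J, i ≤ j) : foldMap P γ J i = 1 := by
  induction i with
  | zero => rfl
  | succ i ih =>
    rw [foldMap_succ_of_notMem, ih fun j hj => (h j hj).trans' (by omega)]
    intro hi
    have := h i hi
    omega

theorem foldMap_insert {a i : ℕ} (h : ∀ j ∈ J, a < j) (hai : a < i) :
    foldMap P γ (insert a J) i = faceReflection P (γ.fc (a + 1)) * foldMap P γ J i := by
  induction i, (show a + 1 ≤ i from hai) using Nat.le_induction with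
  | base =>
    rw [foldMap_succ_of_mem (Set.mem_insert a J), foldMap_eq_one (i := a + 1) h,
      foldMap_eq_one, one_mul, mul_one]
    rintro j (rfl | hj)
    · rfl
    · exact (h j hj).le
  | succ i hi ih =>
    by_cases hiJ : i ∈ J
    · rw [foldMap_succ_of_mem hiJ, foldMap_succ_of_mem (Set.mem_insert_of_mem a hiJ), ih hi,
        mul_assoc]
    · rw [foldMap_succ_of_notMem hiJ, foldMap_succ_of_notMem, ih hi]
      rintro (rfl | h')
      · omega
      · exact hiJ h'

/-- The flip at the largest position is carried out first, so when position `a` is reached its wall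
has not moved; the flip multiplies all later maps on the left by the original wall reflection. -/
theorem foldr_tailFlip {L : List (Fin l)} (hL : L.Pairwise (· < ·)) :
    L.foldr (tailFlip P) γ = fold P γ ((fun j : Fin l => (j : ℕ)) '' {j | j ∈ L}) := by
  induction L with
  | nil =>
    have h1 : ∀ i, foldMap P γ ((fun j : Fin l => (j : ℕ)) '' {j | j ∈ []}) i = 1 :=
      fun i => foldMap_eq_one (by simp)
    refine eq_of_fc_alc (fun i hi => ?_) fun i hi => ?_
    · rw [fold_fc hi, h1]
      exact (Set.image_id _).symm
    · rw [fold_alc hi, h1]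
      exact (Set.image_id _).symm
  | cons a L ih =>
    rw [List.pairwise_cons] at hL
    rw [List.foldr_cons, ih hL.2]
    set J : Set ℕ := (fun j : Fin l => (j : ℕ)) '' {j | j ∈ L} with hJ
    have hJa : ∀ j ∈ J, (a : ℕ) < j := by
      rintro - ⟨j, hj, rfl⟩
      exact hL.1 j hj
    have hins : (fun j : Fin l => (j : ℕ)) '' {j | j ∈ a :: L} = insert (a : ℕ) J := by
      rw [hJ, ← Set.image_insert_eq]
      congr 1
      ext j
      simp
    rw [hins]
    have h1 : ∀ i ≤ (a : ℕ), foldMap P γ J i = 1 := fun i hi =>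
      foldMap_eq_one fun j hj => hi.trans (hJa j hj).le
    have h2 : ∀ i ≤ (a : ℕ), foldMap P γ (insert (a : ℕ) J) i = 1 := fun i hi =>
      foldMap_eq_one fun j hj => by
        rcases hj with rfl | hj
        · exact hi
        · exact hi.trans (hJa j hj).le
    have hwall : (fold P γ J).wall a = γ.fc (a + 1) := by
      rw [wall_eq, fold_fc_succ a.2.le, h1 _ le_rfl]
      exact Set.image_id _
    have e1 : ∀ i ≤ l + 1, (tailFlip P a (fold P γ J)).fc i = if i ≤ (a : ℕ) + 1 then
        (fold P γ J).fc i else faceReflection P (γ.fc (a + 1)) '' (fold P γ J).fc i := by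
      intro i hi
      rw [← hwall, show i = ((⟨i, by omega⟩ : Fin (l + 2)) : ℕ) from rfl, ← face_eq, ← face_eq]
      rfl
    have e2 : ∀ i ≤ l, (tailFlip P a (fold P γ J)).alc i = if i ≤ (a : ℕ) then
        (fold P γ J).alc i else faceReflection P (γ.fc (a + 1)) '' (fold P γ J).alc i := by
      intro i hi
      rw [← hwall, show i = ((⟨i, by omega⟩ : Fin (l + 1)) : ℕ) from rfl, ← alcove_eq, ← alcove_eq]
      rfl
    refine eq_of_fc_alc (fun i hi => ?_) fun i hi => ?_
    · rw [e1 i hi, fold_fc hi, fold_fc hi]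
      split_ifs with hia
      · rw [h1 _ (by omega), h2 _ (by omega)]
      · rw [foldMap_insert hJa (by omega), Set.image_image]
        rfl
    · rw [e2 i hi, fold_alc hi, fold_alc hi]
      split_ifs with hia
      · rw [h1 _ hia, h2 _ hia]
      · rw [foldMap_insert hJa (by omega), Set.image_image]
        rfl

theorem foldMap_linear_succ_of_mem {i : ℕ} (hi : i ∈ J) :
    (foldMap P γ J (i + 1)).linear =
      (foldMap P γ J i).linear * linearFaceReflection P (γ.fc (i + 1)) := by
  rw [foldMap_succ_of_mem hi]
  rfl

theorem foldMap_eq_mul {n i : ℕ} {K : Set ℕ} (hK : ∀ j, j ∈ K ↔ j ∈ J ∧ n ≤ j) (hi : n ≤ i) :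
    foldMap P γ J i = foldMap P γ J n * foldMap P γ K i := by
  induction i, hi using Nat.le_induction with
  | base => rw [foldMap_eq_one (J := K) fun j hj => ((hK j).1 hj).2, mul_one]
  | succ i hi ih =>
    by_cases hiJ : i ∈ J
    · rw [foldMap_succ_of_mem hiJ, foldMap_succ_of_mem ((hK i).2 ⟨hiJ, hi⟩), ih, mul_assoc]
    · rw [foldMap_succ_of_notMem hiJ, foldMap_succ_of_notMem fun h => hiJ ((hK i).1 h).1, ih]

/-- The list of partial products is the list of values of the linear part of `foldMap`, which
changes only at positions in `J`; so the chain condition can be checked position by position. -/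
theorem isAdmissibleFolding_iff {γ' : GallerySeq V l} :
    γ.IsAdmissibleFolding b γ' ↔ ∃ J ⊆ Set.Iio l, γ' = fold P γ J ∧
      ∀ i ∈ J, BruhatCovers b (foldMap P γ J (i + 1)).linear (foldMap P γ J i).linear := by
  have key : ∀ (L : List (Fin l)) (J : Set ℕ), L.Pairwise (· < ·) →
      J = (fun j : Fin l => (j : ℕ)) '' {j | j ∈ L} →
      (IsSaturatedIncreasing b (L.scanl (fun w j => w * linearFaceReflection P (γ.wall j)) 1) ↔
      ∀ i ∈ J, BruhatCovers b (foldMap P γ J (i + 1)).linear (foldMap P γ J i).linear) := by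
    intro L J hL hJ
    have hmem : ∀ j : Fin l, (j : ℕ) ∈ J ↔ j ∈ L := by
      intro j
      rw [hJ]
      constructor
      · rintro ⟨i, hi, hij⟩
        rwa [← Fin.ext hij]
      · exact fun h => ⟨j, h, rfl⟩
    have := isChain_scanl_iff (R := fun w u => BruhatCovers b u w)
      (f := fun w j => w * linearFaceReflection P (γ.wall j))
      (w := fun i => (foldMap P γ J i).linear) hL (n := 0) (fun _ _ => Nat.zero_le _)
      (fun j _ hj => by
        rw [foldMap_succ_of_notMem]
        rwa [hmem])
      (fun j hj => by
        rw [foldMap_linear_succ_of_mem ((hmem j).2 hj), wall_eq])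
    refine Iff.trans this ⟨fun h i hi => ?_, fun h j hj => h j ((hmem j).2 hj)⟩
    have hi' := hi
    rw [hJ] at hi'
    obtain ⟨j, hj, rfl⟩ := hi'
    exact h j hj
  constructor
  · rintro ⟨L, hL, rfl, hc⟩
    refine ⟨_, ?_, foldr_tailFlip hL, (key L _ hL rfl).1 hc⟩
    rintro - ⟨j, -, rfl⟩
    exact j.2
  · classical
    rintro ⟨J, hJl, rfl, hc⟩
    have hL : ((List.finRange l).filter fun j : Fin l => decide ((j : ℕ) ∈ J)).Pairwise (· < ·) :=
      (List.pairwise_lt_finRange l).filter _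
    have hJ : J = (fun j : Fin l => (j : ℕ)) ''
        {j | j ∈ (List.finRange l).filter fun j : Fin l => decide ((j : ℕ) ∈ J)} := by
      ext i
      constructor
      · exact fun hi => ⟨⟨i, hJl hi⟩, by simpa using hi, rfl⟩
      · rintro ⟨j, hj, rfl⟩
        simpa using hj
    exact ⟨_, hL, by rw [foldr_tailFlip hL, ← hJ], (key _ J hL hJ).2 hc⟩

section

variable (h : γ.IsGal b μ)
include h

theorem foldMap_mem {i : ℕ} (hi : i ≤ l) : foldMap P γ J i ∈ affineWeylGroup P := by
  induction i with
  | zero => exact one_mem _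
  | succ i ih =>
    by_cases hiJ : i ∈ J
    · rw [foldMap_succ_of_mem hiJ]
      exact mul_mem (ih (by omega)) (image_faceReflection_mem (h.codimOne i hi))
    · rw [foldMap_succ_of_notMem hiJ]
      exact ih (by omega)

theorem foldMap_linear_mem {i : ℕ} (hi : i ≤ l) : (foldMap P γ J i).linear ∈ weylGroup P :=
  linear_mem_weylGroup (foldMap_mem h hi)

theorem foldMap_succ_image {i : ℕ} (hi : i < l) :
    foldMap P γ J (i + 1) '' γ.fc (i + 1) = foldMap P γ J i '' γ.fc (i + 1) := by
  by_cases hiJ : i ∈ J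
  · rw [foldMap_succ_of_mem hiJ]
    have := faceReflection_image_face (h.codimOne i hi)
    conv_rhs => rw [← this, Set.image_image]
    rfl
  · rw [foldMap_succ_of_notMem hiJ]

theorem isGal_fold : (fold P γ J).IsGal b (foldMap P γ J l μ) := by
  have hmem : ∀ {i}, i ≤ l → foldMap P γ J i ∈ arrangementGroup P := fun hi =>
    affineWeylGroup_le (foldMap_mem h hi)
  refine ⟨fun i hi => ?_, fun i hi => ?_, fun i hi => ?_, fun i hi => ?_, ?_, ?_, ?_, ?_, ?_⟩
  · rw [fold_alc hi]
    exact isAlcove_image (hmem hi) (h.isAlcove i hi)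
  · rw [fold_fc_succ hi.le]
    exact isCodimOne_image (hmem hi.le) (h.codimOne i hi)
  · rw [fold_fc_succ hi.le, fold_alc hi.le]
    exact isFaceOf_image (hmem hi.le) (h.isAlcove i hi.le) (h.left i hi)
  · rw [fold_fc_succ hi.le, fold_alc hi, ← foldMap_succ_image h hi]
    exact isFaceOf_image (hmem hi) (h.isAlcove _ hi) (h.right i hi)
  · rw [fold_fc (by omega), h.zero]
    exact Set.image_singleton
  · rw [fold_alc (by omega)]
    have := h.zero_of
    rwa [show foldMap P γ J 0 '' γ.alc 0 = γ.alc 0 from Set.image_id _]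
  · obtain ⟨σ, c, hσ⟩ := hmem le_rfl
    intro α
    obtain ⟨n, hn⟩ := h.isWeight (σ⁻¹ α)
    refine ⟨n + c (σ⁻¹ α), ?_⟩
    have := hσ.1 (σ⁻¹ α) μ
    rw [perm_apply_inv] at this
    rw [this, hn]
    push_cast
    rfl
  · rw [fold_fc_succ le_rfl, h.last, Set.image_singleton]
  · rw [fold_alc le_rfl, ← Set.image_singleton]
    exact isFaceOf_image (hmem le_rfl) (h.isAlcove l le_rfl) h.last_of

theorem foldMap_apply_zero (h0 : IsNearZero b γ) {i : ℕ} (hi : i ≤ numPos b) :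
    foldMap P γ J i 0 = 0 := by
  have hl := h0.le
  induction i with
  | zero => rfl
  | succ i ih =>
    by_cases hiJ : i ∈ J
    · have hr : faceReflection P (γ.fc (i + 1)) 0 = 0 := by
        obtain ⟨α, k, -, h1⟩ := (h.codimOne i (by omega)).exists_isPos b
        have hk := eq_zero_of_zero_mem_faceClosure (h.left i (by omega)).1 (h0.wall i hi) h1.1
        rw [h1.faceReflection_eq]
        exact affineReflection_eq_self (by rw [hk]; simp)
      rw [foldMap_succ_of_mem hiJ]
      change foldMap P γ J i (faceReflection P (γ.fc (i + 1)) 0) = 0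
      rw [hr, ih (by omega)]
    · rw [foldMap_succ_of_notMem hiJ, ih (by omega)]

theorem isNearZero_fold (h0 : IsNearZero b γ) : IsNearZero b (fold P γ J) := by
  have hl := h0.le
  have hmem : ∀ {i}, i ≤ l → foldMap P γ J i ∈ arrangementGroup P := fun hi =>
    affineWeylGroup_le (foldMap_mem h hi)
  refine ⟨hl, fun i hi => ?_, fun i hi => ?_⟩
  · rw [fold_alc (by omega)]
    exact zero_mem_faceClosure_image (h.isAlcove i (by omega)).isFace (hmem (by omega))
      (foldMap_apply_zero h h0 hi) (h0.alc i hi)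
  · rw [fold_fc_succ (by omega)]
    exact zero_mem_faceClosure_image (h.left i (by omega)).1 (hmem (by omega))
      (foldMap_apply_zero h h0 (by omega)) (h0.wall i hi)

/-- The reflection in a folded wall is conjugate to that in the original wall. This converts the
right multiplications of an admissible chain into the left multiplications of a companion. -/
theorem linearFaceReflection_fold {i : ℕ} (hi : i < l) :
    linearFaceReflection P ((fold P γ J).fc (i + 1)) * (foldMap P γ J i).linear =
      (foldMap P γ J i).linear * linearFaceReflection P (γ.fc (i + 1)) := by
  rw [fold_fc_succ hi.le]
  exact congrArg AffineEquiv.linear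
    (faceReflection_image (affineWeylGroup_le (foldMap_mem h hi.le)) (h.codimOne i hi))

end

theorem IsShortest.fold_alc_eq_iff (h : IsShortest b γ μ) {i : ℕ} (hi : i < l) :
    (fold P γ J).alc i = (fold P γ J).alc (i + 1) ↔ i ∈ J := by
  rw [fold_alc hi.le, fold_alc hi, h.alc_succ hi]
  by_cases hiJ : i ∈ J
  · refine iff_of_true ?_ hiJ
    have := faceReflection_mul_self (h.codimOne i hi)
    rw [foldMap_succ_of_mem hiJ, Set.image_image]
    refine Set.image_congr fun x _ => ?_
    change _ = foldMap P γ J i ((faceReflection P (γ.fc (i + 1)) *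
      faceReflection P (γ.fc (i + 1))) x)
    rw [this]
    rfl
  · refine iff_of_false (fun h' => ?_) hiJ
    rw [foldMap_succ_of_notMem hiJ] at h'
    exact faceReflection_image_ne (h.codimOne i hi) (h.isAlcove i hi.le)
      ((Set.image_injective.2 (foldMap P γ J i).injective) h').symm

end Fold

/-! ### Reconstruction of a gallery from its type and its folds. -/

section Unique

/-- A gallery is determined by its type, its first alcove and the positions of its folds. -/
theorem GallerySeq.IsGal.eq_of_type_eq [P.IsIrreducible] {γ' : GallerySeq V l} {μ' : V}
    (h : γ.IsGal b μ) (h' : γ'.IsGal b μ') (hne : (fundamentalAlcove b).Nonempty)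
    (htype : γ.type b = γ'.type b) {g : V ≃ᵃ[ℝ] V} (hg : g ∈ affineWeylGroup P)
    (h0 : γ.alc 0 = g '' fundamentalAlcove b) (h0' : γ'.alc 0 = γ.alc 0)
    (hfold : ∀ i < l, γ.alc i = γ.alc (i + 1) ↔ γ'.alc i = γ'.alc (i + 1)) : γ = γ' := by
  have htype' : ∀ i ≤ l + 1, faceType b (γ.fc i) = faceType b (γ'.fc i) := by
    intro i hi
    have := congrFun (congrArg Prod.fst htype) ⟨i, by omega⟩
    simp only [type, face_eq] at this
    exact this
  have hface : ∀ i ≤ l, (∃ g ∈ affineWeylGroup P, γ.alc i = g '' fundamentalAlcove b) →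
      γ'.alc i = γ.alc i → IsFaceOf P (γ.fc (i + 1)) (γ.alc i) →
      IsFaceOf P (γ'.fc (i + 1)) (γ'.alc i) → γ.fc (i + 1) = γ'.fc (i + 1) := by
    rintro i hi ⟨g, hg, hgi⟩ heq hF hF'
    rw [heq] at hF'
    rw [hgi] at hF hF'
    exact eq_of_faceType_eq hne hg hF hF' (htype' _ (by omega))
  have halc : ∀ i ≤ l, (∃ g ∈ affineWeylGroup P, γ.alc i = g '' fundamentalAlcove b) ∧
      γ'.alc i = γ.alc i := by
    intro i hi
    induction i with
    | zero => exact ⟨⟨g, hg, h0⟩, h0'⟩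
    | succ i ih =>
      obtain ⟨hgi, heq⟩ := ih (by omega)
      have hF := hface i (by omega) hgi heq (h.left i hi) (h'.left i hi)
      by_cases hi' : γ.alc i = γ.alc (i + 1)
      · rw [← hi', ← (hfold i hi).1 hi']
        exact ⟨hgi, heq⟩
      -- Where neither gallery is folded, the next alcove is forced to be the reflection of the
      -- current one in the common wall.
      · have e1 := (eq_or_eq_faceReflection_image (h.codimOne i hi) (h.isAlcove i (by omega))
          (h.isAlcove _ hi) (h.left i hi) (h.right i hi)).resolve_left fun h => hi' h.symm
        have e2 := (eq_or_eq_faceReflection_image (h'.codimOne i hi) (h'.isAlcove i (by omega))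
          (h'.isAlcove _ hi) (h'.left i hi) (h'.right i hi)).resolve_left
            fun h => hi' ((hfold i hi).2 h.symm)
        refine ⟨?_, by rw [e1, e2, hF, heq]⟩
        obtain ⟨g, hg, hgi⟩ := hgi
        refine ⟨faceReflection P (γ.fc (i + 1)) * g,
          mul_mem (image_faceReflection_mem (h.codimOne i hi)) hg, ?_⟩
        rw [e1, hgi, Set.image_image]
        rfl
  refine eq_of_fc_alc (fun i hi => ?_) fun i hi => (halc i hi).2.symm
  rcases i with _ | i
  · rw [h.zero, h'.zero]
  obtain ⟨hgi, heq⟩ := halc i (by omega)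
  rcases Nat.lt_or_eq_of_le (show i ≤ l by omega) with hil | rfl
  · exact hface i (by omega) hgi heq (h.left i hil) (h'.left i hil)
  · refine hface i le_rfl hgi heq ?_ ?_
    · rw [h.last]
      exact h.last_of
    · rw [h'.last]
      exact h'.last_of

end Unique

end Alcoves

namespace Alcoves

open GallerySeq

variable {ι V V' : Type*} [AddCommGroup V] [Module ℝ V] [AddCommGroup V'] [Module ℝ V']
  [Finite ι] {P : RootPairing ι ℝ V V'} [P.IsRootSystem] [P.IsCrystallographic] [P.IsReduced]
  {b : P.Base} {l : ℕ} {γ : GallerySeq V l} {μ : V}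

theorem image_sub_eq (v : V) (A : Set V) : (fun x => x - v) '' A = translation (-v) '' A := by
  refine Set.image_congr fun x _ => ?_
  rw [AffineEquiv.constVAdd_apply, vadd_eq_add, neg_add_eq_sub]

theorem IsWeight.neg {v : V} (hv : IsWeight P v) : IsWeight P (-v) := by
  intro α
  obtain ⟨n, hn⟩ := hv α
  exact ⟨-n, by rw [map_neg, hn]; simp⟩

/-! ### The transformation `t`: minimality, types and companions. -/

section Transformation

theorem t_alc (h : γ.IsGal b μ) {j : ℕ} (hj : j ≤ l - numPos b) :
    (γ.t b).alc j = translation (-μ) '' γ.alc (l - j) := by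
  have : (γ.t b).alc j = (γ.t b).alcove ⟨j, by omega⟩ := by rw [alcove_eq]
  rw [this, ← image_sub_eq, ← h.weight_eq]
  change _ '' γ.alcove _ = _
  rw [alcove_eq]

theorem t_fc (h : γ.IsGal b μ) {j : ℕ} (hj : j ≤ l - numPos b) :
    (γ.t b).fc j = translation (-μ) '' γ.fc (l + 1 - j) := by
  have : (γ.t b).fc j = (γ.t b).face ⟨j, by omega⟩ := by rw [face_eq]
  rw [this, ← image_sub_eq, ← h.weight_eq]
  simp only [t, if_pos hj]
  rw [face_eq]

theorem t_fc_last (h : γ.IsGal b μ) :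
    (γ.t b).fc (l - numPos b + 1) = translation (-μ) '' {0} := by
  have : (γ.t b).fc (l - numPos b + 1) = (γ.t b).face ⟨l - numPos b + 1, by omega⟩ := by
    rw [face_eq]
  rw [this, ← image_sub_eq, ← h.weight_eq, ← h.zero]
  simp only [t, if_neg (show ¬ l - numPos b + 1 ≤ l - numPos b by omega)]
  rw [face_eq]
  rfl

theorem isGal_t (h : γ.IsGal b μ) (h0 : IsNearZero b γ) : (γ.t b).IsGal b (-μ) := by
  have hl := h0.le
  have ht : translation (-μ) ∈ arrangementGroup P := translation_mem h.isWeight.neg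
  have hsub : ∀ {j}, j < l - numPos b → l + 1 - (j + 1) = l - (j + 1) + 1 := by omega
  have hμ : translation (-μ) '' {μ} = ({0} : Set V) := by simp
  have h00 : translation (-μ) '' ({0} : Set V) = {-μ} := by simp
  refine ⟨fun j hj => ?_, fun j hj => ?_, fun j hj => ?_, fun j hj => ?_, ?_, ?_,
    h.isWeight.neg, ?_, ?_⟩
  · rw [t_alc h hj]
    exact isAlcove_image ht (h.isAlcove _ (by omega))
  · rw [t_fc h (by omega), hsub hj]
    exact isCodimOne_image ht (h.codimOne _ (by omega))
  · rw [t_fc h (by omega), hsub hj, t_alc h hj.le, show l - j = l - (j + 1) + 1 by omega]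
    exact isFaceOf_image ht (h.isAlcove _ (by omega)) (h.right _ (by omega))
  · rw [t_fc h (by omega), hsub hj, t_alc h hj]
    exact isFaceOf_image ht (h.isAlcove _ (by omega)) (h.left _ (by omega))
  · rw [t_fc h (by omega), Nat.sub_zero, h.last, hμ]
  · rw [t_alc h (by omega), Nat.sub_zero, ← hμ]
    exact isFaceOf_image ht (h.isAlcove _ le_rfl) h.last_of
  · rw [t_fc_last h, h00]
  · rw [t_alc h le_rfl, ← h00, Nat.sub_sub_self hl]
    exact isFaceOf_image ht (h.isAlcove _ hl) (isFaceOf_zero (h.isAlcove _ hl) (h0.alc _ le_rfl))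

/-- Reversal matches position `j` of the transform with position `l - 1 - j` of the gallery. -/
theorem t_alc_eq_iff (h : γ.IsGal b μ) {j : ℕ} (hj : j < l - numPos b) :
    (γ.t b).alc j = (γ.t b).alc (j + 1) ↔ γ.alc (l - 1 - j) = γ.alc (l - 1 - j + 1) := by
  rw [t_alc h hj.le, t_alc h hj, (Set.image_injective.2 (translation (-μ)).injective).eq_iff,
    show l - j = l - 1 - j + 1 by omega, show l - (j + 1) = l - 1 - j by omega]
  exact eq_comm

theorem isMinimal_t [Nonempty ι] (h : IsShortest b γ μ) (h0 : IsNearZero b γ)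
    (hμ : ∀ α, b.IsPos α → P.coroot' α μ < 0) : (γ.t b).IsMinimal b := by
  have hl := h0.le
  have hg := h.toIsGal
  have ht := isGal_t hg h0
  obtain ⟨a, k, hak⟩ := hg.exists_isLabelling
  refine ⟨ht.isGallery, fun j hj => ?_, fun j α k' hw => ?_⟩
  · have hj2 := j.2
    rw [FoldedAt, alcove_eq, alcove_eq, Fin.val_castSucc, Fin.val_succ, t_alc_eq_iff hg hj2] at hj
    exact h.alc_ne (by omega) hj.symm
  · have hj2 := j.2
    rw [ht.weight_eq, map_neg]
    rw [wall_eq, t_fc hg hj2] at hw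
    set i := l - 1 - (j : ℕ) with hi
    rw [show l + 1 - ((j : ℕ) + 1) = i + 1 by omega] at hw
    obtain ⟨m, hm⟩ := hg.isWeight α
    -- Undoing the translation shifts the level by `m = (μ, α^∨)`. For positive `α`, the bounds `m <
    -- k' + m < 0` become `0 < k' < -m`.
    have hw' : γ.fc (i + 1) ⊆ hyperplane P α (k' + m) := by
      intro x hx
      have h1 : P.coroot' α (translation (-μ) x) = k' := hw ⟨x, hx, rfl⟩
      rw [AffineEquiv.constVAdd_apply, vadd_eq_add, map_add, map_neg, hm] at h1
      change P.coroot' α x = _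
      push_cast
      linarith
    rcases isPos_or_isPos_negIdx b α with hα | hα
    · have h1 := h.wall_range (by omega) hα hw' (hμ α hα)
      have h2 := ne_zero_of_subset h h0 hak (by omega) (by omega) hα hw'
      have h3 : ((k' + m : ℤ) : ℝ) < 0 := by exact_mod_cast lt_of_le_of_ne h1.2 h2
      left
      rw [hm] at h1 ⊢
      push_cast at h1 h3
      constructor <;> linarith [h1.1]
    · have hw'' := (((hg.codimOne i (by omega)).onlyHyperplane hw').neg).1
      have h1 := h.wall_range (by omega) hα hw'' (hμ _ hα)
      have h2 := ne_zero_of_subset h h0 hak (by omega) (by omega) hα hw''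
      have h3 : ((-(k' + m) : ℤ) : ℝ) < 0 := by exact_mod_cast lt_of_le_of_ne h1.2 h2
      right
      rw [coroot'_negIdx, hm] at h1
      rw [hm]
      push_cast at h1 h3
      constructor <;> linarith [h1.1]

variable [P.IsIrreducible]

theorem affine_sub_eq (u : V ≃ᵃ[ℝ] V) (x y : V) : u x - u y = u.linear (x - y) := by
  rw [affine_apply u x, affine_apply u y, map_sub, add_sub_add_right_eq_sub]

theorem translation_mul_self_eq (u : V ≃ᵃ[ℝ] V) (v : V) :
    translation (-u v) * u = u.linear.toAffineEquiv * translation (-v) := by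
  ext x
  change translation (-u v) (u x) = u.linear (translation (-v) x)
  rw [AffineEquiv.constVAdd_apply, AffineEquiv.constVAdd_apply, vadd_eq_add, vadd_eq_add,
    neg_add_eq_sub, neg_add_eq_sub, affine_sub_eq]

/-- Moving both face and end by affine Weyl group elements changes the translated face only by an
element of that group, since weight translations normalise it; and types are invariant. -/
theorem faceType_translation {u w : V ≃ᵃ[ℝ] V} (hu : u ∈ affineWeylGroup P)
    (hw : w ∈ affineWeylGroup P) {v : V} (hv : IsWeight P v) (F : Set V) :
    faceType b (translation (-u v) '' (w '' F)) = faceType b (translation (-v) '' F) := by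
  have h1 : translation (-u v) * w =
      u.linear.toAffineEquiv * (translation (-v) * (u⁻¹ * w) * (translation (-v))⁻¹) *
        translation (-v) := by
    rw [mul_assoc, mul_assoc, inv_mul_cancel, mul_one, ← mul_assoc, ← translation_mul_self_eq]
    group
  have h2 := mul_mem (toAffineEquiv_mem (linear_mem_weylGroup hu))
    (translation_conj_mem hv.neg (mul_mem (inv_mem hu) hw))
  rw [← faceType_image (b := b) h2 (F := translation (-v) '' F), Set.image_image, Set.image_image]
  change faceType b ((translation (-u v) * w) '' F) = _
  rw [h1]
  rfl

variable {J : Set ℕ}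

theorem type_t_fold (h : γ.IsGal b μ) (h0 : IsNearZero b γ) :
    ((fold P γ J).t b).type b = (γ.t b).type b := by
  have hl := h0.le
  have hf := isGal_fold (J := J) h
  have hlast := foldMap_mem (J := J) h le_rfl
  refine Prod.ext ?_ ?_
  · funext j
    have hj := j.2
    simp only [type, face_eq]
    rcases Nat.lt_or_ge (l - numPos b) j with hj' | hj'
    · rw [show (j : ℕ) = l - numPos b + 1 by omega, t_fc_last h, t_fc_last hf]
      have := faceType_translation (b := b) hlast (one_mem _) h.isWeight {0}
      rwa [show (1 : V ≃ᵃ[ℝ] V) '' {0} = {0} from Set.image_id _] at this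
    · rw [t_fc h hj', t_fc hf hj', fold_fc (by omega)]
      exact faceType_translation hlast (foldMap_mem h (by omega)) h.isWeight _
  · funext j
    have hj := j.2
    simp only [type, alcove_eq]
    rw [t_alc h (by omega), t_alc hf (by omega), fold_alc (by omega)]
    exact faceType_translation hlast (foldMap_mem h (by omega)) h.isWeight _

/-- The unfolded last alcove is `μ + A_∘`; after translating the new end to the origin, only the
linear part of the total folding map still acts. -/
theorem t_fold_alc_zero (h : IsShortest b γ μ) (hμ : ∀ α, b.IsPos α → P.coroot' α μ < 0) :
    ((fold P γ J).t b).alc 0 = (foldMap P γ J l).linear '' fundamentalAlcove b := by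
  rw [t_alc (isGal_fold h.toIsGal) (by omega), Nat.sub_zero, fold_alc le_rfl,
    ← h.image_alc_last hμ, image_sub_eq, Set.image_image, Set.image_image]
  exact congrArg (fun g : V ≃ᵃ[ℝ] V => g '' γ.alc l) (translation_mul_self_eq _ μ)

theorem linearFaceReflection_translation {v : V} (hv : IsWeight P v) {F : Set V}
    (hF : IsCodimOne P F) :
    linearFaceReflection P (translation v '' F) = linearFaceReflection P F := by
  have := congrArg AffineEquiv.linear (faceReflection_image (translation_mem hv) hF)
  change (faceReflection P (translation v '' F)).linear * 1 = 1 * (faceReflection P F).linear at this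
  rwa [mul_one, one_mul] at this

theorem linearFaceReflection_mul_self {F : Set V} (hF : IsCodimOne P F) :
    linearFaceReflection P F * linearFaceReflection P F = 1 :=
  congrArg AffineEquiv.linear (faceReflection_mul_self hF)

/-- The companion of the transform of a folded gallery is a saturated decreasing chain if and only
if the folds after the first part of the gallery are along covers. -/
theorem companion_t_fold_iff (h : IsShortest b γ μ) (h0 : IsNearZero b γ)
    (hμ : ∀ α, b.IsPos α → P.coroot' α μ < 0) (hJ : J ⊆ Set.Iio l) :
    (∃ L, ((fold P γ J).t b).IsCompanion b L ∧ IsSaturatedDecreasing b L) ↔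
      ∀ i ∈ J, numPos b ≤ i →
        BruhatCovers b (foldMap P γ J (i + 1)).linear (foldMap P γ J i).linear := by
  classical
  have hl := h0.le
  have hg := h.toIsGal
  have hf := isGal_fold (J := J) hg
  set δ := (fold P γ J).t b with hδ
  have hsort : δ.foldList.Pairwise (· < ·) := (List.pairwise_lt_finRange _).filter _
  have hmem : ∀ j : Fin (l - numPos b), j ∈ δ.foldList ↔ l - 1 - j ∈ J := by
    intro j
    have hj := j.2
    rw [foldList, List.mem_filter, decide_eq_true_eq, FoldedAt, alcove_eq, alcove_eq,
      Fin.val_castSucc, Fin.val_succ, hδ, t_alc_eq_iff hf hj, h.fold_alc_eq_iff (by omega)]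
    simp
  have h00 : δ.alcove 0 = (foldMap P γ J l).linear '' fundamentalAlcove b := by
    rw [alcove_eq]
    exact t_fold_alc_zero h hμ
  have hchain := isChain_scanl_iff (R := fun u w => BruhatCovers b u w)
    (f := fun u j => linearFaceReflection P (δ.wall j) * u)
    -- The companion is the sequence of partial products in reverse: by conjugation, the left factor
    -- at each fold cancels the last right factor.
    (w := fun j => (foldMap P γ J (l - j)).linear) hsort (n := 0) (fun _ _ => Nat.zero_le _)
    (fun j _ hj => by
      have hj2 := j.2
      rw [hmem] at hj
      rw [show l - (j : ℕ) = l - 1 - j + 1 by omega, foldMap_succ_of_notMem hj,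
        show l - ((j : ℕ) + 1) = l - 1 - j by omega])
    (fun j hj => by
      have hj2 := j.2
      rw [hmem] at hj
      have hw : linearFaceReflection P (δ.wall j) =
          linearFaceReflection P ((fold P γ J).fc (l - 1 - j + 1)) := by
        rw [wall_eq, hδ, t_fc hf hj2, show l + 1 - ((j : ℕ) + 1) = l - 1 - j + 1 by omega]
        exact linearFaceReflection_translation hf.isWeight.neg (hf.codimOne _ (by omega))
      have hi : l - 1 - (j : ℕ) < l := by omega
      rw [hw, show l - (j : ℕ) = l - 1 - j + 1 by omega, foldMap_linear_succ_of_mem hj, ← mul_assoc,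
        linearFaceReflection_fold hg hi, mul_assoc,
        linearFaceReflection_mul_self (hg.codimOne _ hi), mul_one,
        show l - ((j : ℕ) + 1) = l - 1 - j by omega])
  have hcov : (∀ j ∈ δ.foldList, BruhatCovers b (foldMap P γ J (l - j)).linear
      (foldMap P γ J (l - (j + 1))).linear) ↔ ∀ i ∈ J, numPos b ≤ i →
        BruhatCovers b (foldMap P γ J (i + 1)).linear (foldMap P γ J i).linear := by
    constructor
    · intro hc i hi hNi
      have hil : i < l := hJ hi
      have := hc ⟨l - 1 - i, by omega⟩ ((hmem _).2 (by
        rwa [show l - 1 - (l - 1 - i) = i by omega]))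
      rwa [show l - (l - 1 - i) = i + 1 by omega, show l - (l - 1 - i + 1) = i by omega] at this
    · intro hc j hj
      have hj2 := j.2
      have := hc _ ((hmem j).1 hj) (by omega)
      rwa [show l - 1 - (j : ℕ) + 1 = l - j by omega,
        show l - 1 - (j : ℕ) = l - (j + 1) by omega] at this
  rw [← hcov, ← hchain]
  constructor
  · rintro ⟨L, ⟨u, hu, hu0, rfl⟩, hL⟩
    rw [h00] at hu0
    rwa [eq_of_image_fundamentalAlcove_eq h.nonempty hu (foldMap_linear_mem hg le_rfl) hu0] at hL
  · exact fun hL => ⟨_, ⟨_, foldMap_linear_mem hg le_rfl, h00.symm, rfl⟩, hL⟩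

end Transformation

end Alcoves

namespace Alcoves

open GallerySeq

variable {ι V V' : Type*} [AddCommGroup V] [Module ℝ V] [AddCommGroup V'] [Module ℝ V']
  [Finite ι] {P : RootPairing ι ℝ V V'} [P.IsRootSystem] [P.IsCrystallographic] [P.IsReduced]
  {b : P.Base} {l : ℕ} {γ : GallerySeq V l} {μ : V} {J : Set ℕ}

/-! ### Recovering the folds that `t` forgets. -/

section Bijection

theorem BruhatCovers.ne {u w : V ≃ₗ[ℝ] V} (h : BruhatCovers b u w) : u ≠ w := by
  rintro rfl
  have := h.2.2.2
  omega

variable {α : ℕ → ι} {k : ℕ → ℤ}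

theorem linearFaceReflection_eq_label (hα : IsLabelling b γ α k) {i : ℕ} (hi : i < l) :
    linearFaceReflection P (γ.fc (i + 1)) = P.reflection (α i) := by
  rw [linearFaceReflection, (hα.only i hi).faceReflection_eq, affineReflection_linear]

theorem isIncreasingChain_foldMap (h0 : IsNearZero b γ)
    (hα : IsLabelling b γ α k) (hJ : ∀ i ∈ J,
      BruhatCovers b (foldMap P γ J (i + 1)).linear (foldMap P γ J i).linear) :
    IsIncreasingChain b (numPos b) α fun i => (foldMap P γ J i).linear := by
  have hl := h0.le
  refine ⟨rfl, fun i hi => ?_⟩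
  by_cases hiJ : i ∈ J
  · refine Or.inr ⟨?_, (hJ i hiJ).2.2.2⟩
    change (foldMap P γ J (i + 1)).linear = _
    rw [foldMap_linear_succ_of_mem hiJ, linearFaceReflection_eq_label hα (by omega)]
  · left
    change (foldMap P γ J (i + 1)).linear = _
    rw [foldMap_succ_of_notMem hiJ]

theorem foldMap_linear_eq_of_isIncreasingChain (h0 : IsNearZero b γ)
    (hα : IsLabelling b γ α k) {w : ℕ → V ≃ₗ[ℝ] V} (hw : IsIncreasingChain b (numPos b) α w)
    (hJ : ∀ i < numPos b, i ∈ J ↔ w (i + 1) ≠ w i) {i : ℕ} (hi : i ≤ numPos b) :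
    (foldMap P γ J i).linear = w i := by
  have hl := h0.le
  induction i with
  | zero => exact hw.zero.symm
  | succ i ih =>
    by_cases hiJ : i ∈ J
    · have := (hw.step i hi).resolve_left ((hJ i hi).1 hiJ)
      rw [foldMap_linear_succ_of_mem hiJ, linearFaceReflection_eq_label hα (by omega),
        ih (by omega), this.1]
    · rw [foldMap_succ_of_notMem hiJ, ih (by omega)]
      by_contra h
      exact hiJ ((hJ i hi).2 fun h' => h h'.symm)

variable [P.IsIrreducible]

theorem mem_iff_of_t_fold_eq (h : IsShortest b γ μ) {J' : Set ℕ}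
    (heq : (fold P γ J).t b = (fold P γ J').t b) {i : ℕ} (hi : numPos b ≤ i) (hil : i < l) :
    i ∈ J ↔ i ∈ J' := by
  have hg := h.toIsGal
  have h1 : ∀ J : Set ℕ, (((fold P γ J).t b).alc (l - 1 - i) =
      ((fold P γ J).t b).alc (l - 1 - i + 1) ↔ i ∈ J) := by
    intro J
    rw [t_alc_eq_iff (isGal_fold hg) (by omega), show l - 1 - (l - 1 - i) = i by omega,
      h.fold_alc_eq_iff hil]
  rw [← h1 J, ← h1 J', heq]

/-- An admissible set of folding positions is determined by the transformed gallery. -/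
theorem eq_of_t_fold_eq (h : IsShortest b γ μ) (h0 : IsNearZero b γ)
    (hμ : ∀ α, b.IsPos α → P.coroot' α μ < 0) {J' : Set ℕ} (hJl : J ⊆ Set.Iio l)
    (hJl' : J' ⊆ Set.Iio l)
    (hJ : ∀ i ∈ J, BruhatCovers b (foldMap P γ J (i + 1)).linear (foldMap P γ J i).linear)
    (hJ' : ∀ i ∈ J', BruhatCovers b (foldMap P γ J' (i + 1)).linear (foldMap P γ J' i).linear)
    (heq : (fold P γ J).t b = (fold P γ J').t b) : J = J' := by
  have hl := h0.le
  have hg := h.toIsGal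
  have : Nonempty ι := nonempty_index P
  obtain ⟨α, k, hα⟩ := hg.exists_isLabelling
  obtain ⟨x, hx⟩ := exists_isReflectionOrder h h0 hα
  have hend : (foldMap P γ J l).linear = (foldMap P γ J' l).linear := by
    refine eq_of_image_fundamentalAlcove_eq h.nonempty (foldMap_linear_mem hg le_rfl)
      (foldMap_linear_mem hg le_rfl) ?_
    rw [← t_fold_alc_zero h hμ, ← t_fold_alc_zero h hμ, heq]
  -- The positions `≥ N` are visible in the transform, so both sets have the same part `K` there.
  -- Cancelling its product from the equal totals leaves equal partial products at `N`, where
  -- uniqueness of increasing chains applies.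
  let K : Set ℕ := {i | i ∈ J ∧ numPos b ≤ i}
  have hKJ' : ∀ j, j ∈ K ↔ j ∈ J' ∧ numPos b ≤ j := by
    intro j
    constructor
    · exact fun hj => ⟨(mem_iff_of_t_fold_eq h heq hj.2 (hJl hj.1)).1 hj.1, hj.2⟩
    · exact fun hj => ⟨(mem_iff_of_t_fold_eq h heq hj.2 (hJl' hj.1)).2 hj.1, hj.2⟩
  have hmid : (foldMap P γ J (numPos b)).linear = (foldMap P γ J' (numPos b)).linear := by
    have e1 := foldMap_eq_mul (P := P) (γ := γ) (J := J) (K := K) (fun _ => Iff.rfl) hl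
    have e2 := foldMap_eq_mul (P := P) (γ := γ) (J := J') (K := K) hKJ' hl
    rw [e1, e2] at hend
    exact mul_right_cancel (b := (foldMap P γ K l).linear) hend
  have hchain := fun {i} => (isIncreasingChain_foldMap h0 hα hJ).eq_of_eq hx
    (isIncreasingChain_foldMap h0 hα hJ') hmid (i := i)
  have hmem : ∀ {J : Set ℕ}, (∀ i ∈ J, BruhatCovers b (foldMap P γ J (i + 1)).linear
      (foldMap P γ J i).linear) → ∀ i, i ∈ J ↔
      (foldMap P γ J (i + 1)).linear ≠ (foldMap P γ J i).linear := by
    intro J hJ i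
    refine ⟨fun hi => (hJ i hi).ne, fun hne => ?_⟩
    by_contra hi
    rw [foldMap_succ_of_notMem hi] at hne
    exact hne rfl
  ext i
  rcases lt_or_ge i (numPos b) with hi | hi
  · have e1 : (foldMap P γ J (i + 1)).linear = (foldMap P γ J' (i + 1)).linear := hchain hi
    have e2 : (foldMap P γ J i).linear = (foldMap P γ J' i).linear := hchain hi.le
    rw [hmem hJ, hmem hJ', e1, e2]
  · constructor
    · exact fun hj => (mem_iff_of_t_fold_eq h heq hi (hJl hj)).1 hj
    · exact fun hj => (mem_iff_of_t_fold_eq h heq hi (hJl' hj)).2 hj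

/-- Every LS-gallery is the transform of an admissible folding. -/
theorem exists_t_fold_eq (h : IsShortest b γ μ) (h0 : IsNearZero b γ)
    (hμ : ∀ α, b.IsPos α → P.coroot' α μ < 0) {δ : GallerySeq V (l - numPos b)}
    (hδ : δ ∈ (γ.t b).lsGalleries b) : ∃ J ⊆ Set.Iio l, (fold P γ J).t b = δ ∧
      ∀ i ∈ J, BruhatCovers b (foldMap P γ J (i + 1)).linear (foldMap P γ J i).linear := by
  have hl := h0.le
  have hg := h.toIsGal
  have : Nonempty ι := nonempty_index P
  obtain ⟨α, k, hα⟩ := hg.exists_isLabelling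
  obtain ⟨x, hx⟩ := exists_isReflectionOrder h h0 hα
  obtain ⟨hδg, htype, L, ⟨u, hu, hu0, hL⟩, hdec⟩ := hδ
  rw [alcove_eq] at hu0
  let K : Set ℕ := {i | numPos b ≤ i ∧ i < l ∧ δ.alc (l - 1 - i) = δ.alc (l - 1 - i + 1)}
  have hK1 := foldMap_linear_mem (J := K) hg le_rfl
  -- The total product must be `u`, and the folds seen in `δ` contribute the last factor; the
  -- increasing chain supplies the rest using the first `N` walls.
  obtain ⟨w, hw, hwN⟩ := exists_isIncreasingChain hx (mul_mem hu (inv_mem hK1))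
  let J : Set ℕ := {i | i < numPos b ∧ w (i + 1) ≠ w i} ∪ K
  have hJl : J ⊆ Set.Iio l := by
    rintro i (hi | hi)
    · exact Set.mem_Iio.2 (hi.1.trans_le hl)
    · exact hi.2.1
  have hJ1 : ∀ i < numPos b, i ∈ J ↔ w (i + 1) ≠ w i := by
    intro i hi
    constructor
    · rintro (h1 | h1)
      · exact h1.2
      · have := h1.1
        omega
    · exact fun h1 => Or.inl ⟨hi, h1⟩
  have hJ2 : ∀ i, i ∈ K ↔ i ∈ J ∧ numPos b ≤ i := by
    intro i
    constructor
    · exact fun hi => ⟨Or.inr hi, hi.1⟩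
    · rintro ⟨h1 | h1, h2⟩
      · have := h1.1
        omega
      · exact h1
  have hlin := fun {i} => foldMap_linear_eq_of_isIncreasingChain h0 hα hw hJ1 (i := i)
  have hend : (foldMap P γ J l).linear = u := by
    rw [foldMap_eq_mul hJ2 hl]
    change (foldMap P γ J (numPos b)).linear * (foldMap P γ K l).linear = u
    rw [hlin le_rfl, hwN, inv_mul_cancel_right]
  have hf := isGal_fold (J := J) hg
  have heq : (fold P γ J).t b = δ := by
    refine (isGal_t hf (isNearZero_fold hg h0)).eq_of_type_eq hδg.isGal h.nonempty
      ((type_t_fold hg h0).trans htype.symm) (toAffineEquiv_mem hu) ?_ ?_ fun i hi => ?_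
    · rw [t_fold_alc_zero h hμ, hend]
      rfl
    · rw [t_fold_alc_zero h hμ, hend]
      exact hu0.symm
    · rw [t_alc_eq_iff hf hi, h.fold_alc_eq_iff (by omega)]
      have h1 : l - 1 - i ∈ J ↔ l - 1 - i ∈ K := by
        rw [hJ2]
        exact ⟨fun h => ⟨h, by omega⟩, fun h => h.1⟩
      rw [h1]
      change (_ ∧ _ ∧ _) ↔ _
      rw [show l - 1 - (l - 1 - i) = i by omega]
      exact ⟨fun h => h.2.2, fun h => ⟨by omega, by omega, h⟩⟩
  refine ⟨J, hJl, heq, fun i hi => ?_⟩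
  rcases lt_or_ge i (numPos b) with hiN | hiN
  · rw [hlin hiN.le, hlin hiN]
    have h1 := (hw.step i hiN).resolve_left ((hJ1 i hiN).1 hi)
    refine ⟨hw.mem hiN, hw.mem hiN.le, ⟨α i, hα.isPos i (by omega), ?_⟩, h1.2⟩
    rw [h1.1, mul_assoc, reflection_mul_self, mul_one]
  -- Covers at the late positions come from the companion of `δ`; those at the early positions are
  -- the steps of the increasing chain.
  · refine (companion_t_fold_iff h h0 hμ hJl).1 ⟨L, ?_, hdec⟩ i hi hiN
    rw [heq]
    refine ⟨u, hu, ?_, hL⟩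
    rw [alcove_eq]
    exact hu0

end Bijection

end Alcoves

end

/-! ### The proposition. -/

open Alcoves in
theorem proposition18p9 {ι V V' : Type*} [Finite ι] [AddCommGroup V] [Module ℝ V]
    [AddCommGroup V'] [Module ℝ V'] (P : RootPairing ι ℝ V V') [P.IsRootSystem]
    [P.IsCrystallographic] [P.IsReduced] [P.IsIrreducible] (b : P.Base)
    (lam : V) (hweight : IsWeight P lam) (hdominant : IsDominant b lam) (hregular : IsRegular P lam)
    {l : ℕ} (γ : GallerySeq V l) (hreduced : γ.IsReduced b) (hspecial : γ.IsSpecial b)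
    (hγ : γ.weight = -lam) :
    (∀ γ' : GallerySeq V l, γ.IsAdmissibleFolding b γ' → γ'.IsSpecial b) ∧
    ((γ.t b).IsMinimal b ∧ (γ.t b).weight = lam) ∧
    Set.BijOn (fun γ' : GallerySeq V l => γ'.t b)
      {γ' | γ.IsAdmissibleFolding b γ'} ((γ.t b).lsGalleries b) ∧
    ∀ γ' : GallerySeq V l, γ.IsAdmissibleFolding b γ' → (γ'.t b).weight = -γ'.weight := by
  have h := hreduced.isShortest
  rw [hγ] at h
  have hg := h.toIsGal
  obtain ⟨-, h0⟩ := isSpecial_iff.1 hspecial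
  -- Regularity makes the antidominance of `-lam` strict, which fixes the last alcove of `γ`.
  have hμ : ∀ α, b.IsPos α → P.coroot' α (-lam) < 0 := fun α hα => by
    rw [map_neg, neg_lt_zero]
    exact lt_of_le_of_ne (hdominant α hα) (hregular α).symm
  have : Nonempty ι := nonempty_index P
  refine ⟨fun γ' hγ' => ?_, ⟨isMinimal_t h h0 hμ, ?_⟩, ⟨fun γ' hγ' => ?_, ?_, ?_⟩, fun γ' hγ' => ?_⟩
  · obtain ⟨J, -, rfl, -⟩ := isAdmissibleFolding_iff.1 hγ'
    exact isSpecial_iff.2 ⟨(isGal_fold hg).isGallery, isNearZero_fold hg h0⟩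
  · rw [(isGal_t hg h0).weight_eq, neg_neg]
  · obtain ⟨J, hJ, rfl, hc⟩ := isAdmissibleFolding_iff.1 hγ'
    exact ⟨(isGal_t (isGal_fold hg) (isNearZero_fold hg h0)).isGallery, type_t_fold hg h0,
      (companion_t_fold_iff h h0 hμ hJ).2 fun i hi _ => hc i hi⟩
  · intro γ₁ h₁ γ₂ h₂ heq
    obtain ⟨J₁, hJ₁, rfl, hc₁⟩ := isAdmissibleFolding_iff.1 h₁
    obtain ⟨J₂, hJ₂, rfl, hc₂⟩ := isAdmissibleFolding_iff.1 h₂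
    rw [eq_of_t_fold_eq h h0 hμ hJ₁ hJ₂ hc₁ hc₂ heq]
  · intro δ hδ
    obtain ⟨J, hJ, heq, hc⟩ := exists_t_fold_eq h h0 hμ hδ
    exact ⟨fold P γ J, isAdmissibleFolding_iff.2 ⟨J, hJ, rfl, hc⟩, heq⟩
  · obtain ⟨J, -, rfl, -⟩ := isAdmissibleFolding_iff.1 hγ'
    have hf := isGal_fold (J := J) hg
    rw [(isGal_t hf (isNearZero_fold hg h0)).weight_eq, hf.weight_eq]
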